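/- Let $\Omega\subset\mathbb C$ be a Borel set, $\lambda$ Lebesgue measure, and $\mathcal B=\mathcal B(L^2(\Omega,\lambda))$. For $f\in L^\infty(\Omega,\lambda)$ let $M_f\in\mathcal B$ be multiplication by $f$ and $Df(s,t)=\frac{f(s)-f(t)}{s-t}$ $(s\neq t)$, and let $\Lambda(\Omega)=\{f\in L^\infty(\Omega,\lambda): Df\in L^\infty(\Omega\times\Omega,\lambda\otimes\lambda)\}$. With $|\cdot|_2$ the Hilbert--Schmidt norm (equal to $\infty$ for operators that are not Hilbert--Schmidt), put, for $T\in\mathcal B$, $$L(T)=\sup\{|[M_f,T]|_2 : f\in\Lambda(\Omega),\ \|Df\|_\infty\le 1\},\qquad |||T|||=\|T\|+L(T).$$ Let $E\Lambda(\Omega)=\{T\in\mathcal B: L(T)<\infty\}$, a $*$-subalgebra of $\mathcal B$, and let $K\Lambda(\Omega)$ be the two-sided ideal of $E\Lambda(\Omega)$ consisting of the compact operators in $E\Lambda(\Omega)$. For $n\in\mathbb N$ let $n\mathbb D=\{z\in\mathbb C:|z|<n\}$, and for $\Omega_1\subset\Omega$ let $i(\Omega,\Omega_1)(T)=T\oplus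 0$ with respect to $L^2(\Omega)=L^2(\Omega_1)\oplus L^2(\Omega\setminus\Omega_1)$. Then there are self-adjoint projections $P_n\in K\Lambda(\Omega)$ of finite rank such that: (a) $P_n\uparrow I$ (that is, $P_n\le P_{n+1}$ for all $n$ and $P_n\to I$ strongly), and $L(P_n)\to 0$; (b) $P_n\in i(\Omega,\Omega\cap n\mathbb D)\bigl(E\Lambda(\Omega\cap n\mathbb D)\bigr)$ for all $n$, and $[P_n,M_{\chi_{\Omega\cap m\mathbb D}}]=0$ for all $n,m\in\mathbb N$; (c) $(P_n)$ is a bounded approximate unit of $K\Lambda(\Omega)$: $\sup_n|||P_n|||<\infty$, and $|||P_nT-T|||\to0$ and $|||TP_n-T|||\to0$ for every $T\in K\Lambda(\Omega)$; (d) $\bigcup_n P_n\mathcal B(L^2(\Omega,\lambda))P_n$ is a subalgebra of $K\Lambda(\Omega)$ which is dense in $K\Lambda(\Omega)$ in the norm $|||\cdot|||$. -/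

import Mathlib

open MeasureTheory Filter Topology
open scoped ENNReal NNReal InnerProductSpace

noncomputable section

namespace LipAlg

/-! ### The Hilbert-Schmidt norm -/

section HilbertSchmidt

variable {H : Type*} [NormedAddCommGroup H] [InnerProductSpace ℂ H]

/-- The square of the Hilbert-Schmidt norm of a bounded operator, with values in `[0, ∞]`: the
supremum of `∑ ‖T e‖²` over the finite orthonormal families. By `hsSq_eq_tsum` below it is
`∑ i, ‖T (b i)‖²` for every Hilbert basis `b`. -/
def hsSq (T : H →L[ℂ] H) : ℝ≥0∞ :=
  ⨆ (s : Finset H) (_ : Orthonormal ℂ (fun x : s => (x : H))), ∑ x ∈ s, ‖T x‖ₑ ^ 2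

/-- The Hilbert-Schmidt norm `|T|₂ ∈ [0, ∞]`; the value is `∞` if `T` is not Hilbert-Schmidt. -/
def hsNorm (T : H →L[ℂ] H) : ℝ≥0∞ := hsSq T ^ (1 / 2 : ℝ)

/-- Parseval's identity. -/
theorem enorm_sq_eq_tsum {ι : Type*} (b : HilbertBasis ι ℂ H) (x : H) :
    ‖x‖ₑ ^ 2 = ∑' i, ‖⟪b i, x⟫_ℂ‖ₑ ^ 2 := by
  have h := b.hasSum_inner_mul_inner x x
  have h2 : HasSum (fun i => ‖⟪b i, x⟫_ℂ‖ ^ 2) (‖x‖ ^ 2) := by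
    have h3 := (Complex.hasSum_re h)
    have e : ∀ i, (⟪x, b i⟫_ℂ * ⟪b i, x⟫_ℂ).re = ‖⟪b i, x⟫_ℂ‖ ^ 2 := by
      intro i
      rw [← inner_conj_symm x (b i), ← Complex.normSq_eq_conj_mul_self, Complex.ofReal_re,
        Complex.normSq_eq_norm_sq]
    simp only [e] at h3
    have e2 : (⟪x, x⟫_ℂ).re = ‖x‖ ^ 2 := by
      rw [inner_self_eq_norm_sq_to_K]; norm_cast
    rwa [e2] at h3
  have h4 : ∀ y : ℝ, 0 ≤ y → ENNReal.ofReal (y ^ 2) = (ENNReal.ofReal y) ^ 2 :=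
    fun y hy => ENNReal.ofReal_pow hy 2
  rw [← ofReal_norm, ← h4 _ (norm_nonneg _), ← h2.tsum_eq,
    ENNReal.ofReal_tsum_of_nonneg (fun i => by positivity) h2.summable]
  congr 1; ext i
  rw [← ofReal_norm, ← h4 _ (norm_nonneg _)]

/-- Bessel's inequality. -/
theorem bessel_enorm (s : Finset H) (hs : Orthonormal ℂ (fun x : s => (x : H))) (y : H) :
    ∑ x ∈ s, ‖⟪x, y⟫_ℂ‖ₑ ^ 2 ≤ ‖y‖ₑ ^ 2 := by
  have h := hs.sum_inner_products_le y (s := Finset.univ)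
  rw [Finset.univ_eq_attach, Finset.sum_attach s (fun x => ‖⟪x, y⟫_ℂ‖ ^ 2)] at h
  have := ENNReal.ofReal_le_ofReal h
  rw [ENNReal.ofReal_sum_of_nonneg (fun i _ => by positivity)] at this
  simpa [ENNReal.ofReal_pow, ofReal_norm] using this

theorem hsSq_le_of_basis [CompleteSpace H] {ι : Type*} (b : HilbertBasis ι ℂ H) (T : H →L[ℂ] H) :
    hsSq T ≤ ∑' i, ‖(ContinuousLinearMap.adjoint T) (b i)‖ₑ ^ 2 := by
  refine iSup₂_le fun s hs => ?_
  calc ∑ x ∈ s, ‖T x‖ₑ ^ 2 = ∑ x ∈ s, ∑' i, ‖⟪x, (ContinuousLinearMap.adjoint T) (b i)⟫_ℂ‖ₑ ^ 2 := by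
        refine Finset.sum_congr rfl fun x _ => ?_
        rw [enorm_sq_eq_tsum b]
        congr 1; ext i
        rw [ContinuousLinearMap.adjoint_inner_right, ← inner_conj_symm, RCLike.enorm_conj]
    _ = ∑' i, ∑ x ∈ s, ‖⟪x, (ContinuousLinearMap.adjoint T) (b i)⟫_ℂ‖ₑ ^ 2 :=
        (Summable.tsum_finsetSum (fun _ _ => ENNReal.summable)).symm
    _ ≤ _ := ENNReal.tsum_le_tsum fun i => bessel_enorm s hs _

theorem tsum_le_hsSq {ι : Type*} (b : HilbertBasis ι ℂ H) (T : H →L[ℂ] H) :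
    ∑' i, ‖T (b i)‖ₑ ^ 2 ≤ hsSq T := by
  classical
  rw [ENNReal.tsum_eq_iSup_sum]
  refine iSup_le fun t => ?_
  have inj : Function.Injective b := b.orthonormal.linearIndependent.injective
  have hs : Orthonormal ℂ (fun x : t.image b => (x : H)) := by
    have h1 := b.orthonormal.toSubtypeRange
    exact h1.comp (fun x : t.image b => (⟨x, by
      obtain ⟨i, _, hi⟩ := Finset.mem_image.1 x.2; exact ⟨i, hi⟩⟩ : Set.range b))
      (fun x y h => Subtype.ext (congrArg (fun z : Set.range b => (z : H)) h))
  refine le_trans (le_of_eq ?_) (le_iSup₂ (f := fun (s : Finset H)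
    (_ : Orthonormal ℂ (fun x : s => (x : H))) => ∑ x ∈ s, ‖T x‖ₑ ^ 2) (t.image b) hs)
  rw [Finset.sum_image (fun x _ y _ h => inj h)]

theorem hsNorm_neg (T : H →L[ℂ] H) : hsNorm (-T) = hsNorm T := by
  simp [hsNorm, hsSq]

theorem hsNorm_zero : hsNorm (0 : H →L[ℂ] H) = 0 := by
  simp [hsNorm, hsSq]

variable [CompleteSpace H]

theorem hsSq_adjoint_le (T : H →L[ℂ] H) : hsSq (star T) ≤ hsSq T := by
  obtain ⟨w, b, -⟩ := exists_hilbertBasis ℂ H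
  have h := hsSq_le_of_basis b (star T)
  rw [← ContinuousLinearMap.star_eq_adjoint, star_star] at h
  exact h.trans (tsum_le_hsSq b T)

theorem hsSq_star (T : H →L[ℂ] H) : hsSq (star T) = hsSq T :=
  le_antisymm (hsSq_adjoint_le T) (by simpa using hsSq_adjoint_le (star T))

theorem hsSq_eq_tsum {ι : Type*} (b : HilbertBasis ι ℂ H) (T : H →L[ℂ] H) :
    hsSq T = ∑' i, ‖T (b i)‖ₑ ^ 2 := by
  refine le_antisymm ?_ (tsum_le_hsSq b T)
  rw [← hsSq_star T]
  have h := hsSq_le_of_basis b (star T)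
  rwa [← ContinuousLinearMap.star_eq_adjoint, star_star] at h

theorem hsNorm_star (T : H →L[ℂ] H) : hsNorm (star T) = hsNorm T := by
  rw [hsNorm, hsSq_star, hsNorm]


theorem hsNorm_le_iff (T : H →L[ℂ] H) (c : ℝ≥0∞) : hsNorm T ≤ c ↔
    ∀ s : Finset H, Orthonormal ℂ (fun x : s => (x : H)) →
      (∑ x ∈ s, ‖T x‖ₑ ^ (2 : ℝ)) ^ (1 / 2 : ℝ) ≤ c := by
  have e : ∀ a : ℝ≥0∞, a ^ (1 / 2 : ℝ) ≤ c ↔ a ≤ c ^ (2 : ℝ) := fun a => by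
    rw [one_div]; exact ENNReal.rpow_inv_le_iff (by norm_num)
  simp only [hsNorm, e, hsSq, iSup_le_iff, ENNReal.rpow_ofNat]

theorem hsNorm_add_le (S T : H →L[ℂ] H) : hsNorm (S + T) ≤ hsNorm S + hsNorm T := by
  rw [hsNorm_le_iff]
  intro s hs
  refine le_trans ?_ (add_le_add ((hsNorm_le_iff S _).1 le_rfl s hs)
    ((hsNorm_le_iff T _).1 le_rfl s hs))
  refine le_trans ?_ (ENNReal.Lp_add_le s (fun x => ‖S x‖ₑ) (fun x => ‖T x‖ₑ) (by norm_num))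
  gcongr
  exact enorm_add_le _ _

theorem hsNorm_mul_le (S T : H →L[ℂ] H) : hsNorm (S * T) ≤ ‖S‖ₑ * hsNorm T := by
  rw [hsNorm_le_iff]
  intro s hs
  refine le_trans ?_ (mul_le_mul_right ((hsNorm_le_iff T _).1 le_rfl s hs) _)
  have : ∑ x ∈ s, ‖(S * T) x‖ₑ ^ (2 : ℝ) ≤ ‖S‖ₑ ^ (2 : ℝ) * ∑ x ∈ s, ‖T x‖ₑ ^ (2 : ℝ) := by
    rw [Finset.mul_sum]
    refine Finset.sum_le_sum fun x _ => ?_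
    rw [← ENNReal.mul_rpow_of_nonneg _ _ (by norm_num)]
    gcongr
    exact S.le_opENorm (T x)
  refine (ENNReal.rpow_le_rpow this (by norm_num)).trans (le_of_eq ?_)
  rw [ENNReal.mul_rpow_of_nonneg _ _ (by norm_num), ← ENNReal.rpow_mul]
  norm_num

theorem enorm_star_op (T : H →L[ℂ] H) : ‖star T‖ₑ = ‖T‖ₑ := by
  rw [← ofReal_norm, ← ofReal_norm, norm_star]

theorem hsNorm_mul_le' (S T : H →L[ℂ] H) : hsNorm (S * T) ≤ hsNorm S * ‖T‖ₑ := by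
  rw [← hsNorm_star, star_mul, mul_comm, ← enorm_star_op T, ← hsNorm_star S]
  exact hsNorm_mul_le _ _

end HilbertSchmidt

/-! ### The spaces, multiplication operators and essentially Lipschitz functions -/

/-- Lebesgue measure of `ℂ`, restricted to `Ω`. -/
abbrev leb (Ω : Set ℂ) : Measure ℂ := (volume : Measure ℂ).restrict Ω

/-- The Hilbert space `L²(Ω)`. -/
abbrev L2 (Ω : Set ℂ) : Type := Lp ℂ 2 (leb Ω)

/-- The bounded operators on `L²(Ω)`. -/
abbrev BL2 (Ω : Set ℂ) : Type := L2 Ω →L[ℂ] L2 Ω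

variable {Ω : Set ℂ}

/-- The operator `M_f` of multiplication by `f ∈ L^∞(Ω)` on `L²(Ω)`. -/
def mulOp (f : Lp ℂ ∞ (leb Ω)) : BL2 Ω :=
  (ContinuousLinearMap.mul ℂ ℂ).holderL (leb Ω) ∞ 2 2 f

theorem mulOp_apply_ae (f : Lp ℂ ∞ (leb Ω)) (g : L2 Ω) :
    mulOp f g =ᵐ[leb Ω] fun z => f z * g z :=
  (ContinuousLinearMap.mul ℂ ℂ).coeFn_holder f g

/-- The indicator function of `A ∩ Ω`, as an element of `L^∞(Ω)`. -/
def indLinf (Ω : Set ℂ) (A : Set ℂ) (hA : MeasurableSet A) : Lp ℂ ∞ (leb Ω) :=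
  MemLp.toLp (A.indicator fun _ => (1 : ℂ)) ((memLp_top_const (1 : ℂ)).indicator hA)

/-- The difference quotient `Df(s,t) = (f(s) - f(t)) / (s - t)`; its value on the diagonal, which
is a null set, is irrelevant. -/
def diffQuot (f : Lp ℂ ∞ (leb Ω)) (p : ℂ × ℂ) : ℂ := (f p.1 - f p.2) / (p.1 - p.2)

/-- The essential supremum `‖Df‖_∞ ∈ [0, ∞]` over `Ω × Ω`. -/
def lipNorm (f : Lp ℂ ∞ (leb Ω)) : ℝ≥0∞ := eLpNorm (diffQuot f) ∞ ((leb Ω).prod (leb Ω))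

/-- The essentially Lipschitz functions `Λ(Ω)`: the `f ∈ L^∞(Ω)` with `Df ∈ L^∞(Ω × Ω)`. -/
def essLip (Ω : Set ℂ) : Set (Lp ℂ ∞ (leb Ω)) :=
  {f | MemLp (diffQuot f) ∞ ((leb Ω).prod (leb Ω))}

/-- `L(T) = sup { |[M_f, T]|₂ : f ∈ Λ(Ω), ‖Df‖_∞ ≤ 1 } ∈ [0, ∞]`. -/
def lipL (T : BL2 Ω) : ℝ≥0∞ :=
  ⨆ f ∈ {f : Lp ℂ ∞ (leb Ω) | f ∈ essLip Ω ∧ lipNorm f ≤ 1}, hsNorm (mulOp f * T - T * mulOp f)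

theorem hsNorm_le_lipL (T : BL2 Ω) (f : Lp ℂ ∞ (leb Ω)) (hf : f ∈ essLip Ω) (h1 : lipNorm f ≤ 1) :
    hsNorm (mulOp f * T - T * mulOp f) ≤ lipL T :=
  le_iSup₂ (f := fun f (_ : f ∈ {f : Lp ℂ ∞ (leb Ω) | f ∈ essLip Ω ∧ lipNorm f ≤ 1}) =>
    hsNorm (mulOp f * T - T * mulOp f)) f ⟨hf, h1⟩

theorem lipL_add_le (S T : BL2 Ω) : lipL (S + T) ≤ lipL S + lipL T := by
  refine iSup₂_le fun f hf => ?_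
  have e : mulOp f * (S + T) - (S + T) * mulOp f
      = (mulOp f * S - S * mulOp f) + (mulOp f * T - T * mulOp f) := by noncomm_ring
  rw [e]
  exact (hsNorm_add_le _ _).trans
    (add_le_add (hsNorm_le_lipL S f hf.1 hf.2) (hsNorm_le_lipL T f hf.1 hf.2))

theorem lipL_mul_le (S T : BL2 Ω) : lipL (S * T) ≤ lipL S * ‖T‖ₑ + ‖S‖ₑ * lipL T := by
  refine iSup₂_le fun f hf => ?_
  have e : mulOp f * (S * T) - (S * T) * mulOp f
      = (mulOp f * S - S * mulOp f) * T + S * (mulOp f * T - T * mulOp f) := by noncomm_ring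
  rw [e]
  refine (hsNorm_add_le _ _).trans (add_le_add ((hsNorm_mul_le' _ _).trans ?_)
    ((hsNorm_mul_le _ _).trans ?_))
  · gcongr
    exact hsNorm_le_lipL S f hf.1 hf.2
  · gcongr
    exact hsNorm_le_lipL T f hf.1 hf.2

theorem lipL_algebraMap (c : ℂ) : lipL (algebraMap ℂ (BL2 Ω) c) = 0 := by
  refine le_antisymm (iSup₂_le fun f _ => ?_) zero_le
  rw [(Algebra.commutes c (mulOp f)).symm, sub_self, hsNorm_zero]

theorem measurable_diffQuot (f : Lp ℂ ∞ (leb Ω)) : Measurable (diffQuot f) := by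
  have hf : Measurable (f : ℂ → ℂ) := (Lp.stronglyMeasurable f).measurable
  exact ((hf.comp measurable_fst).sub (hf.comp measurable_snd)).div
    (measurable_fst.sub measurable_snd)

theorem diffQuot_star_ae (f : Lp ℂ ∞ (leb Ω)) :
    ∀ᵐ p ∂((leb Ω).prod (leb Ω)), ‖diffQuot (star f) p‖ = ‖diffQuot f p‖ := by
  have h1 := Measure.quasiMeasurePreserving_fst (μ := leb Ω) (ν := leb Ω) |>.ae (Lp.coeFn_star f)
  have h2 := Measure.quasiMeasurePreserving_snd (μ := leb Ω) (ν := leb Ω) |>.ae (Lp.coeFn_star f)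
  filter_upwards [h1, h2] with p hp1 hp2
  rw [diffQuot, diffQuot, hp1, hp2, Pi.star_apply, Pi.star_apply, ← star_sub, norm_div, norm_star,
    ← norm_div]

theorem lipNorm_star (f : Lp ℂ ∞ (leb Ω)) : lipNorm (star f) = lipNorm f :=
  eLpNorm_congr_norm_ae (diffQuot_star_ae f)

theorem star_mem_essLip {f : Lp ℂ ∞ (leb Ω)} (hf : f ∈ essLip Ω) : star f ∈ essLip Ω :=
  ⟨(measurable_diffQuot _).aestronglyMeasurable, (lipNorm_star f).trans_lt hf.2⟩

theorem star_mulOp (f : Lp ℂ ∞ (leb Ω)) : star (mulOp f) = mulOp (star f) := by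
  rw [ContinuousLinearMap.star_eq_adjoint]
  symm
  rw [ContinuousLinearMap.eq_adjoint_iff]
  intro g h
  rw [L2.inner_def, L2.inner_def]
  refine integral_congr_ae ?_
  filter_upwards [mulOp_apply_ae (star f) g, mulOp_apply_ae f h, Lp.coeFn_star f] with z h1 h2 h3
  rw [h1, h2, h3]
  simp
  ring

theorem lipL_star_le (T : BL2 Ω) : lipL (star T) ≤ lipL T := by
  refine iSup₂_le fun f hf => ?_
  have e : mulOp f * star T - star T * mulOp f
      = -star (mulOp (star f) * T - T * mulOp (star f)) := by
    rw [star_sub, star_mul, star_mul, star_mulOp, star_star]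
    noncomm_ring
  rw [e, hsNorm_neg, hsNorm_star]
  exact hsNorm_le_lipL T _ (star_mem_essLip hf.1) ((lipNorm_star f).trans_le hf.2)

/-! ### The algebras `EΛ(Ω)` and `KΛ(Ω)` -/

/-- The `*`-subalgebra `EΛ(Ω) = {T : L(T) < ∞}` of the bounded operators on `L²(Ω)`. -/
def EAlg (Ω : Set ℂ) : StarSubalgebra ℂ (BL2 Ω) where
  carrier := {T | lipL T < ∞}
  mul_mem' {S T} hS hT := (lipL_mul_le S T).trans_lt
    (ENNReal.add_lt_top.2 ⟨ENNReal.mul_lt_top hS enorm_lt_top, ENNReal.mul_lt_top enorm_lt_top hT⟩)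
  add_mem' {S T} hS hT := (lipL_add_le S T).trans_lt (ENNReal.add_lt_top.2 ⟨hS, hT⟩)
  algebraMap_mem' c := (lipL_algebraMap c).trans_lt ENNReal.zero_lt_top
  star_mem' {T} hT := (lipL_star_le T).trans_lt hT

theorem mem_EAlg (T : BL2 Ω) : T ∈ EAlg Ω ↔ lipL T < ∞ := Iff.rfl

/-- The norm `|||T||| = ‖T‖ + L(T)` of `EΛ(Ω)`, as a (finite) element of `[0, ∞]`. -/
def triNorm (T : EAlg Ω) : ℝ≥0∞ := ‖(T : BL2 Ω)‖ₑ + lipL (T : BL2 Ω)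

theorem triNorm_lt_top (T : EAlg Ω) : triNorm T < ∞ :=
  ENNReal.add_lt_top.2 ⟨enorm_lt_top, T.2⟩

/-- The two-sided ideal `KΛ(Ω)` of `EΛ(Ω)` that consists of the compact operators in `EΛ(Ω)`. -/
def KIdeal (Ω : Set ℂ) : TwoSidedIdeal (EAlg Ω) :=
  TwoSidedIdeal.mk' {T : EAlg Ω | IsCompactOperator (T : BL2 Ω)}
    isCompactOperator_zero
    (fun {S T} hS hT => IsCompactOperator.add (f := ((S : BL2 Ω) : L2 Ω → L2 Ω))
      (g := ((T : BL2 Ω) : L2 Ω → L2 Ω)) hS hT)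
    (fun {S} hS => IsCompactOperator.neg (f := ((S : BL2 Ω) : L2 Ω → L2 Ω)) hS)
    (fun {S T} hT => IsCompactOperator.clm_comp (f := ((T : BL2 Ω) : L2 Ω → L2 Ω)) hT (S : BL2 Ω))
    (fun {S T} hS => IsCompactOperator.comp_clm (f := ((S : BL2 Ω) : L2 Ω → L2 Ω)) hS (T : BL2 Ω))

theorem mem_KIdeal (T : EAlg Ω) : T ∈ KIdeal Ω ↔ IsCompactOperator (T : BL2 Ω) :=
  TwoSidedIdeal.mem_mk' _ _ _ _ _ _ T

/-! ### The inclusion of operators on `L²(Ω₁)` into operators on `L²(Ω₂)` -/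

/-- The restriction map `L²(Ω₂) → L²(Ω₁)`, `f ↦ f|Ω₁`, for `Ω₁ ⊆ Ω₂`. -/
def restrictL2 {Ω₁ Ω₂ : Set ℂ} (h : Ω₁ ⊆ Ω₂) : L2 Ω₂ →L[ℂ] L2 Ω₁ :=
  LinearMap.mkContinuous
    { toFun := fun f => ((Lp.memLp f).mono_measure (Measure.restrict_mono h le_rfl)).toLp f
      map_add' := fun f g => by
        rw [← MemLp.toLp_add]
        exact MemLp.toLp_congr _ _ ((Measure.absolutelyContinuous_of_le
          (Measure.restrict_mono h le_rfl)).ae_le (Lp.coeFn_add f g))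
      map_smul' := fun c f => by
        rw [RingHom.id_apply, ← MemLp.toLp_const_smul]
        exact MemLp.toLp_congr _ _ ((Measure.absolutelyContinuous_of_le
          (Measure.restrict_mono h le_rfl)).ae_le (Lp.coeFn_smul c f)) }
    1 (fun f => by
      rw [one_mul, LinearMap.coe_mk, AddHom.coe_mk, Lp.norm_toLp, Lp.norm_def]
      exact ENNReal.toReal_mono (Lp.eLpNorm_ne_top f)
        (eLpNorm_mono_measure f (Measure.restrict_mono h le_rfl)))

theorem restrictL2_apply_ae {Ω₁ Ω₂ : Set ℂ} (h : Ω₁ ⊆ Ω₂) (f : L2 Ω₂) :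
    restrictL2 h f =ᵐ[leb Ω₁] f :=
  MemLp.coeFn_toLp ((Lp.memLp f).mono_measure (Measure.restrict_mono h le_rfl))

/-- Extension by zero `L²(Ω₁) → L²(Ω₂)`, as the adjoint of the restriction map. -/
def extendL2 {Ω₁ Ω₂ : Set ℂ} (h : Ω₁ ⊆ Ω₂) : L2 Ω₁ →L[ℂ] L2 Ω₂ :=
  ContinuousLinearMap.adjoint (restrictL2 h)

theorem extendL2_apply_ae {Ω₁ Ω₂ : Set ℂ} (h : Ω₁ ⊆ Ω₂) (h₁ : MeasurableSet Ω₁) (f : L2 Ω₁) :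
    extendL2 h f =ᵐ[leb Ω₂] Ω₁.indicator f := by
  have hr : (leb Ω₂).restrict Ω₁ = leb Ω₁ := Measure.restrict_restrict_of_subset h
  have hm : MemLp (Ω₁.indicator f) 2 (leb Ω₂) := by
    rw [memLp_indicator_iff_restrict h₁, hr]; exact Lp.memLp f
  have e : extendL2 h f = hm.toLp := by
    refine ext_inner_left ℂ fun g => ?_
    rw [extendL2, ContinuousLinearMap.adjoint_inner_right, L2.inner_def, L2.inner_def]
    have h2 : ∫ z, ⟪g z, (hm.toLp : L2 Ω₂) z⟫_ℂ ∂(leb Ω₂) =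
        ∫ z, Ω₁.indicator (fun z => ⟪g z, f z⟫_ℂ) z ∂(leb Ω₂) := by
      refine integral_congr_ae ?_
      filter_upwards [hm.coeFn_toLp] with z hz
      rw [hz]
      by_cases hz1 : z ∈ Ω₁ <;> simp [hz1]
    rw [h2, integral_indicator h₁, hr]
    refine integral_congr_ae ?_
    filter_upwards [restrictL2_apply_ae h g] with z hz
    rw [hz]
  rw [e]
  exact hm.coeFn_toLp

/-- The inclusion `i(Ω₂, Ω₁)(T) = T ⊕ 0` with respect to `L²(Ω₂) = L²(Ω₁) ⊕ L²(Ω₂ \ Ω₁)`. -/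
def inclOp {Ω₁ Ω₂ : Set ℂ} (h : Ω₁ ⊆ Ω₂) (T : BL2 Ω₁) : BL2 Ω₂ :=
  extendL2 h ∘L T ∘L restrictL2 h

end LipAlg

end

/-!
The plane has dimension two: the indicator functions of dyadic cells of size `2⁻ⁱ` in a ball span a
space of dimension about `4ⁱ`, and a Lipschitz function is within `2⁻ⁱ` of one that is constant on
these cells. Hence its commutator with the projection `p i` onto that space has Hilbert-Schmidt norm
of order `2⁻ⁱ √(4ⁱ) = 1` for every `i`, and these commutators are almost orthogonal. A cutoff that
descends from `1` to `0` in `K` equal steps along `p 0 ≤ … ≤ p K` therefore has commutators whose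
squared Hilbert-Schmidt norm is of order `K * (1 / K) ^ 2 = 1 / K`. Written as `cos² θ`, the cutoff
becomes a projection when its range is rotated by the angle `θ` towards an orthogonal copy. Each
cell function is copied to another function living on the same cell, so that the partial isometry
onto the copy almost commutes with Lipschitz functions too.

For the approximate unit, the commutators `[M_f, X]` with a `1`-Lipschitz `f` are all dominated by
the single commutator `[M_z, X]`: on the block between two distant cells `M_f` and `M_z` act almost
as scalars, whose differences compare by the Lipschitz condition, and the blocks near the diagonal
carry arbitrarily little of a Hilbert-Schmidt operator once the cells are small. The Leibniz rule
then reduces `L (P n T - T) → 0` to `(P n - 1) [M_z, T] → 0` in Hilbert-Schmidt norm.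
-/

noncomputable section

namespace LipAlg

/-! ### Hilbert-Schmidt norms -/

section HilbertSchmidt

open InnerProductSpace (rankOne)

variable {H : Type*} [NormedAddCommGroup H] [InnerProductSpace ℂ H]

theorem enorm_sum_sq_of_orthogonal {ι : Type*} {s : Finset ι} {v : ι → H}
    (h : (s : Set ι).Pairwise fun i j => ⟪v i, v j⟫_ℂ = 0) :
    ‖∑ i ∈ s, v i‖ₑ ^ 2 = ∑ i ∈ s, ‖v i‖ₑ ^ 2 := by
  have inner_sum_self : ⟪∑ i ∈ s, v i, ∑ i ∈ s, v i⟫_ℂ = ∑ i ∈ s, ⟪v i, v i⟫_ℂ := by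
    rw [sum_inner]
    refine Finset.sum_congr rfl fun i hi => ?_
    rw [inner_sum, Finset.sum_eq_single_of_mem i hi]
    exact fun j hj hij => h hi hj hij.symm
  have norm_sq : ‖∑ i ∈ s, v i‖ ^ 2 = ∑ i ∈ s, ‖v i‖ ^ 2 := by
    simp only [inner_self_eq_norm_sq_to_K] at inner_sum_self
    exact_mod_cast inner_sum_self
  have e := congrArg ENNReal.ofReal norm_sq
  rw [ENNReal.ofReal_sum_of_nonneg (fun i _ => by positivity)] at e
  simpa [ENNReal.ofReal_pow, ofReal_norm] using e

theorem hsNorm_sq (T : H →L[ℂ] H) : hsNorm T ^ 2 = hsSq T := by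
  rw [hsNorm, ← ENNReal.rpow_natCast, ← ENNReal.rpow_mul]; norm_num

theorem hsNorm_le_iff_hsSq_le {T : H →L[ℂ] H} {c : ℝ≥0∞} : hsNorm T ≤ c ↔ hsSq T ≤ c ^ 2 := by
  rw [← hsNorm_sq, ENNReal.pow_le_pow_left_iff two_ne_zero]

theorem hsNorm_lt_top_iff {T : H →L[ℂ] H} : hsNorm T < ∞ ↔ hsSq T < ∞ := by
  rw [← hsNorm_sq]
  simp [lt_top_iff_ne_top]

theorem tendsto_hsNorm_zero_iff {α : Type*} {l : Filter α} {T : α → H →L[ℂ] H} :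
    Tendsto (fun n => hsNorm (T n)) l (𝓝 0) ↔ Tendsto (fun n => hsSq (T n)) l (𝓝 0) := by
  constructor <;> intro h
  · simpa [hsNorm_sq] using ENNReal.Tendsto.pow (n := 2) h
  · simpa [hsNorm] using h.ennrpow_const (1 / 2 : ℝ)

variable [CompleteSpace H]

theorem hsNorm_sub_le (S T : H →L[ℂ] H) : hsNorm (S - T) ≤ hsNorm S + hsNorm T := by
  rw [sub_eq_add_neg, ← hsNorm_neg T]
  exact hsNorm_add_le _ _

theorem hsNorm_sum_le {ι : Type*} (s : Finset ι) (T : ι → H →L[ℂ] H) :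
    hsNorm (∑ i ∈ s, T i) ≤ ∑ i ∈ s, hsNorm (T i) := by
  induction s using Finset.cons_induction with
  | empty => simp [hsNorm_zero]
  | cons i s hi ih =>
    rw [Finset.sum_cons, Finset.sum_cons]
    exact (hsNorm_add_le _ _).trans (by gcongr)

theorem hsNorm_mul_le_of_norm_le_left {S : H →L[ℂ] H} {r : ℝ} (h : ‖S‖ ≤ r) (T : H →L[ℂ] H) :
    hsNorm (S * T) ≤ ENNReal.ofReal r * hsNorm T := by
  refine (hsNorm_mul_le S T).trans ?_
  rw [← ofReal_norm]
  gcongr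

theorem hsNorm_mul_le_of_norm_le_right {T : H →L[ℂ] H} {r : ℝ} (h : ‖T‖ ≤ r)
    (S : H →L[ℂ] H) : hsNorm (S * T) ≤ ENNReal.ofReal r * hsNorm S := by
  refine (hsNorm_mul_le' S T).trans ?_
  rw [← ofReal_norm, mul_comm]
  gcongr

theorem hsNorm_mul_le_of_norm_le_one_left {S : H →L[ℂ] H} (h : ‖S‖ ≤ 1) (T : H →L[ℂ] H) :
    hsNorm (S * T) ≤ hsNorm T := by
  simpa using hsNorm_mul_le_of_norm_le_left h T

theorem hsNorm_mul_le_of_norm_le_one_right {T : H →L[ℂ] H} (h : ‖T‖ ≤ 1) (S : H →L[ℂ] H) :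
    hsNorm (S * T) ≤ hsNorm S := by
  simpa using hsNorm_mul_le_of_norm_le_right h S

theorem hsNorm_smul (c : ℂ) (T : H →L[ℂ] H) : hsNorm (c • T) = ‖c‖ₑ * hsNorm T := by
  obtain ⟨w, b, -⟩ := exists_hilbertBasis ℂ H
  refine (ENNReal.pow_right_strictMono two_ne_zero).injective ?_
  simp only [mul_pow, hsNorm_sq, hsSq_eq_tsum b, smul_apply, enorm_smul, ENNReal.tsum_mul_left]

theorem hsSq_sum_of_star_mul_eq_zero {ι : Type*} {s : Finset ι} {Y : ι → H →L[ℂ] H}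
    (h : (s : Set ι).Pairwise fun i j => star (Y i) * Y j = 0) :
    hsSq (∑ i ∈ s, Y i) = ∑ i ∈ s, hsSq (Y i) := by
  obtain ⟨w, b, -⟩ := exists_hilbertBasis ℂ H
  simp only [hsSq_eq_tsum b]
  rw [← Summable.tsum_finsetSum (fun _ _ => ENNReal.summable)]
  refine tsum_congr fun k => ?_
  rw [sum_apply]
  refine enorm_sum_sq_of_orthogonal fun i hi j hj hij => ?_
  change ⟪Y i (b k), Y j (b k)⟫_ℂ = 0
  rw [← ContinuousLinearMap.adjoint_inner_right, ← ContinuousLinearMap.star_eq_adjoint,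
    ← mul_apply_eq_comp, h hi hj hij, zero_apply, inner_zero_right]

theorem hsSq_sum_of_mul_star_eq_zero {ι : Type*} {s : Finset ι} {Y : ι → H →L[ℂ] H}
    (h : (s : Set ι).Pairwise fun i j => Y i * star (Y j) = 0) :
    hsSq (∑ i ∈ s, Y i) = ∑ i ∈ s, hsSq (Y i) := by
  rw [← hsSq_star, star_sum, hsSq_sum_of_star_mul_eq_zero]
  · simp only [hsSq_star]
  · intro i hi j hj hij
    rw [star_star, h hi hj hij]

theorem hsSq_add_of_star_mul_eq_zero {X Y : H →L[ℂ] H} (h : star X * Y = 0) :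
    hsSq (X + Y) = hsSq X + hsSq Y := by
  have h' : star Y * X = 0 := by simpa using congrArg star h
  have pairwise : ((Finset.univ : Finset Bool) : Set Bool).Pairwise
      fun i j => star (cond i X Y) * cond j X Y = 0 := by
    rintro (_ | _) - (_ | _) - hij <;> simp_all
  simpa using hsSq_sum_of_star_mul_eq_zero pairwise

theorem hsSq_rankOne (x y : H) : hsSq (rankOne ℂ x y) = ‖x‖ₑ ^ 2 * ‖y‖ₑ ^ 2 := by
  obtain ⟨w, b, -⟩ := exists_hilbertBasis ℂ H
  rw [hsSq_eq_tsum b, enorm_sq_eq_tsum b y, ← ENNReal.tsum_mul_left]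
  refine tsum_congr fun k => ?_
  rw [InnerProductSpace.rankOne_apply, enorm_smul, mul_pow, mul_comm, ← inner_conj_symm,
    RCLike.enorm_conj]

theorem tendsto_hsNorm_mul_of_strong {Z : H →L[ℂ] H} (hZ : hsNorm Z < ∞) {q : ℕ → H →L[ℂ] H}
    (hq : ∀ n, ‖q n‖ ≤ 1) (h : ∀ x, Tendsto (fun n => q n x) atTop (𝓝 0)) :
    Tendsto (fun n => hsNorm (q n * Z)) atTop (𝓝 0) := by
  obtain ⟨w, b, -⟩ := exists_hilbertBasis ℂ H
  let _ : MeasurableSpace w := ⊤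
  have hsSq_eq_lintegral : ∀ T : H →L[ℂ] H, hsSq T = ∫⁻ i, ‖T (b i)‖ₑ ^ 2 ∂Measure.count :=
    fun T => by rw [hsSq_eq_tsum b, lintegral_count]
  rw [hsNorm_lt_top_iff, hsSq_eq_lintegral] at hZ
  rw [tendsto_hsNorm_zero_iff]
  simp only [hsSq_eq_lintegral]
  rw [← lintegral_zero (μ := (Measure.count : Measure w))]
  refine tendsto_lintegral_filter_of_dominated_convergence (fun i => ‖Z (b i)‖ₑ ^ 2)
    (Eventually.of_forall fun n => measurable_from_top)
    (Eventually.of_forall fun n => Eventually.of_forall fun i => ?_) hZ.ne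
    (Eventually.of_forall fun i => ?_)
  · have norm_le := (q n).le_of_opNorm_le (hq n) (Z (b i))
    rw [one_mul] at norm_le
    gcongr
    exact enorm_le_iff_norm_le.2 norm_le
  · have enorm_tendsto : Tendsto (fun n => ‖q n (Z (b i))‖ₑ) atTop (𝓝 0) := by
      simpa using (h (Z (b i))).enorm
    simpa using ENNReal.Tendsto.pow (n := 2) enorm_tendsto

end HilbertSchmidt

/-! ### Flags of projections -/

section Flag

variable {R : Type*} [Ring R]

/-- An increasing sequence of projections, the order being expressed by `p i * p j = p i`. -/
structure IsFlag [StarRing R] (p : ℕ → R) : Prop where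
  isStarProjection : ∀ i, IsStarProjection (p i)
  mul_eq_left : ∀ {i j}, i ≤ j → p i * p j = p i

/-- The successive differences of a flag: pairwise orthogonal projections. -/
def flagBlock (p : ℕ → R) : ℕ → R
  | 0 => p 0
  | l + 1 => p (l + 1) - p l

/-- The operator that is diagonal along a flag, with the entry `a l` on the `l`-th block for
`l ≤ K` and `0` afterwards. -/
def flagDiag [Algebra ℂ R] (p : ℕ → R) (K : ℕ) (a : ℕ → ℝ) : R :=
  ∑ l ∈ Finset.range (K + 1), (a l : ℂ) • flagBlock p l

theorem sum_flagBlock (p : ℕ → R) (k : ℕ) :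
    ∑ l ∈ Finset.range (k + 1), flagBlock p l = p k := by
  induction k with
  | zero => simp [flagBlock]
  | succ k ih => rw [Finset.sum_range_succ, ih]; simp [flagBlock]

namespace IsFlag

variable [StarRing R] {p : ℕ → R}

theorem star_eq (hp : IsFlag p) (i : ℕ) : star (p i) = p i :=
  (hp.isStarProjection i).isSelfAdjoint

theorem mul_eq_right (hp : IsFlag p) {i j : ℕ} (hij : i ≤ j) : p j * p i = p i := by
  simpa [hp.star_eq] using congrArg star (hp.mul_eq_left hij)

theorem shift (hp : IsFlag p) (n : ℕ) : IsFlag fun i => p (n + i) :=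
  ⟨fun i => hp.isStarProjection (n + i), fun hij => hp.mul_eq_left (Nat.add_le_add_left hij n)⟩

theorem star_block (hp : IsFlag p) (l : ℕ) : star (flagBlock p l) = flagBlock p l := by
  cases l <;> simp [flagBlock, hp.star_eq]

theorem mul_block (hp : IsFlag p) (i l : ℕ) :
    p i * flagBlock p l = if l ≤ i then flagBlock p l else 0 := by
  cases l with
  | zero => simp [flagBlock, hp.mul_eq_right (Nat.zero_le i)]
  | succ l =>
    simp only [flagBlock, mul_sub]
    split_ifs with h
    · rw [hp.mul_eq_right h, hp.mul_eq_right (by lia)]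
    · rw [hp.mul_eq_left (by lia), hp.mul_eq_left (by lia), sub_self]

theorem block_mul (hp : IsFlag p) (i l : ℕ) :
    flagBlock p l * p i = if l ≤ i then flagBlock p l else 0 := by
  have e := congrArg star (hp.mul_block i l)
  rw [star_mul, hp.star_block, hp.star_eq] at e
  rw [e]
  split_ifs <;> simp [hp.star_block]

theorem block_mul_block (hp : IsFlag p) (l m : ℕ) :
    flagBlock p l * flagBlock p m = if l = m then flagBlock p l else 0 := by
  cases m with
  | zero => cases l <;> simp [flagBlock, hp.mul_eq_left, hp.mul_eq_right, sub_mul]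
  | succ m =>
    rw [flagBlock, mul_sub, hp.block_mul, hp.block_mul]
    split_ifs <;> first | lia | simp

theorem isStarProjection_block (hp : IsFlag p) (l : ℕ) : IsStarProjection (flagBlock p l) :=
  ⟨by simp [IsIdempotentElem, hp.block_mul_block], hp.star_block l⟩

variable [Algebra ℂ R]

theorem star_diag [StarModule ℂ R] (hp : IsFlag p) (K : ℕ) (a : ℕ → ℝ) :
    star (flagDiag p K a) = flagDiag p K a := by
  simp [flagDiag, star_sum, star_smul, hp.star_block]

theorem diag_mul_diag (hp : IsFlag p) (K : ℕ) (a b : ℕ → ℝ) :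
    flagDiag p K a * flagDiag p K b = flagDiag p K (fun l => a l * b l) := by
  rw [flagDiag, flagDiag, flagDiag, Finset.sum_mul]
  refine Finset.sum_congr rfl fun l hl => ?_
  rw [Finset.mul_sum, Finset.sum_eq_single_of_mem l hl]
  · rw [smul_mul_smul_comm, hp.block_mul_block]; simp
  · intro m _ hm
    rw [smul_mul_smul_comm, hp.block_mul_block]; simp [hm.symm]

theorem mul_diag (hp : IsFlag p) (K : ℕ) (a : ℕ → ℝ) : p K * flagDiag p K a = flagDiag p K a := by
  rw [flagDiag, Finset.mul_sum]
  refine Finset.sum_congr rfl fun l hl => ?_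
  rw [mul_smul_comm, hp.mul_block, if_pos (by simpa [Nat.lt_succ_iff] using hl)]

theorem diag_mul_zero (hp : IsFlag p) (K : ℕ) (a : ℕ → ℝ) :
    flagDiag p K a * p 0 = (a 0 : ℂ) • p 0 := by
  rw [flagDiag, Finset.sum_mul, Finset.sum_eq_single_of_mem 0 (by simp)]
  · rw [smul_mul_assoc, hp.block_mul]; simp [flagBlock]
  · intro l _ hl
    rw [smul_mul_assoc, hp.block_mul]; simp [hl]

end IsFlag

variable [Algebra ℂ R]

theorem flagDiag_eq_sum_smul_add (p : ℕ → R) (K : ℕ) (a : ℕ → ℝ) :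
    flagDiag p K a
      = ∑ i ∈ Finset.range K, ((a i - a (i + 1) : ℝ) : ℂ) • p i + (a K : ℂ) • p K := by
  induction K with
  | zero => simp [flagDiag, flagBlock]
  | succ K ih =>
    rw [flagDiag, Finset.sum_range_succ, ← flagDiag, ih, Finset.sum_range_succ, flagBlock]
    push_cast
    module

theorem flagDiag_sub (p : ℕ → R) (K : ℕ) (a b : ℕ → ℝ) :
    flagDiag p K a - flagDiag p K b = flagDiag p K fun l => a l - b l := by
  simp only [flagDiag, ← Finset.sum_sub_distrib, ← sub_smul, ← Complex.ofReal_sub]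

theorem commute_flagDiag {p : ℕ → R} {T : R} (hT : ∀ i, Commute T (p i)) (K : ℕ) (a : ℕ → ℝ) :
    Commute T (flagDiag p K a) := by
  refine Commute.sum_right _ _ _ fun l _ => Commute.smul_right ?_ _
  cases l with
  | zero => exact hT 0
  | succ l => exact (hT _).sub_right (hT _)

end Flag

section FlagCommutator

variable {H : Type*} [NormedAddCommGroup H] [InnerProductSpace ℂ H] [CompleteSpace H]
  {p : ℕ → H →L[ℂ] H} {f : H →L[ℂ] H} {c δ : ℝ}

/-- The corners of `f` far from the diagonal of the flag decay geometrically in Hilbert-Schmidt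
norm. -/
def HasCornerDecay (p : ℕ → H →L[ℂ] H) (f : H →L[ℂ] H) (c : ℝ) : Prop :=
  ∀ l i, l ≤ i → hsNorm ((1 - p i) * f * p l) ≤ ENNReal.ofReal (c * (2 ^ l / 2 ^ i))

/-- The sum of the corners `(1 - p i) f p i`, `i < K`, with weights `d i`. -/
def cornerSum (p : ℕ → H →L[ℂ] H) (f : H →L[ℂ] H) (K : ℕ) (d : ℕ → ℝ) : H →L[ℂ] H :=
  ∑ i ∈ Finset.range K, (d i : ℂ) • ((1 - p i) * f * p i)

theorem IsFlag.cornerSum_mul_block (hp : IsFlag p) (K : ℕ) (d : ℕ → ℝ) (l : ℕ) :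
    cornerSum p f K d * flagBlock p l
      = ∑ i ∈ Finset.Ico l K, (d i : ℂ) • ((1 - p i) * f * p l * flagBlock p l) := by
  have corner_mul_block : ∀ i, (1 - p i) * f * p i * flagBlock p l
      = if l ≤ i then (1 - p i) * f * p l * flagBlock p l else 0 := by
    intro i
    rw [mul_assoc _ (p i), hp.mul_block, mul_assoc _ (p l), hp.mul_block]
    split_ifs <;> simp_all
  rw [cornerSum, Finset.sum_mul]
  simp only [smul_mul_assoc, corner_mul_block, smul_ite, smul_zero]
  rw [← Finset.sum_filter]
  refine Finset.sum_congr ?_ fun _ _ => rfl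
  ext i; simp [and_comm]

theorem IsFlag.sum_cornerSum_mul_block (hp : IsFlag p) (f : H →L[ℂ] H) (K : ℕ) (d : ℕ → ℝ) :
    ∑ l ∈ Finset.range K, cornerSum p f K d * flagBlock p l = cornerSum p f K d := by
  cases K with
  | zero => simp [cornerSum]
  | succ k =>
    rw [← Finset.mul_sum, sum_flagBlock, cornerSum, Finset.sum_mul]
    refine Finset.sum_congr rfl fun i hi => ?_
    rw [smul_mul_assoc, mul_assoc _ (p i), hp.mul_eq_left]
    simpa [Nat.lt_succ_iff] using hi

theorem IsFlag.hsNorm_cornerSum_mul_block_le (hp : IsFlag p) (hc : 0 ≤ c) (hδ : 0 ≤ δ)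
    (hf : HasCornerDecay p f c) {K : ℕ} {d : ℕ → ℝ} (hd : ∀ i < K, |d i| ≤ δ) (l : ℕ) :
    hsNorm (cornerSum p f K d * flagBlock p l) ≤ ENNReal.ofReal (2 * c * δ) := by
  have term_le : ∀ i ∈ Finset.Ico l K,
      hsNorm ((d i : ℂ) • ((1 - p i) * f * p l * flagBlock p l))
        ≤ ENNReal.ofReal (δ * c * 2 ^ l * (1 / 2) ^ i) := by
    intro i hi
    rw [Finset.mem_Ico] at hi
    rw [hsNorm_smul, ← ofReal_norm, Complex.norm_real, Real.norm_eq_abs]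
    calc ENNReal.ofReal |d i| * hsNorm ((1 - p i) * f * p l * flagBlock p l)
        ≤ ENNReal.ofReal δ * ENNReal.ofReal (c * (2 ^ l / 2 ^ i)) := by
          gcongr
          · exact hd i hi.2
          · exact (hsNorm_mul_le_of_norm_le_one_right
              (hp.isStarProjection_block l).norm_le _).trans (hf l i hi.1)
      _ = _ := by
          rw [← ENNReal.ofReal_mul hδ]
          congr 1
          rw [one_div, inv_pow]
          ring
  rw [hp.cornerSum_mul_block]
  refine (hsNorm_sum_le _ _).trans ((Finset.sum_le_sum term_le).trans ?_)
  rw [← ENNReal.ofReal_sum_of_nonneg (fun i _ => by positivity), ← Finset.mul_sum]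
  refine ENNReal.ofReal_le_ofReal ?_
  calc δ * c * 2 ^ l * ∑ i ∈ Finset.Ico l K, (1 / 2 : ℝ) ^ i
      ≤ δ * c * 2 ^ l * ((1 / 2) ^ l / (1 - 1 / 2)) := by
        gcongr
        exact geom_sum_Ico_le_of_lt_one (by norm_num) (by norm_num)
    _ = 2 * c * δ := by
        rw [one_div, inv_pow]
        field_simp
        norm_num

theorem IsFlag.hsNorm_cornerSum_le (hp : IsFlag p) (hc : 0 ≤ c) (hδ : 0 ≤ δ)
    (hf : HasCornerDecay p f c) {K : ℕ} {d : ℕ → ℝ} (hd : ∀ i < K, |d i| ≤ δ) :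
    hsNorm (cornerSum p f K d) ≤ ENNReal.ofReal (2 * c * δ * √K) := by
  have orthogonal : (Finset.range K : Set ℕ).Pairwise fun l m =>
      cornerSum p f K d * flagBlock p l * star (cornerSum p f K d * flagBlock p m) = 0 := by
    intro l _ m _ hlm
    rw [star_mul, hp.star_block, ← mul_assoc, mul_assoc (cornerSum p f K d),
      hp.block_mul_block, if_neg hlm]
    simp
  rw [hsNorm_le_iff_hsSq_le, ← hp.sum_cornerSum_mul_block f K d,
    hsSq_sum_of_mul_star_eq_zero orthogonal]
  calc ∑ l ∈ Finset.range K, hsSq (cornerSum p f K d * flagBlock p l)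
      ≤ ∑ _l ∈ Finset.range K, ENNReal.ofReal (2 * c * δ) ^ 2 :=
        Finset.sum_le_sum fun l _ =>
          hsNorm_le_iff_hsSq_le.1 (hp.hsNorm_cornerSum_mul_block_le hc hδ hf hd l)
    _ = ENNReal.ofReal (2 * c * δ * √K) ^ 2 := by
        rw [Finset.sum_const, Finset.card_range, nsmul_eq_mul,
          ENNReal.ofReal_mul (q := √K) (by positivity),
          mul_pow _ (ENNReal.ofReal √K), ← ENNReal.ofReal_pow (Real.sqrt_nonneg _),
          Real.sq_sqrt (by positivity), ENNReal.ofReal_natCast, mul_comm]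

theorem IsFlag.hsNorm_commutator_diag_le (hp : IsFlag p) (hc : 0 ≤ c) (hδ : 0 ≤ δ)
    (hf : HasCornerDecay p f c) (hf' : HasCornerDecay p (star f) c)
    {K : ℕ} {a : ℕ → ℝ} (haK : a K = 0) (hda : ∀ i < K, |a i - a (i + 1)| ≤ δ) :
    hsNorm (f * flagDiag p K a - flagDiag p K a * f) ≤ ENNReal.ofReal (4 * c * δ * √K) := by
  have commutator_eq : f * flagDiag p K a - flagDiag p K a * f
      = cornerSum p f K (fun i => a i - a (i + 1))
        - star (cornerSum p (star f) K fun i => a i - a (i + 1)) := by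
    rw [flagDiag_eq_sum_smul_add, haK, Complex.ofReal_zero, zero_smul, add_zero, cornerSum,
      cornerSum, star_sum, Finset.mul_sum, Finset.sum_mul, ← Finset.sum_sub_distrib,
      ← Finset.sum_sub_distrib]
    refine Finset.sum_congr rfl fun i _ => ?_
    rw [star_smul, star_mul, star_mul, star_star, star_sub, hp.star_eq, star_one, mul_smul_comm,
      smul_mul_assoc, Complex.star_def, Complex.conj_ofReal, ← smul_sub, ← smul_sub]
    congr 1
    noncomm_ring
  calc hsNorm (f * flagDiag p K a - flagDiag p K a * f)
      ≤ ENNReal.ofReal (2 * c * δ * √K) + ENNReal.ofReal (2 * c * δ * √K) := by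
        rw [commutator_eq]
        refine (hsNorm_sub_le _ _).trans ?_
        rw [hsNorm_star]
        exact add_le_add (hp.hsNorm_cornerSum_le hc hδ hf hda)
          (hp.hsNorm_cornerSum_le hc hδ hf' hda)
    _ = ENNReal.ofReal (4 * c * δ * √K) := by
        rw [← ENNReal.ofReal_add (by positivity) (by positivity)]
        congr 1; ring

end FlagCommutator

/-! ### Rotating a slowly varying positive contraction into a projection -/

section Rotation

section StarRing

variable {R : Type*} [Ring R] [StarRing R]

/-- `A = cos² θ` and `B = cos θ sin θ` for an operator of angles `θ` living under the
projection `q`. -/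
structure IsCosSinPair (q A B : R) : Prop where
  isSelfAdjoint_cos : IsSelfAdjoint A
  isSelfAdjoint_sin : IsSelfAdjoint B
  proj_mul_cos : q * A = A
  proj_mul_sin : q * B = B
  sin_mul_sin : B * B = A - A * A
  commute : B * A = A * B

/-- `W` is a partial isometry that moves the range of the projection `p` to an orthogonal
subspace. -/
structure IsOrthogonalMove (p W : R) : Prop where
  isStarProjection : IsStarProjection p
  star_mul_self : star W * W = p
  proj_mul : p * W = 0

/-- For `A = cos² θ`, `B = cos θ sin θ` under a projection moved by `W` to an orthogonal place,
this is the projection onto the range of `cos θ + W sin θ`. -/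
def rotProj (A B W : R) : R :=
  A + B * star W + W * B + W * star W - W * A * star W

variable {p q A B W : R}

namespace IsCosSinPair

theorem mono (hAB : IsCosSinPair q A B) (hpq : p * q = q) : IsCosSinPair p A B where
  __ := hAB
  proj_mul_cos := by rw [← hAB.proj_mul_cos, ← mul_assoc, hpq]
  proj_mul_sin := by rw [← hAB.proj_mul_sin, ← mul_assoc, hpq]

theorem cos_mul_proj (hAB : IsCosSinPair q A B) (hq : IsSelfAdjoint q) : A * q = A := by
  simpa [hq.star_eq, hAB.isSelfAdjoint_cos.star_eq] using congrArg star hAB.proj_mul_cos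

theorem sin_mul_proj (hAB : IsCosSinPair q A B) (hq : IsSelfAdjoint q) : B * q = B := by
  simpa [hq.star_eq, hAB.isSelfAdjoint_sin.star_eq] using congrArg star hAB.proj_mul_sin

end IsCosSinPair

theorem IsOrthogonalMove.star_mul_proj (hW : IsOrthogonalMove p W) : star W * p = 0 := by
  simpa [hW.isStarProjection.isSelfAdjoint.star_eq] using congrArg star hW.proj_mul

theorem isSelfAdjoint_rotProj (hA : IsSelfAdjoint A) (hB : IsSelfAdjoint B) :
    IsSelfAdjoint (rotProj A B W) := by
  simp only [IsSelfAdjoint, rotProj, star_add, star_sub, star_mul, star_star, hA.star_eq,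
    hB.star_eq, mul_assoc]
  abel

theorem commute_rotProj {T : R} (hA : Commute T A) (hB : Commute T B) (hW : Commute T W)
    (hW' : Commute T (star W)) : Commute T (rotProj A B W) :=
  (((hA.add_right (hB.mul_right hW')).add_right (hW.mul_right hB)).add_right
    (hW.mul_right hW')).sub_right ((hW.mul_right hA).mul_right hW')

theorem commutator_rotProj (hAB : IsCosSinPair q A B) (hq : IsSelfAdjoint q) (f : R) :
    f * rotProj A B W - rotProj A B W * f
      = (f * A - A * f)
        + ((f * B - B * f) * star W - B * (q * (star W * f - f * star W)))
        + ((f * W - W * f) * q * B + W * (f * B - B * f))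
        + (f * (W * star W) - W * star W * f)
        - ((f * W - W * f) * q * A * star W + W * (f * A - A * f) * star W
          - W * (A * (q * (star W * f - f * star W)))) := by
  rw [← mul_assoc B q, hAB.sin_mul_proj hq, ← mul_assoc A q, hAB.cos_mul_proj hq,
    mul_assoc _ q B, hAB.proj_mul_sin, mul_assoc _ q A, hAB.proj_mul_cos, rotProj]
  noncomm_ring

end StarRing

section CStarRing

variable {R : Type*} [NormedRing R] [StarRing R] [CStarRing R] {p A B W : R}

namespace IsOrthogonalMove

theorem mul_proj (hW : IsOrthogonalMove p W) : W * p = W := by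
  have star_mul_self_eq_zero : star (W - W * p) * (W - W * p) = 0 := by
    rw [star_sub, star_mul, hW.isStarProjection.isSelfAdjoint.star_eq, sub_mul, mul_sub, mul_sub,
      hW.star_mul_self]
    simp only [mul_assoc]
    rw [← mul_assoc (star W), hW.star_mul_self]
    simp [hW.isStarProjection.isIdempotentElem.eq]
  exact (sub_eq_zero.1 ((CStarRing.star_mul_self_eq_zero_iff _).1 star_mul_self_eq_zero)).symm

theorem norm_le_one (hW : IsOrthogonalMove p W) : ‖W‖ ≤ 1 := by
  have norm_proj_le := hW.isStarProjection.norm_le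
  rw [← hW.star_mul_self, CStarRing.norm_star_mul_self] at norm_proj_le
  nlinarith [norm_nonneg W]

theorem isStarProjection_mul_star (hW : IsOrthogonalMove p W) :
    IsStarProjection (W * star W) where
  isIdempotentElem := by
    rw [IsIdempotentElem, mul_assoc, ← mul_assoc (star W), hW.star_mul_self, ← mul_assoc,
      hW.mul_proj]
  isSelfAdjoint := by rw [IsSelfAdjoint, star_mul, star_star]

theorem rotProj_mul_self (hW : IsOrthogonalMove p W) (hAB : IsCosSinPair p A B) :
    rotProj A B W * rotProj A B W = rotProj A B W := by
  have hps := hW.isStarProjection.isSelfAdjoint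
  have hpW' : p * star W = star W := by
    simpa [hps.star_eq] using congrArg star hW.mul_proj
  have hAW : A * W = 0 := by rw [← hAB.cos_mul_proj hps, mul_assoc, hW.proj_mul, mul_zero]
  have hBW : B * W = 0 := by rw [← hAB.sin_mul_proj hps, mul_assoc, hW.proj_mul, mul_zero]
  have hWA : star W * A = 0 := by
    rw [← hAB.proj_mul_cos, ← mul_assoc, hW.star_mul_proj, zero_mul]
  have hWB : star W * B = 0 := by
    rw [← hAB.proj_mul_sin, ← mul_assoc, hW.star_mul_proj, zero_mul]
  have star_mul_self_mul : ∀ x, star W * (W * x) = p * x := fun x => by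
    rw [← mul_assoc, hW.star_mul_self]
  have cos_move_mul : ∀ x, A * (W * x) = 0 := fun x => by rw [← mul_assoc, hAW, zero_mul]
  have sin_move_mul : ∀ x, B * (W * x) = 0 := fun x => by rw [← mul_assoc, hBW, zero_mul]
  have star_sin_mul : ∀ x, star W * (B * x) = 0 := fun x => by rw [← mul_assoc, hWB, zero_mul]
  have proj_cos_mul : ∀ x, p * (A * x) = A * x := fun x => by rw [← mul_assoc, hAB.proj_mul_cos]
  have sin_sin_mul : ∀ x, B * (B * x) = A * x - A * (A * x) := fun x => by
    rw [← mul_assoc, hAB.sin_mul_sin, sub_mul, mul_assoc]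
  have sin_cos_mul : ∀ x, B * (A * x) = A * (B * x) := fun x => by
    rw [← mul_assoc, hAB.commute, mul_assoc]
  simp only [rotProj, mul_add, add_mul, mul_sub, sub_mul, mul_assoc, star_mul_self_mul,
    cos_move_mul, sin_move_mul, star_sin_mul, proj_cos_mul, sin_sin_mul, sin_cos_mul, hWA,
    hAB.sin_mul_sin, hAB.commute, hAB.proj_mul_sin, hpW', mul_zero]
  abel

theorem isStarProjection_rotProj (hW : IsOrthogonalMove p W) (hAB : IsCosSinPair p A B) :
    IsStarProjection (rotProj A B W) :=
  ⟨hW.rotProj_mul_self hAB, isSelfAdjoint_rotProj hAB.isSelfAdjoint_cos hAB.isSelfAdjoint_sin⟩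

end IsOrthogonalMove

end CStarRing

section CStarAlgebra

variable {R : Type*} [CStarAlgebra R] [PartialOrder R] [StarOrderedRing R] {A B : R}

theorem sq_norm_le_of_mul_self_le (hA : IsSelfAdjoint A) (h : A * A ≤ B) : ‖A‖ ^ 2 ≤ ‖B‖ := by
  rw [← hA.norm_mul_self]
  exact CStarAlgebra.norm_le_norm_of_nonneg_of_le
    (by simpa [hA.star_eq] using star_mul_self_nonneg A) h

namespace IsCosSinPair

variable {q : R}

theorem norm_cos_le_one (hAB : IsCosSinPair q A B) : ‖A‖ ≤ 1 := by
  have cos_sq_le_cos : A * A ≤ A := by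
    rw [← sub_nonneg, ← hAB.sin_mul_sin]
    simpa [hAB.isSelfAdjoint_sin.star_eq] using star_mul_self_nonneg B
  nlinarith [sq_norm_le_of_mul_self_le hAB.isSelfAdjoint_cos cos_sq_le_cos, norm_nonneg A]

theorem norm_sin_le_one (hAB : IsCosSinPair q A B) : ‖B‖ ≤ 1 := by
  have sin_sq_le_cos : B * B ≤ A := by
    rw [hAB.sin_mul_sin, sub_le_self_iff]
    simpa [hAB.isSelfAdjoint_cos.star_eq] using star_mul_self_nonneg A
  nlinarith [sq_norm_le_of_mul_self_le hAB.isSelfAdjoint_sin sin_sq_le_cos, hAB.norm_cos_le_one,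
    norm_nonneg B]

end IsCosSinPair

end CStarAlgebra

end Rotation

section RotationCommutator

variable {H : Type*} [NormedAddCommGroup H] [InnerProductSpace ℂ H] [CompleteSpace H]

theorem hsNorm_commutator_rotProj_le {f q A B W : H →L[ℂ] H} {a b d e : ℝ≥0∞}
    (hAB : IsCosSinPair q A B) (hq : IsSelfAdjoint q) (hW : ‖W‖ ≤ 1)
    (hfA : hsNorm (f * A - A * f) ≤ a) (hfB : hsNorm (f * B - B * f) ≤ b)
    (hfW : hsNorm ((f * W - W * f) * q) ≤ d)
    (hfW' : hsNorm ((star f * W - W * star f) * q) ≤ d)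
    (hfWW : hsNorm (f * (W * star W) - W * star W * f) ≤ e) :
    hsNorm (f * rotProj A B W - rotProj A B W * f) ≤ 2 * a + 2 * b + 4 * d + e := by
  have hW' : ‖star W‖ ≤ 1 := by rwa [norm_star]
  have hA := hAB.norm_cos_le_one
  have hB := hAB.norm_sin_le_one
  have hfZ : hsNorm (q * (star W * f - f * star W)) ≤ d := by
    rw [← hsNorm_star]
    simpa [star_sub, star_mul, hq.star_eq] using hfW'
  rw [commutator_rotProj hAB hq]
  set Y := (f * W - W * f) * q
  set Z := q * (star W * f - f * star W)
  have right_term : hsNorm ((f * B - B * f) * star W - B * Z) ≤ b + d :=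
    (hsNorm_sub_le _ _).trans (add_le_add ((hsNorm_mul_le_of_norm_le_one_right hW' _).trans hfB)
      ((hsNorm_mul_le_of_norm_le_one_left hB _).trans hfZ))
  have left_term : hsNorm (Y * B + W * (f * B - B * f)) ≤ d + b :=
    (hsNorm_add_le _ _).trans (add_le_add ((hsNorm_mul_le_of_norm_le_one_right hB _).trans hfW)
      ((hsNorm_mul_le_of_norm_le_one_left hW _).trans hfB))
  have conj_term : hsNorm (Y * A * star W + W * (f * A - A * f) * star W - W * (A * Z))
      ≤ d + a + d := by
    refine (hsNorm_sub_le _ _).trans (add_le_add ((hsNorm_add_le _ _).trans (add_le_add ?_ ?_)) ?_)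
    · exact (hsNorm_mul_le_of_norm_le_one_right hW' _).trans
        ((hsNorm_mul_le_of_norm_le_one_right hA _).trans hfW)
    · exact (hsNorm_mul_le_of_norm_le_one_right hW' _).trans
        ((hsNorm_mul_le_of_norm_le_one_left hW _).trans hfA)
    · exact (hsNorm_mul_le_of_norm_le_one_left hW _).trans
        ((hsNorm_mul_le_of_norm_le_one_left hA _).trans hfZ)
  calc _ ≤ a + (b + d) + (d + b) + e + (d + a + d) :=
        (hsNorm_sub_le _ _).trans <| add_le_add ((hsNorm_add_le _ _).trans <|
          add_le_add ((hsNorm_add_le _ _).trans <| add_le_add ((hsNorm_add_le _ _).trans <|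
            add_le_add hfA right_term) left_term) hfWW) conj_term
    _ = 2 * a + 2 * b + 4 * d + e := by ring

theorem hsNorm_corner_le_of_near {f g Q S χ : H →L[ℂ] H} {r s : ℝ} (hQ : IsStarProjection Q)
    (hfg : ‖(f - g) * χ‖ ≤ r) (hg : Commute g Q) (hQS : Q * S = S) (hχ : χ * S = S)
    (hS : hsNorm S ≤ ENNReal.ofReal s) :
    hsNorm ((1 - Q) * f * S) ≤ ENNReal.ofReal (r * s) := by
  have corner_eq : (1 - Q) * f * S = (1 - Q) * ((f - g) * χ * S) := by
    have corner_g : (1 - Q) * (g * S) = 0 := by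
      rw [sub_mul, one_mul, ← mul_assoc, ← hg.eq, mul_assoc, hQS, sub_self]
    rw [mul_assoc _ χ, hχ, sub_mul f g, mul_sub, corner_g, sub_zero, mul_assoc]
  rw [corner_eq, ENNReal.ofReal_mul ((norm_nonneg _).trans hfg)]
  refine (hsNorm_mul_le_of_norm_le_one_left hQ.one_sub.norm_le _).trans
    ((hsNorm_mul_le_of_norm_le_left hfg _).trans ?_)
  gcongr

end RotationCommutator

section Cutoff

theorem abs_cos_sq_sub_le (x y : ℝ) : |Real.cos x ^ 2 - Real.cos y ^ 2| ≤ |x - y| := by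
  have h := Real.abs_cos_sub_cos_le (2 * x) (2 * y)
  rw [Real.cos_two_mul, Real.cos_two_mul, ← mul_sub, abs_mul, abs_two, sub_sub_sub_cancel_right,
    ← mul_sub, abs_mul, abs_two] at h
  linarith

theorem abs_cos_mul_sin_sub_le (x y : ℝ) :
    |Real.cos x * Real.sin x - Real.cos y * Real.sin y| ≤ |x - y| := by
  have h := Real.abs_sin_sub_sin_le (2 * x) (2 * y)
  rw [Real.sin_two_mul, Real.sin_two_mul, ← mul_sub, abs_mul, abs_two, mul_assoc, mul_assoc,
    ← mul_sub, abs_mul, abs_two, mul_comm (Real.sin x), mul_comm (Real.sin y)] at h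
  linarith

/-- Angles that grow in `K` equal steps from `0` to `π / 2`. -/
def cutoffAngle (K i : ℕ) : ℝ := Real.pi / 2 * (i / K)

theorem cutoffAngle_zero (K : ℕ) : cutoffAngle K 0 = 0 := by simp [cutoffAngle]

theorem cutoffAngle_self {K : ℕ} (hK : K ≠ 0) : cutoffAngle K K = Real.pi / 2 := by
  simp [cutoffAngle, hK]

theorem abs_cutoffAngle_sub_succ_le (K i : ℕ) :
    |cutoffAngle K i - cutoffAngle K (i + 1)| ≤ 2 / K := by
  have e : cutoffAngle K i - cutoffAngle K (i + 1) = -(Real.pi / 2 / K) := by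
    simp only [cutoffAngle]
    push_cast
    ring
  rw [e, abs_neg, abs_of_nonneg (by positivity)]
  gcongr
  linarith [Real.pi_le_four]

/-- `cos² θ` for the operator with angles `cutoffAngle K` along the flag `p`. -/
def cutoffCos {R : Type*} [Ring R] [Algebra ℂ R] (p : ℕ → R) (K : ℕ) : R :=
  flagDiag p K fun i => Real.cos (cutoffAngle K i) ^ 2

/-- `cos θ sin θ` for the operator with angles `cutoffAngle K` along the flag `p`. -/
def cutoffSin {R : Type*} [Ring R] [Algebra ℂ R] (p : ℕ → R) (K : ℕ) : R :=
  flagDiag p K fun i => Real.cos (cutoffAngle K i) * Real.sin (cutoffAngle K i)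

namespace IsFlag

section StarRing

variable {R : Type*} [Ring R] [StarRing R] [Algebra ℂ R] {p : ℕ → R}

theorem isCosSinPair_cutoff [StarModule ℂ R] (hp : IsFlag p) (K : ℕ) :
    IsCosSinPair (p K) (cutoffCos p K) (cutoffSin p K) where
  isSelfAdjoint_cos := hp.star_diag _ _
  isSelfAdjoint_sin := hp.star_diag _ _
  proj_mul_cos := hp.mul_diag _ _
  proj_mul_sin := hp.mul_diag _ _
  sin_mul_sin := by
    simp only [cutoffCos, cutoffSin, hp.diag_mul_diag, flagDiag_sub]
    congr 1
    ext l
    linear_combination Real.cos (cutoffAngle K l) ^ 2 * Real.sin_sq_add_cos_sq (cutoffAngle K l)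
  commute := by
    simp only [cutoffCos, cutoffSin, hp.diag_mul_diag]
    congr 1; ext l; ring

theorem cutoffCos_mul_zero (hp : IsFlag p) (K : ℕ) : cutoffCos p K * p 0 = p 0 := by
  simp [cutoffCos, hp.diag_mul_zero, cutoffAngle_zero]

theorem cutoffSin_mul_zero (hp : IsFlag p) (K : ℕ) : cutoffSin p K * p 0 = 0 := by
  simp [cutoffSin, hp.diag_mul_zero, cutoffAngle_zero]

end StarRing

variable {H : Type*} [NormedAddCommGroup H] [InnerProductSpace ℂ H] [CompleteSpace H]
  {p : ℕ → H →L[ℂ] H}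

theorem hsNorm_commutator_cutoff_le (hp : IsFlag p) {f : H →L[ℂ] H} {c : ℝ} (hc : 0 ≤ c)
    (hf : HasCornerDecay p f c) (hf' : HasCornerDecay p (star f) c) {K : ℕ} (hK : K ≠ 0) :
    hsNorm (f * cutoffCos p K - cutoffCos p K * f) ≤ ENNReal.ofReal (8 * c / √K) ∧
      hsNorm (f * cutoffSin p K - cutoffSin p K * f) ≤ ENNReal.ofReal (8 * c / √K) := by
  have e : 8 * c / √K = 4 * c * (2 / K) * √K := by
    rw [div_eq_iff (by positivity), mul_assoc _ (√(K : ℝ)), Real.mul_self_sqrt (by positivity)]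
    field_simp
    ring
  rw [e]
  constructor <;>
    refine hp.hsNorm_commutator_diag_le hc (by positivity) hf hf' (by simp [cutoffAngle_self hK])
      fun i _ => ?_
  · exact (abs_cos_sq_sub_le _ _).trans (abs_cutoffAngle_sub_succ_le K i)
  · exact (abs_cos_mul_sin_sub_le _ _).trans (abs_cutoffAngle_sub_succ_le K i)

end IsFlag

end Cutoff

section Existence

variable {H : Type*} [NormedAddCommGroup H] [InnerProductSpace ℂ H] [CompleteSpace H]

/-- The operators of `𝓕` are approximated along the flag `p` at the rate `2⁻ⁱ` by the operators in
`𝒟 i`, which commute with `p i`, while the rank of `p i` is `O(4ⁱ)`: the balance that holds for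
Lipschitz functions in dimension two. The approximation takes place below the operator `χ`. -/
structure IsDyadicFlag (p : ℕ → H →L[ℂ] H) (χ : H →L[ℂ] H) (𝓕 : Set (H →L[ℂ] H))
    (𝒟 : ℕ → Set (H →L[ℂ] H)) (c : ℝ) : Prop where
  isFlag : IsFlag p
  mul_flag : ∀ i, χ * p i = p i
  star_mem : ∀ f ∈ 𝓕, star f ∈ 𝓕
  exists_near : ∀ f ∈ 𝓕, ∀ i, ∃ g ∈ 𝒟 i, ‖(f - g) * χ‖ ≤ 2 / 2 ^ i
  commute : ∀ i, ∀ g ∈ 𝒟 i, Commute g (p i)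
  nonneg : 0 ≤ c
  hsNorm_le : ∀ i, hsNorm (p i) ≤ ENNReal.ofReal (c * 2 ^ i)

theorem exists_forall_div_two_pow_le (a : ℝ) {ε : ℝ} (hε : 0 < ε) :
    ∃ N : ℕ, ∀ M, N ≤ M → a / 2 ^ M ≤ ε := by
  have h := (tendsto_pow_atTop_nhds_zero_of_lt_one (r := (1 / 2 : ℝ)) (by norm_num)
    (by norm_num)).const_mul a
  rw [mul_zero] at h
  obtain ⟨N, hN⟩ := eventually_atTop.1 (h.eventually_le_const hε)
  exact ⟨N, fun M hM => by simpa [div_eq_mul_inv] using hN M hM⟩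

namespace IsDyadicFlag

variable {p : ℕ → H →L[ℂ] H} {χ f W : H →L[ℂ] H} {𝓕 : Set (H →L[ℂ] H)}
  {𝒟 : ℕ → Set (H →L[ℂ] H)} {c : ℝ}

theorem hasCornerDecay_shift (hp : IsDyadicFlag p χ 𝓕 𝒟 c) (hf : f ∈ 𝓕) (n : ℕ) :
    HasCornerDecay (fun i => p (n + i)) f (2 * c) := by
  intro l i hli
  obtain ⟨g, hg, hfg⟩ := hp.exists_near f hf (n + i)
  have h := hsNorm_corner_le_of_near (hp.isFlag.isStarProjection (n + i)) hfg (hp.commute _ g hg)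
    (hp.isFlag.mul_eq_right (by lia : n + l ≤ n + i)) (hp.mul_flag (n + l)) (hp.hsNorm_le _)
  convert h using 2
  rw [pow_add, pow_add]
  field_simp

theorem exists_cutoff (hp : IsDyadicFlag p χ 𝓕 𝒟 c) (n : ℕ) {ε : ℝ} (hε : 0 < ε) :
    ∃ K : ℕ, ∀ f ∈ 𝓕,
      hsNorm (f * cutoffCos (fun i => p (n + i)) K - cutoffCos (fun i => p (n + i)) K * f)
        ≤ ENNReal.ofReal ε ∧
      hsNorm (f * cutoffSin (fun i => p (n + i)) K - cutoffSin (fun i => p (n + i)) K * f)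
        ≤ ENNReal.ofReal ε := by
  obtain ⟨K, hK⟩ := exists_nat_gt ((8 * (2 * c) / ε) ^ 2)
  have hK0 : 0 < (K : ℝ) := lt_of_le_of_lt (by positivity) hK
  have hbound : 8 * (2 * c) / √K ≤ ε := by
    rw [div_le_iff₀ (by positivity), mul_comm ε, ← div_le_iff₀ hε]
    exact Real.le_sqrt_of_sq_le hK.le
  have hle := ENNReal.ofReal_le_ofReal hbound
  refine ⟨K, fun f hf => ?_⟩
  have h := (hp.isFlag.shift n).hsNorm_commutator_cutoff_le (by linarith [hp.nonneg])
    (hp.hasCornerDecay_shift hf n) (hp.hasCornerDecay_shift (hp.star_mem f hf) n)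
    (by exact_mod_cast hK0.ne' : K ≠ 0)
  exact ⟨h.1.trans hle, h.2.trans hle⟩

theorem hsNorm_commutator_move_mul_le (hp : IsDyadicFlag p χ 𝓕 𝒟 c) {N : ℕ} (hW : ‖W‖ ≤ 1)
    (hχW : χ * W = W) (hcomm : ∀ g ∈ 𝒟 N, Commute g W) (hf : f ∈ 𝓕) (j : ℕ) :
    hsNorm ((f * W - W * f) * p j) ≤ ENNReal.ofReal (4 * c * 2 ^ j / 2 ^ N) := by
  have hc := hp.nonneg
  obtain ⟨g, hg, hfg⟩ := hp.exists_near f hf N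
  have commutator_eq : (f * W - W * f) * p j
      = (f - g) * χ * (W * p j) - W * ((f - g) * χ * p j) := by
    rw [mul_assoc _ χ (p j), hp.mul_flag, mul_assoc _ χ, ← mul_assoc χ, hχW, sub_mul f g (W * p j),
      ← mul_assoc g, (hcomm g hg).eq]
    noncomm_ring
  have hWj : hsNorm (W * p j) ≤ ENNReal.ofReal (c * 2 ^ j) :=
    (hsNorm_mul_le_of_norm_le_one_left hW _).trans (hp.hsNorm_le j)
  calc hsNorm ((f * W - W * f) * p j)
      ≤ ENNReal.ofReal (2 / 2 ^ N) * ENNReal.ofReal (c * 2 ^ j)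
        + ENNReal.ofReal (2 / 2 ^ N) * ENNReal.ofReal (c * 2 ^ j) := by
        rw [commutator_eq]
        refine (hsNorm_sub_le _ _).trans (add_le_add ?_ ?_)
        · exact (hsNorm_mul_le_of_norm_le_left hfg _).trans (mul_le_mul_right hWj _)
        · exact (hsNorm_mul_le_of_norm_le_one_left hW _).trans
            ((hsNorm_mul_le_of_norm_le_left hfg _).trans (mul_le_mul_right (hp.hsNorm_le j) _))
    _ = ENNReal.ofReal (4 * c * 2 ^ j / 2 ^ N) := by
        rw [← ENNReal.ofReal_mul (by positivity),
          ← ENNReal.ofReal_add (by positivity) (by positivity)]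
        congr 1; ring

theorem hsNorm_commutator_proj_le (hp : IsDyadicFlag p χ 𝓕 𝒟 c) {Q : H →L[ℂ] H}
    (hQ : IsStarProjection Q) (hχQ : χ * Q = Q) {L : ℕ} (hcomm : ∀ g ∈ 𝒟 L, Commute g Q)
    {s : ℝ} (hs : 0 ≤ s) (hQs : hsNorm Q ≤ ENNReal.ofReal s) (hf : f ∈ 𝓕) :
    hsNorm (f * Q - Q * f) ≤ ENNReal.ofReal (4 * s / 2 ^ L) := by
  have corner_le : ∀ f ∈ 𝓕, hsNorm ((1 - Q) * f * Q) ≤ ENNReal.ofReal (2 / 2 ^ L * s) := by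
    intro f hf
    obtain ⟨g, hg, hfg⟩ := hp.exists_near f hf L
    exact hsNorm_corner_le_of_near hQ hfg (hcomm g hg) hQ.isIdempotentElem hχQ hQs
  have commutator_eq : f * Q - Q * f = (1 - Q) * f * Q - star ((1 - Q) * star f * Q) := by
    rw [star_mul, hQ.isSelfAdjoint.star_eq, star_mul, star_star, star_sub,
      hQ.isSelfAdjoint.star_eq, star_one]
    noncomm_ring
  calc hsNorm (f * Q - Q * f)
      ≤ ENNReal.ofReal (2 / 2 ^ L * s) + ENNReal.ofReal (2 / 2 ^ L * s) := by
        rw [commutator_eq]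
        refine (hsNorm_sub_le _ _).trans ?_
        rw [hsNorm_star]
        exact add_le_add (corner_le f hf) (corner_le _ (hp.star_mem f hf))
    _ = ENNReal.ofReal (4 * s / 2 ^ L) := by
        rw [← ENNReal.ofReal_add (by positivity) (by positivity)]
        congr 1; ring

theorem hsNorm_commutator_moveProj_le (hp : IsDyadicFlag p χ 𝓕 𝒟 c) {N L : ℕ}
    (hW : IsOrthogonalMove (p N) W) (hχW : χ * W = W)
    (hcomm : ∀ g ∈ 𝒟 L, Commute g (W * star W)) (hf : f ∈ 𝓕) :
    hsNorm (f * (W * star W) - W * star W * f) ≤ ENNReal.ofReal (4 * (c * 2 ^ N) / 2 ^ L) := by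
  refine hp.hsNorm_commutator_proj_le hW.isStarProjection_mul_star (by rw [← mul_assoc, hχW]) hcomm
    (mul_nonneg hp.nonneg (by positivity)) ?_ hf
  have hW' : ‖star W‖ ≤ 1 := by rw [norm_star]; exact hW.norm_le_one
  calc hsNorm (W * star W) ≤ hsNorm W := hsNorm_mul_le_of_norm_le_one_right hW' _
    _ = hsNorm (W * p N) := by rw [hW.mul_proj]
    _ ≤ hsNorm (p N) := hsNorm_mul_le_of_norm_le_one_left hW.norm_le_one _
    _ ≤ ENNReal.ofReal (c * 2 ^ N) := hp.hsNorm_le N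

theorem hsNorm_commutator_rotProj_cutoff_le (hp : IsDyadicFlag p χ 𝓕 𝒟 c) {n K N L : ℕ} {ε : ℝ}
    (hε : 0 < ε) (hcut : ∀ f ∈ 𝓕,
      hsNorm (f * cutoffCos (fun i => p (n + i)) K - cutoffCos (fun i => p (n + i)) K * f)
        ≤ ENNReal.ofReal (ε / 8) ∧
      hsNorm (f * cutoffSin (fun i => p (n + i)) K - cutoffSin (fun i => p (n + i)) K * f)
        ≤ ENNReal.ofReal (ε / 8))
    (hN : 4 * c * 2 ^ (n + K) / 2 ^ N ≤ ε / 16) (hL : 4 * (c * 2 ^ N) / 2 ^ L ≤ ε / 4)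
    (hW : IsOrthogonalMove (p N) W) (hχW : χ * W = W)
    (hWN : ∀ g ∈ 𝒟 N, Commute g W) (hWL : ∀ g ∈ 𝒟 L, Commute g (W * star W)) (hf : f ∈ 𝓕) :
    let P := rotProj (cutoffCos (fun i => p (n + i)) K) (cutoffSin (fun i => p (n + i)) K) W
    hsNorm (f * P - P * f) ≤ ENNReal.ofReal ε := by
  have hmove := fun f hf => (hp.hsNorm_commutator_move_mul_le hW.norm_le_one hχW hWN
    (f := f) hf (n + K)).trans (ENNReal.ofReal_le_ofReal hN)
  refine (hsNorm_commutator_rotProj_le ((hp.isFlag.shift n).isCosSinPair_cutoff K)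
    (hp.isFlag.isStarProjection (n + K)).isSelfAdjoint hW.norm_le_one (hcut f hf).1 (hcut f hf).2
    (hmove f hf) (hmove _ (hp.star_mem f hf))
    ((hp.hsNorm_commutator_moveProj_le hW hχW hWL hf).trans (ENNReal.ofReal_le_ofReal hL))).trans
      (le_of_eq ?_)
  rw [← ENNReal.ofReal_ofNat 2, ← ENNReal.ofReal_ofNat 4, ← ENNReal.ofReal_mul (by positivity),
    ← ENNReal.ofReal_mul (by positivity), ← ENNReal.ofReal_add (by positivity) (by positivity),
    ← ENNReal.ofReal_add (by positivity) (by positivity),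
    ← ENNReal.ofReal_add (by positivity) (by positivity)]
  congr 1; ring

theorem exists_almost_commuting_projection (hp : IsDyadicFlag p χ 𝓕 𝒟 c) {𝒞 : Set (H →L[ℂ] H)}
    (h𝒞 : ∀ T ∈ 𝒞, IsSelfAdjoint T) (h𝒞p : ∀ T ∈ 𝒞, ∀ i, Commute T (p i))
    (hmove : ∀ N L : ℕ, ∃ (W : H →L[ℂ] H) (M : ℕ), N ≤ M ∧ IsOrthogonalMove (p N) W ∧
      p M * W = W ∧ (∀ g ∈ 𝒟 N, Commute g W) ∧ (∀ g ∈ 𝒟 L, Commute g (W * star W)) ∧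
      ∀ T ∈ 𝒞, Commute T W)
    (n : ℕ) {ε : ℝ} (hε : 0 < ε) :
    ∃ (P : H →L[ℂ] H) (M : ℕ), n ≤ M ∧ IsStarProjection P ∧ P * p n = p n ∧ p M * P = P ∧
      (∀ f ∈ 𝓕, hsNorm (f * P - P * f) ≤ ENNReal.ofReal ε) ∧ ∀ T ∈ 𝒞, Commute T P := by
  obtain ⟨K, hK⟩ := hp.exists_cutoff n (ε := ε / 8) (by positivity)
  obtain ⟨N₀, hN₀⟩ := exists_forall_div_two_pow_le (4 * c * 2 ^ (n + K)) (ε := ε / 16)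
    (by positivity)
  set N := max N₀ (n + K)
  obtain ⟨L, hL⟩ := exists_forall_div_two_pow_le (4 * (c * 2 ^ N)) (ε := ε / 4) (by positivity)
  obtain ⟨W, M, hNM, hW, hMW, hWN, hWL, hW𝒞⟩ := hmove N L
  have hχW : χ * W = W := by rw [← hMW, ← mul_assoc, hp.mul_flag]
  have hKN : n + K ≤ N := le_max_right _ _
  have hflag := hp.isFlag.shift n
  have hpairN : IsCosSinPair (p N) _ _ :=
    (hflag.isCosSinPair_cutoff K).mono (hp.isFlag.mul_eq_right hKN)
  have hpairM : IsCosSinPair (p M) _ _ := hpairN.mono (hp.isFlag.mul_eq_right hNM)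
  have star_move_mul : star W * p n = 0 := by
    rw [← hp.isFlag.mul_eq_right (by lia : n ≤ N), ← mul_assoc, hW.star_mul_proj, zero_mul]
  refine ⟨_, M, by lia, hW.isStarProjection_rotProj hpairN, ?_, ?_, fun f hf =>
    hp.hsNorm_commutator_rotProj_cutoff_le hε hK (hN₀ N (le_max_left _ _)) (hL L le_rfl) hW hχW
      hWN hWL hf, fun T hT => ?_⟩
  · have cos_mul : cutoffCos (fun i => p (n + i)) K * p n = p n := hflag.cutoffCos_mul_zero K
    have sin_mul : cutoffSin (fun i => p (n + i)) K * p n = 0 := hflag.cutoffSin_mul_zero K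
    simp only [rotProj, add_mul, sub_mul, mul_assoc, star_move_mul, cos_mul, sin_mul, mul_zero,
      add_zero, sub_zero]
  · simp only [rotProj, mul_add, mul_sub, ← mul_assoc, hpairM.proj_mul_cos, hpairM.proj_mul_sin,
      hMW]
  · have hT𝒞 := fun i => h𝒞p T hT (n + i)
    exact commute_rotProj (commute_flagDiag hT𝒞 K _) (commute_flagDiag hT𝒞 K _) (hW𝒞 T hT)
      (by simpa [(h𝒞 T hT).star_eq] using (hW𝒞 T hT).star_star)

end IsDyadicFlag

end Existence

/-! ### Partial isometries between finite orthogonal families -/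

section OrthogonalFamilies

open InnerProductSpace (rankOne)

variable {H : Type*} [NormedAddCommGroup H] [InnerProductSpace ℂ H]

theorem inner_normalize_eq_zero {x y : H} (h : ⟪x, y⟫_ℂ = 0) :
    ⟪NormedSpace.normalize x, NormedSpace.normalize y⟫_ℂ = 0 := by
  simp [NormedSpace.normalize, ← Complex.coe_smul, h]

theorem map_normalize_eq_smul {T : H →L[ℂ] H} {x : H} {κ : ℂ} (h : T x = κ • x) :
    T (NormedSpace.normalize x) = κ • NormedSpace.normalize x := by
  rw [NormedSpace.normalize, ← Complex.coe_smul, map_smul, h, smul_comm]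

theorem norm_normalize_le (x : H) : ‖NormedSpace.normalize x‖ ≤ 1 := by
  by_cases hx : x = 0
  · simp [hx]
  · exact (NormedSpace.norm_normalize_eq_one_iff.2 hx).le

/-- The partial isometry that maps the direction of `x a` to the direction of `y a`, for `a ∈ s`;
terms with `x a = 0` or `y a = 0` vanish. -/
def transfer {ι : Type*} (s : Finset ι) (y x : ι → H) : H →L[ℂ] H :=
  ∑ a ∈ s, rankOne ℂ (NormedSpace.normalize (y a)) (NormedSpace.normalize (x a))

variable {ι : Type*} {s : Finset ι} {x y z : ι → H}

theorem transfer_mul_transfer (hy : (s : Set ι).Pairwise fun a b => ⟪y a, y b⟫_ℂ = 0)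
    (h0 : ∀ a ∈ s, y a = 0 → x a = 0) : transfer s z y * transfer s y x = transfer s z x := by
  rw [transfer, transfer, transfer, Finset.sum_mul]
  refine Finset.sum_congr rfl fun a ha => ?_
  rw [Finset.mul_sum, Finset.sum_eq_single_of_mem a ha]
  · rw [ContinuousLinearMap.mul_def, InnerProductSpace.rankOne_comp_rankOne]
    by_cases hya : y a = 0
    · simp [hya, h0 a ha hya]
    · rw [inner_self_eq_norm_sq_to_K, NormedSpace.norm_normalize_eq_one_iff.2 hya]
      simp
  · intro b hb hab
    rw [ContinuousLinearMap.mul_def, InnerProductSpace.rankOne_comp_rankOne,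
      inner_normalize_eq_zero (hy ha hb hab.symm), zero_smul]

theorem transfer_mul_transfer_eq_zero {x' y' : ι → H} {s' : Finset ι}
    (h : ∀ a ∈ s', ∀ b ∈ s, ⟪x' a, y b⟫_ℂ = 0) : transfer s' y' x' * transfer s y x = 0 := by
  rw [transfer, transfer, Finset.sum_mul]
  refine Finset.sum_eq_zero fun a ha => ?_
  rw [Finset.mul_sum]
  refine Finset.sum_eq_zero fun b hb => ?_
  rw [ContinuousLinearMap.mul_def, InnerProductSpace.rankOne_comp_rankOne,
    inner_normalize_eq_zero (h a ha b hb), zero_smul]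

theorem mul_transfer_of_forall_apply_eq {T : H →L[ℂ] H} (h : ∀ a ∈ s, T (y a) = y a) :
    T * transfer s y x = transfer s y x := by
  rw [transfer, Finset.mul_sum]
  refine Finset.sum_congr rfl fun a ha => ?_
  rw [ContinuousLinearMap.mul_def, InnerProductSpace.comp_rankOne,
    map_normalize_eq_smul (κ := 1) (by rw [one_smul, h a ha]), one_smul]

theorem transfer_self_apply_of_mem (hx : (s : Set ι).Pairwise fun a b => ⟪x a, x b⟫_ℂ = 0) {a : ι}
    (ha : a ∈ s) : transfer s x x (x a) = x a := by
  rw [transfer, sum_apply, Finset.sum_eq_single_of_mem a ha]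
  · by_cases hxa : x a = 0
    · simp [hxa]
    · have hn : (‖x a‖ : ℂ) ≠ 0 := by exact_mod_cast norm_ne_zero_iff.2 hxa
      rw [InnerProductSpace.rankOne_apply, NormedSpace.normalize, ← Complex.coe_smul,
        inner_smul_left, inner_self_eq_norm_sq_to_K, smul_smul, Complex.conj_ofReal]
      have hone : ((‖x a‖⁻¹ : ℝ) : ℂ) * (‖x a‖ : ℂ) ^ 2 * ((‖x a‖⁻¹ : ℝ) : ℂ) = 1 := by
        push_cast; field_simp
      exact (congrArg (· • x a) hone).trans (one_smul _ _)
  · intro b hb hab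
    rw [InnerProductSpace.rankOne_apply, NormedSpace.normalize, ← Complex.coe_smul, inner_smul_left,
      hx hb ha hab, mul_zero, zero_smul]

theorem finiteDimensional_range_transfer : FiniteDimensional ℂ (transfer s y x).range := by
  let V := Submodule.span ℂ ((fun a => NormedSpace.normalize (y a)) '' (s : Set ι))
  have hV : FiniteDimensional ℂ V := FiniteDimensional.span_of_finite ℂ (s.finite_toSet.image _)
  refine Submodule.finiteDimensional_of_le (S₂ := V) ?_
  rintro _ ⟨v, rfl⟩
  have hv : transfer s y x v
      = ∑ a ∈ s, ⟪NormedSpace.normalize (x a), v⟫_ℂ • NormedSpace.normalize (y a) := by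
    simp [transfer, sum_apply]
  change transfer s y x v ∈ _
  rw [hv]
  exact Submodule.sum_mem _ fun a ha => Submodule.smul_mem _ _ (Submodule.subset_span ⟨a, ha, rfl⟩)

variable [CompleteSpace H]

theorem star_transfer : star (transfer s y x) = transfer s x y := by
  rw [transfer, star_sum]
  refine Finset.sum_congr rfl fun a _ => ?_
  rw [ContinuousLinearMap.star_eq_adjoint, InnerProductSpace.adjoint_rankOne]

theorem commute_transfer {T : H →L[ℂ] H} (hT : IsSelfAdjoint T)
    (h : ∀ a ∈ s, ∃ κ : ℝ, T (x a) = (κ : ℂ) • x a ∧ T (y a) = (κ : ℂ) • y a) :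
    Commute T (transfer s y x) := by
  refine Commute.sum_right _ _ _ fun a ha => ?_
  obtain ⟨κ, hx, hy⟩ := h a ha
  rw [Commute, SemiconjBy, ContinuousLinearMap.mul_def, ContinuousLinearMap.mul_def,
    InnerProductSpace.comp_rankOne, InnerProductSpace.rankOne_comp,
    ← ContinuousLinearMap.star_eq_adjoint, hT.star_eq, map_normalize_eq_smul hx,
    map_normalize_eq_smul hy]
  ext v
  rw [InnerProductSpace.rankOne_apply, InnerProductSpace.rankOne_apply, inner_smul_left,
    Complex.conj_ofReal, smul_comm, smul_smul]

theorem isStarProjection_transfer_self (hx : (s : Set ι).Pairwise fun a b => ⟪x a, x b⟫_ℂ = 0) :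
    IsStarProjection (transfer s x x) :=
  ⟨transfer_mul_transfer hx fun _ _ => id, star_transfer⟩

theorem hsSq_transfer_self_le (hx : (s : Set ι).Pairwise fun a b => ⟪x a, x b⟫_ℂ = 0) :
    hsSq (transfer s x x) ≤ s.card := by
  rw [transfer, hsSq_sum_of_star_mul_eq_zero]
  · have h1 : ∀ a, ‖NormedSpace.normalize (x a)‖ₑ ≤ 1 := fun a => by
      rw [← ofReal_norm]; simpa using ENNReal.ofReal_le_ofReal (norm_normalize_le (x a))
    refine (Finset.sum_le_card_nsmul s _ 1 fun a _ => ?_).trans (by simp)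
    rw [hsSq_rankOne]
    exact mul_le_one' (pow_le_one' (h1 a) 2) (pow_le_one' (h1 a) 2)
  · intro a ha b hb hab
    rw [ContinuousLinearMap.star_eq_adjoint, InnerProductSpace.adjoint_rankOne,
      ContinuousLinearMap.mul_def, InnerProductSpace.rankOne_comp_rankOne,
      inner_normalize_eq_zero (hx ha hb hab), zero_smul]

end OrthogonalFamilies

/-! ### Multiplication operators and essentially Lipschitz functions -/

section Multiplication

variable {Ω : Set ℂ}

theorem mulOp_mul_comm (f g : Lp ℂ ∞ (leb Ω)) : mulOp f * mulOp g = mulOp g * mulOp f := by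
  ext1 x
  refine Lp.ext ?_
  rw [mul_apply_eq_comp, mul_apply_eq_comp]
  filter_upwards [mulOp_apply_ae f (mulOp g x), mulOp_apply_ae g (mulOp f x), mulOp_apply_ae f x,
    mulOp_apply_ae g x] with z h1 h2 h3 h4
  rw [h1, h2, h3, h4]; ring

/-- Multiplication by the indicator function of a measurable set. -/
def chi (Ω : Set ℂ) {A : Set ℂ} (hA : MeasurableSet A) : BL2 Ω := mulOp (indLinf Ω A hA)

variable {A B : Set ℂ} (hA : MeasurableSet A) (hB : MeasurableSet B)

theorem indLinf_ae : indLinf Ω A hA =ᵐ[leb Ω] A.indicator 1 := MemLp.coeFn_toLp _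

theorem chi_apply_ae (x : L2 Ω) : chi Ω hA x =ᵐ[leb Ω] A.indicator x := by
  filter_upwards [mulOp_apply_ae (indLinf Ω A hA) x, indLinf_ae hA] with z h1 h2
  rw [chi, h1, h2]
  by_cases hz : z ∈ A <;> simp [hz]

theorem chi_mul_chi : chi Ω hA * chi Ω hB = chi Ω (hA.inter hB) := by
  ext1 x
  refine Lp.ext ?_
  rw [mul_apply_eq_comp]
  filter_upwards [chi_apply_ae hA (chi Ω hB x), chi_apply_ae hB x,
    chi_apply_ae (hA.inter hB) x] with z h1 h2 h3
  rw [h1, h3, ← Set.indicator_indicator]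
  by_cases hz : z ∈ A <;> simp [hz, h2]

theorem commute_chi_mulOp (f : Lp ℂ ∞ (leb Ω)) : Commute (chi Ω hA) (mulOp f) :=
  mulOp_mul_comm _ _

theorem isStarProjection_chi : IsStarProjection (chi Ω hA) where
  isIdempotentElem := by
    rw [IsIdempotentElem, chi_mul_chi]
    congr 1; exact Set.inter_self A
  isSelfAdjoint := by
    rw [IsSelfAdjoint, chi, star_mulOp]
    congr 1
    refine Lp.ext ?_
    filter_upwards [Lp.coeFn_star (indLinf Ω A hA), indLinf_ae hA] with z h1 h2
    rw [h1, Pi.star_apply, h2]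
    by_cases hz : z ∈ A <;> simp [hz]

theorem chi_mul_chi_of_subset_left (h : A ⊆ B) : chi Ω hA * chi Ω hB = chi Ω hA := by
  rw [chi_mul_chi]
  congr 1; exact Set.inter_eq_left.2 h

theorem chi_mul_chi_of_subset_right (h : A ⊆ B) : chi Ω hB * chi Ω hA = chi Ω hA := by
  rw [chi_mul_chi]
  congr 1; exact Set.inter_eq_right.2 h

theorem chi_mul_chi_of_disjoint (h : Disjoint A B) : chi Ω hA * chi Ω hB = 0 := by
  rw [chi_mul_chi]
  ext1 x
  refine Lp.ext ?_
  filter_upwards [chi_apply_ae (hA.inter hB) x, Lp.coeFn_zero ℂ 2 (leb Ω)] with z h1 h2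
  rw [h1, zero_apply, h2]
  simp [h.inter_eq]

theorem coeFn_finsetSum_ae {ι : Type*} (s : Finset ι) (v : ι → L2 Ω) :
    ⇑(∑ i ∈ s, v i) =ᵐ[leb Ω] fun z => ∑ i ∈ s, v i z := by
  classical
  induction s using Finset.induction_on with
  | empty =>
    filter_upwards [Lp.coeFn_zero ℂ 2 (leb Ω)] with z h
    simp only [Finset.sum_empty]
    exact h
  | insert i s hi ih =>
    rw [Finset.sum_insert hi]
    filter_upwards [Lp.coeFn_add (v i) (∑ j ∈ s, v j), ih] with z h1 h2
    rw [h1, Pi.add_apply, h2, Finset.sum_insert hi]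

theorem sum_chi {ι : Type*} (s : Finset ι) {C : ι → Set ℂ} (hC : ∀ i, MeasurableSet (C i))
    (h : ∀ z, ∑ i ∈ s, (C i).indicator (1 : ℂ → ℂ) z = B.indicator 1 z) :
    ∑ i ∈ s, chi Ω (hC i) = chi Ω hB := by
  ext1 x
  refine Lp.ext ?_
  rw [sum_apply]
  have hCx : ∀ᵐ z ∂leb Ω, ∀ i ∈ s, chi Ω (hC i) x z = (C i).indicator x z :=
    (Filter.eventually_all_finset s).2 fun i _ => chi_apply_ae (hC i) x
  have hind : ∀ (D : Set ℂ) z, D.indicator x z = D.indicator (1 : ℂ → ℂ) z * x z := fun D z => by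
    by_cases hz : z ∈ D <;> simp [hz]
  filter_upwards [coeFn_finsetSum_ae s fun i => chi Ω (hC i) x, hCx, chi_apply_ae hB x]
    with z h1 h2 h3
  rw [h1, h3, Finset.sum_congr rfl h2]
  simp only [hind]
  rw [← Finset.sum_mul, h z]

theorem enorm_sq_eq_lintegral (x : L2 Ω) : ‖x‖ₑ ^ 2 = ∫⁻ z, ‖x z‖ₑ ^ 2 ∂leb Ω := by
  rw [Lp.enorm_def, eLpNorm_eq_lintegral_rpow_enorm_toReal (by norm_num) (by norm_num),
    ← ENNReal.rpow_natCast, ← ENNReal.rpow_mul]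
  norm_num

theorem enorm_chi_apply_sq (x : L2 Ω) :
    ‖chi Ω hA x‖ₑ ^ 2 = ∫⁻ z in A, ‖x z‖ₑ ^ 2 ∂leb Ω := by
  rw [enorm_sq_eq_lintegral, ← lintegral_indicator hA]
  refine lintegral_congr_ae ?_
  filter_upwards [chi_apply_ae hA x] with z h
  rw [h]
  by_cases hz : z ∈ A <;> simp [hz]

theorem enorm_chi_apply_sub_self_sq (x : L2 Ω) :
    ‖chi Ω hA x - x‖ₑ ^ 2 = ∫⁻ z, Aᶜ.indicator (fun z => ‖x z‖ₑ ^ 2) z ∂leb Ω := by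
  rw [enorm_sq_eq_lintegral]
  refine lintegral_congr_ae ?_
  filter_upwards [Lp.coeFn_sub (chi Ω hA x) x, chi_apply_ae hA x] with z h1 h2
  rw [h1, Pi.sub_apply, h2]
  by_cases hz : z ∈ A <;> simp [hz]

theorem tendsto_of_tendsto_enorm_sub_sq {E : Type*} [NormedAddCommGroup E] {α : Type*}
    {l : Filter α} {u : α → E} {x : E} (h : Tendsto (fun a => ‖u a - x‖ₑ ^ 2) l (𝓝 0)) :
    Tendsto u l (𝓝 x) := by
  rw [tendsto_iff_edist_tendsto_0]
  have h' := h.ennrpow_const (1 / 2 : ℝ)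
  rw [ENNReal.zero_rpow_of_pos (by norm_num)] at h'
  refine h'.congr fun a => ?_
  rw [edist_eq_enorm_sub, ← ENNReal.rpow_natCast, ← ENNReal.rpow_mul]
  norm_num

/-- Multiplication by the indicator function of the open ball of radius `n` around `0`. -/
abbrev chiBall (Ω : Set ℂ) (n : ℕ) : BL2 Ω := chi Ω (measurableSet_ball (x := (0 : ℂ)) (ε := n))

theorem tendsto_chiBall (x : L2 Ω) : Tendsto (fun n => chiBall Ω n x) atTop (𝓝 x) := by
  refine tendsto_of_tendsto_enorm_sub_sq ?_
  simp only [enorm_chi_apply_sub_self_sq]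
  rw [← lintegral_zero (μ := leb Ω)]
  refine tendsto_lintegral_of_dominated_convergence' (fun z => ‖x z‖ₑ ^ 2) (fun n => ?_)
    (fun n => Eventually.of_forall fun z => Set.indicator_le_self _ _ z) ?_
    (Eventually.of_forall fun z => ?_)
  · exact (((Lp.stronglyMeasurable x).measurable.enorm.pow_const 2).indicator
      measurableSet_ball.compl).aemeasurable
  · rw [← enorm_sq_eq_lintegral]; simp
  · obtain ⟨N, hN⟩ := exists_nat_gt ‖z‖
    refine tendsto_const_nhds.congr' (eventually_atTop.2 ⟨N, fun n hn => ?_⟩)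
    have hz : ‖z‖ < n := hN.trans_le (by exact_mod_cast hn)
    simp [hz]

theorem ae_ae_norm_sub_le_of_lipNorm_le_one {f : Lp ℂ ∞ (leb Ω)} (h : lipNorm f ≤ 1) :
    ∀ᵐ s ∂leb Ω, ∀ᵐ t ∂leb Ω, ‖f s - f t‖ ≤ ‖s - t‖ := by
  refine Measure.ae_ae_of_ae_prod (p := fun p : ℂ × ℂ => ‖f p.1 - f p.2‖ ≤ ‖p.1 - p.2‖) ?_
  filter_upwards [ae_le_eLpNormEssSup (f := diffQuot f) (μ := (leb Ω).prod (leb Ω))] with p hp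
  have hquot : ‖diffQuot f p‖ ≤ 1 := by
    rw [← ENNReal.ofReal_le_one, ofReal_norm]
    exact hp.trans (by rwa [lipNorm, eLpNorm_exponent_top] at h)
  by_cases hp2 : p.1 = p.2
  · simp [hp2]
  · rwa [diffQuot, norm_div, div_le_one (norm_pos_iff.2 (sub_ne_zero.2 hp2))] at hquot

theorem exists_ae_norm_sub_le_of_diam_le {f : Lp ℂ ∞ (leb Ω)} (h : lipNorm f ≤ 1) {r : ℝ}
    (hr : ∀ s ∈ A, ∀ t ∈ A, ‖s - t‖ ≤ r) :
    ∃ c : ℂ, ∀ᵐ z ∂leb Ω, z ∈ A → ‖f z - c‖ ≤ r := by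
  by_cases hA0 : leb Ω A = 0
  · refine ⟨0, ?_⟩
    filter_upwards [measure_eq_zero_iff_ae_notMem.1 hA0] with z hz hz'
    exact absurd hz' hz
  · obtain ⟨s, hsA, hs⟩ := ((frequently_ae_mem_iff.2 hA0).and_eventually
      (ae_ae_norm_sub_le_of_lipNorm_le_one h)).exists
    refine ⟨f s, ?_⟩
    filter_upwards [hs] with t ht htA
    rw [norm_sub_rev]
    exact ht.trans (hr s hsA t htA)

theorem norm_mulOp_sub_smul_mul_chi_le {f : Lp ℂ ∞ (leb Ω)} {r : ℝ} (hr : 0 ≤ r) {c : ℂ}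
    (h : ∀ᵐ z ∂leb Ω, z ∈ A → ‖f z - c‖ ≤ r) :
    ‖(mulOp f - c • (1 : BL2 Ω)) * chi Ω hA‖ ≤ r := by
  refine ContinuousLinearMap.opNorm_le_bound _ hr fun x => ?_
  refine Lp.norm_le_mul_norm_of_ae_le_mul ?_
  have hx : ((mulOp f - c • (1 : BL2 Ω)) * chi Ω hA) x
      = mulOp f (chi Ω hA x) - c • chi Ω hA x := by
    simp [mul_apply_eq_comp]
  rw [hx]
  filter_upwards [h, Lp.coeFn_sub (mulOp f (chi Ω hA x)) (c • chi Ω hA x),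
    mulOp_apply_ae f (chi Ω hA x), Lp.coeFn_smul c (chi Ω hA x), chi_apply_ae hA x]
    with z h1 h2 h3 h4 h5
  rw [h2, Pi.sub_apply, h3, h4, Pi.smul_apply, h5, smul_eq_mul, ← sub_mul]
  by_cases hz : z ∈ A
  · rw [Set.indicator_of_mem hz, norm_mul]
    exact mul_le_mul_of_nonneg_right (h1 hz) (norm_nonneg _)
  · rw [Set.indicator_of_notMem hz, mul_zero, norm_zero]
    positivity

theorem exists_essLip_of_lipschitz {F : ℂ → ℂ} {C : ℝ} (hC : ∀ z, ‖F z‖ ≤ C)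
    (hF : LipschitzWith 1 F) :
    ∃ f : Lp ℂ ∞ (leb Ω), f ∈ essLip Ω ∧ lipNorm f ≤ 1 ∧ f =ᵐ[leb Ω] F := by
  have hm : MemLp F ∞ (leb Ω) := memLp_top_of_bound hF.continuous.aestronglyMeasurable C
    (Eventually.of_forall hC)
  have hquot : ∀ᵐ p ∂(leb Ω).prod (leb Ω), ‖diffQuot hm.toLp p‖ ≤ 1 := by
    filter_upwards [(Measure.quasiMeasurePreserving_fst (μ := leb Ω) (ν := leb Ω)).ae
      hm.coeFn_toLp, (Measure.quasiMeasurePreserving_snd (μ := leb Ω) (ν := leb Ω)).ae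
      hm.coeFn_toLp] with p h1 h2
    rw [diffQuot, h1, h2, norm_div]
    exact div_le_one_of_le₀ (by simpa [dist_eq_norm] using hF.dist_le_mul p.1 p.2) (norm_nonneg _)
  have hle : lipNorm hm.toLp ≤ 1 := by
    rw [lipNorm, eLpNorm_exponent_top]
    simpa using eLpNormEssSup_le_of_ae_bound hquot
  exact ⟨hm.toLp, ⟨(measurable_diffQuot _).aestronglyMeasurable, hle.trans_lt ENNReal.one_lt_top⟩,
    hle, hm.coeFn_toLp⟩

end Multiplication

/-! ### Dyadic cells -/

section Cells

/-- The label of the cell of level `j` containing `z`: the annulus `k ≤ ‖z‖ < k + 1` and the dyadic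
square of side `2 ^ -j` around `z`. Intersecting with annuli makes every ball of integer radius a
union of cells. -/
def cellLabel (j : ℕ) (z : ℂ) : ℕ × ℤ × ℤ := (⌊‖z‖⌋₊, ⌊2 ^ j * z.re⌋, ⌊2 ^ j * z.im⌋)

theorem measurable_cellLabel (j : ℕ) : Measurable (cellLabel j) :=
  (Nat.measurable_floor.comp measurable_norm).prodMk
    ((Int.measurable_floor.comp (Complex.measurable_re.const_mul _)).prodMk
      (Int.measurable_floor.comp (Complex.measurable_im.const_mul _)))

/-- The cell of level `j` with label `a`. -/
def cell (j : ℕ) (a : ℕ × ℤ × ℤ) : Set ℂ := cellLabel j ⁻¹' {a}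

theorem measurableSet_cell (j : ℕ) (a : ℕ × ℤ × ℤ) : MeasurableSet (cell j a) :=
  measurable_cellLabel j (measurableSet_singleton a)

theorem disjoint_cell {j : ℕ} {a b : ℕ × ℤ × ℤ} (h : a ≠ b) : Disjoint (cell j a) (cell j b) :=
  Disjoint.preimage _ (Set.disjoint_singleton.2 h)

theorem cellLabel_eq_of_mem {j : ℕ} {a : ℕ × ℤ × ℤ} {s t : ℂ} (hs : s ∈ cell j a)
    (ht : t ∈ cell j a) : cellLabel j s = cellLabel j t :=
  Eq.trans hs (Eq.symm ht)

/-- A finite set of labels containing those of all cells of level `j` that meet the ball of radius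
`n`, and only labels of cells contained in that ball. -/
def cellIndex (n j : ℕ) : Finset (ℕ × ℤ × ℤ) :=
  Finset.range n ×ˢ Finset.Icc (-(n * 2 ^ j : ℤ)) (n * 2 ^ j) ×ˢ
    Finset.Icc (-(n * 2 ^ j : ℤ)) (n * 2 ^ j)

theorem cellLabel_mem_cellIndex {n : ℕ} {z : ℂ} (hz : ‖z‖ < n) (j : ℕ) :
    cellLabel j z ∈ cellIndex n j := by
  have floor_mem : ∀ x : ℝ, |x| ≤ ‖z‖ →
      ⌊2 ^ j * x⌋ ∈ Finset.Icc (-(n * 2 ^ j : ℤ)) (n * 2 ^ j) := by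
    intro x hx
    obtain ⟨hlow, hupp⟩ := abs_le.1 (hx.trans hz.le)
    have hp : (0 : ℝ) < 2 ^ j := by positivity
    rw [Finset.mem_Icc, Int.le_floor, ← Int.cast_le (R := ℝ)]
    push_cast
    exact ⟨by nlinarith, (Int.floor_le _).trans (by nlinarith)⟩
  rw [cellIndex, Finset.mem_product, Finset.mem_product, Finset.mem_range]
  exact ⟨(Nat.floor_lt (norm_nonneg z)).2 hz, floor_mem _ (Complex.abs_re_le_norm z),
    floor_mem _ (Complex.abs_im_le_norm z)⟩

theorem cell_subset_ball {n j : ℕ} {a : ℕ × ℤ × ℤ} (ha : a ∈ cellIndex n j) :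
    cell j a ⊆ Metric.ball (0 : ℂ) n := by
  rintro z rfl
  rw [cellIndex, Finset.mem_product, Finset.mem_range] at ha
  rw [mem_ball_zero_iff]
  exact (Nat.floor_lt (norm_nonneg z)).1 ha.1

theorem card_cellIndex_le (n j : ℕ) : (cellIndex n j).card ≤ ((2 * n + 1) ^ 2 * 2 ^ j) ^ 2 := by
  have hIcc : ((n * 2 ^ j : ℤ) + 1 - -(n * 2 ^ j : ℤ)).toNat = 2 * n * 2 ^ j + 1 := by
    have hcast : ((n * 2 ^ j : ℤ) + 1 - -(n * 2 ^ j : ℤ)) = ((2 * n * 2 ^ j + 1 : ℕ) : ℤ) := by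
      push_cast; ring
    rw [hcast, Int.toNat_natCast]
  rw [cellIndex, Finset.card_product, Finset.card_product, Finset.card_range, Int.card_Icc, hIcc]
  have hside : 2 * n * 2 ^ j + 1 ≤ (2 * n + 1) * 2 ^ j := by
    have := Nat.one_le_two_pow (n := j)
    nlinarith
  have hn : n ≤ (2 * n + 1) ^ 2 := by nlinarith
  calc n * ((2 * n * 2 ^ j + 1) * (2 * n * 2 ^ j + 1))
      ≤ (2 * n + 1) ^ 2 * (((2 * n + 1) * 2 ^ j) * ((2 * n + 1) * 2 ^ j)) := by gcongr
    _ = _ := by ring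

theorem abs_sub_le_of_floor_two_pow_mul_eq {x y : ℝ} {j : ℕ} (h : ⌊2 ^ j * x⌋ = ⌊2 ^ j * y⌋) :
    |x - y| ≤ 1 / 2 ^ j := by
  have hlt := Int.abs_sub_lt_one_of_floor_eq_floor h
  rw [← mul_sub, abs_mul, abs_of_pos (by positivity)] at hlt
  rw [le_div_iff₀ (by positivity), mul_comm]
  exact hlt.le

theorem norm_sub_le_of_cellLabel_eq {j : ℕ} {s t : ℂ} (h : cellLabel j s = cellLabel j t) :
    ‖s - t‖ ≤ 2 / 2 ^ j := by
  simp only [cellLabel, Prod.mk.injEq] at h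
  calc ‖s - t‖ ≤ |(s - t).re| + |(s - t).im| := Complex.norm_le_abs_re_add_abs_im _
    _ ≤ 1 / 2 ^ j + 1 / 2 ^ j := by
        rw [Complex.sub_re, Complex.sub_im]
        exact add_le_add (abs_sub_le_of_floor_two_pow_mul_eq h.2.1)
          (abs_sub_le_of_floor_two_pow_mul_eq h.2.2)
    _ = 2 / 2 ^ j := by ring

theorem floor_two_pow_mul_eq_div {i j : ℕ} (hij : i ≤ j) (x : ℝ) :
    ⌊2 ^ i * x⌋ = ⌊2 ^ j * x⌋ / ((2 ^ (j - i) : ℕ) : ℤ) := by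
  rw [← Int.floor_div_natCast]
  congr 1
  push_cast
  rw [eq_div_iff (by positivity), mul_right_comm, ← pow_add, Nat.add_sub_cancel' hij]

theorem cellLabel_eq_of_le {i j : ℕ} (hij : i ≤ j) {s t : ℂ} (h : cellLabel j s = cellLabel j t) :
    cellLabel i s = cellLabel i t := by
  simp only [cellLabel, Prod.mk.injEq] at h ⊢
  simp only [floor_two_pow_mul_eq_div hij, h, and_self]

theorem exists_cell_subset_of_le {i j : ℕ} (hij : i ≤ j) (b : ℕ × ℤ × ℤ) :
    ∃ a, cell j b ⊆ cell i a := by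
  rcases (cell j b).eq_empty_or_nonempty with h | ⟨z, hz⟩
  · exact ⟨b, h ▸ Set.empty_subset _⟩
  · exact ⟨cellLabel i z, fun t ht => cellLabel_eq_of_le hij (cellLabel_eq_of_mem ht hz)⟩

/-- The sets that are unions of cells of level `j`. -/
def Saturated (j : ℕ) (A : Set ℂ) : Prop :=
  ∀ ⦃s t⦄, cellLabel j s = cellLabel j t → s ∈ A → t ∈ A

theorem saturated_cell {i j : ℕ} (hij : i ≤ j) (a : ℕ × ℤ × ℤ) : Saturated j (cell i a) :=
  fun _ _ h hs => (cellLabel_eq_of_le hij h).symm.trans hs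

theorem saturated_ball (j m : ℕ) : Saturated j (Metric.ball (0 : ℂ) m) := by
  intro s t h hs
  simp only [cellLabel, Prod.mk.injEq] at h
  rw [mem_ball_zero_iff, ← Nat.floor_lt (norm_nonneg _)] at hs ⊢
  rwa [← h.1]

theorem Saturated.inter {j : ℕ} {A B : Set ℂ} (hA : Saturated j A) (hB : Saturated j B) :
    Saturated j (A ∩ B) := fun _ _ h hs => ⟨hA h hs.1, hB h hs.2⟩

theorem Saturated.diff {j : ℕ} {A B : Set ℂ} (hA : Saturated j A) (hB : Saturated j B) :
    Saturated j (A \ B) := fun _ _ h hs => ⟨hA h hs.1, fun ht => hs.2 (hB h.symm ht)⟩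

theorem Saturated.mono {i j : ℕ} (hij : i ≤ j) {A : Set ℂ} (hA : Saturated i A) :
    Saturated j A := fun _ _ h hs => hA (cellLabel_eq_of_le hij h) hs

theorem Saturated.cell_subset_or_disjoint {j : ℕ} {A : Set ℂ} (hA : Saturated j A)
    (a : ℕ × ℤ × ℤ) : cell j a ⊆ A ∨ Disjoint (cell j a) A := by
  by_cases h : ∃ z ∈ cell j a, z ∈ A
  · obtain ⟨z, hz, hzA⟩ := h
    exact Or.inl fun t ht => hA (cellLabel_eq_of_mem hz ht) hzA
  · push Not at h
    exact Or.inr (Set.disjoint_left.2 h)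

theorem volume_cell_le (j : ℕ) (a : ℕ × ℤ × ℤ) :
    volume (cell j a) ≤ ENNReal.ofReal (2 / 2 ^ j) ^ 2 * NNReal.pi := by
  rcases (cell j a).eq_empty_or_nonempty with h | ⟨z, hz⟩
  · rw [h, measure_empty]; exact zero_le
  · rw [← Complex.volume_closedBall z]
    refine measure_mono fun t ht => ?_
    rw [Metric.mem_closedBall, dist_eq_norm]
    exact norm_sub_le_of_cellLabel_eq (cellLabel_eq_of_mem ht hz)

theorem exists_volume_cell_lt (N : ℕ) {ε : ℝ≥0∞} (hε : 0 < ε) :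
    ∃ M, N ≤ M ∧ ∀ a, volume (cell M a) < ε := by
  have hdiam : Tendsto (fun M : ℕ => (2 : ℝ) / 2 ^ M) atTop (𝓝 0) :=
    tendsto_const_nhds.div_atTop (tendsto_pow_atTop_atTop_of_one_lt (by norm_num))
  have hvol : Tendsto (fun M : ℕ => ENNReal.ofReal (2 / 2 ^ M) ^ 2 * (NNReal.pi : ℝ≥0∞)) atTop
      (𝓝 0) := by
    simpa using ENNReal.Tendsto.mul_const (b := (NNReal.pi : ℝ≥0∞))
      (ENNReal.Tendsto.pow (n := 2) (ENNReal.tendsto_ofReal hdiam)) (Or.inr ENNReal.coe_ne_top)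
  obtain ⟨M, hM, hNM⟩ := ((hvol.eventually_lt_const hε).and (eventually_ge_atTop N)).exists
  exact ⟨M, hNM, fun a => (volume_cell_le M a).trans_lt hM⟩

end Cells

section CellProjections

variable {Ω : Set ℂ}

theorem inner_chi_left {A : Set ℂ} (hA : MeasurableSet A) (x y : L2 Ω) :
    ⟪chi Ω hA x, y⟫_ℂ = ⟪x, chi Ω hA y⟫_ℂ :=
  (isStarProjection_chi hA).isSelfAdjoint.isSymmetric x y

theorem inner_chi_chi_of_disjoint {A B : Set ℂ} (hA : MeasurableSet A) (hB : MeasurableSet B)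
    (h : Disjoint A B) (x y : L2 Ω) : ⟪chi Ω hA x, chi Ω hB y⟫_ℂ = 0 := by
  rw [inner_chi_left, ← mul_apply_eq_comp, chi_mul_chi_of_disjoint hA hB h, zero_apply,
    inner_zero_right]

/-- The indicator function of the ball of radius `n`, as an element of `L²(Ω)`. -/
def ballVec (Ω : Set ℂ) (n : ℕ) : L2 Ω :=
  indicatorConstLp 2 (measurableSet_ball (x := (0 : ℂ)) (ε := n))
    ((Measure.restrict_apply_le _ _).trans_lt measure_ball_lt_top).ne 1

theorem ballVec_ae (n : ℕ) :
    ballVec Ω n =ᵐ[leb Ω] (Metric.ball (0 : ℂ) n).indicator fun _ => 1 := indicatorConstLp_coeFn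

theorem chi_ballVec_eq {A : Set ℂ} (hA : MeasurableSet A) {n m : ℕ}
    (hn : A ⊆ Metric.ball (0 : ℂ) n) (hm : A ⊆ Metric.ball (0 : ℂ) m) :
    chi Ω hA (ballVec Ω n) = chi Ω hA (ballVec Ω m) := by
  refine Lp.ext ?_
  filter_upwards [chi_apply_ae hA (ballVec Ω n), chi_apply_ae hA (ballVec Ω m),
    ballVec_ae (Ω := Ω) n, ballVec_ae (Ω := Ω) m] with z h1 h2 h3 h4
  rw [h1, h2]
  by_cases hz : z ∈ A
  · rw [Set.indicator_of_mem hz, Set.indicator_of_mem hz, h3, h4, Set.indicator_of_mem (hn hz),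
      Set.indicator_of_mem (hm hz)]
  · rw [Set.indicator_of_notMem hz, Set.indicator_of_notMem hz]

theorem enorm_chi_ballVec_sq_le {A : Set ℂ} (hA : MeasurableSet A) (n : ℕ) :
    ‖chi Ω hA (ballVec Ω n)‖ₑ ^ 2 ≤ volume A := by
  rw [enorm_chi_apply_sq]
  calc ∫⁻ z in A, ‖ballVec Ω n z‖ₑ ^ 2 ∂leb Ω ≤ ∫⁻ _ in A, 1 ∂leb Ω := by
        refine lintegral_mono_ae (ae_restrict_of_ae ?_)
        filter_upwards [ballVec_ae (Ω := Ω) n] with z h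
        rw [h]
        by_cases hz : z ∈ Metric.ball (0 : ℂ) n
        · rw [Set.indicator_of_mem hz]; simp
        · rw [Set.indicator_of_notMem hz]; simp
    _ ≤ volume A := by
        rw [setLIntegral_one]
        exact Measure.restrict_apply_le _ _

theorem sum_chi_cell_inter {A : Set ℂ} (hA : MeasurableSet A) {n : ℕ}
    (hn : A ⊆ Metric.ball (0 : ℂ) n) (j : ℕ) :
    ∑ a ∈ cellIndex n j, chi Ω ((measurableSet_cell j a).inter hA) = chi Ω hA := by
  refine sum_chi hA _ _ fun z => ?_
  by_cases hz : z ∈ A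
  · rw [Finset.sum_eq_single_of_mem (cellLabel j z)
      (cellLabel_mem_cellIndex (mem_ball_zero_iff.1 (hn hz)) j)]
    · rw [Set.indicator_of_mem (show z ∈ cell j (cellLabel j z) ∩ A from ⟨rfl, hz⟩),
        Set.indicator_of_mem hz]
    · intro b _ hb
      exact Set.indicator_of_notMem (fun h => hb (show cellLabel j z = b from h.1).symm) _
  · rw [Set.indicator_of_notMem hz]
    exact Finset.sum_eq_zero fun b _ => Set.indicator_of_notMem (fun h => hz h.2) _

theorem exists_chi_cell_inter_ne_zero {A : Set ℂ} (hA : MeasurableSet A) {n : ℕ}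
    (hn : A ⊆ Metric.ball (0 : ℂ) n) (j : ℕ) {x : L2 Ω} (hx : chi Ω hA x ≠ 0) :
    ∃ a ∈ cellIndex n j, chi Ω ((measurableSet_cell j a).inter hA) x ≠ 0 := by
  by_contra! h
  refine hx ?_
  rw [← sum_chi_cell_inter hA hn j, sum_apply]
  exact Finset.sum_eq_zero h

/-- The (unnormalised) indicator function of a cell, as an element of `L²(Ω)`; for labels in
`cellIndex n j` it does not depend on `n`. -/
def cellVec (Ω : Set ℂ) (n j : ℕ) (a : ℕ × ℤ × ℤ) : L2 Ω :=
  chi Ω (measurableSet_cell j a) (ballVec Ω n)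

/-- The projection onto the functions that vanish outside the ball of radius `n` and are constant
on the cells of level `j`. -/
def cellProj (Ω : Set ℂ) (n j : ℕ) : BL2 Ω :=
  transfer (cellIndex n j) (cellVec Ω n j) (cellVec Ω n j)

theorem pairwise_inner_cellVec_eq_zero (n j : ℕ) (s : Set (ℕ × ℤ × ℤ)) :
    s.Pairwise fun a b => ⟪cellVec Ω n j a, cellVec Ω n j b⟫_ℂ = 0 := fun _ _ _ _ h =>
  inner_chi_chi_of_disjoint _ _ (disjoint_cell h) _ _

theorem chi_cell_cellVec (n j : ℕ) (a : ℕ × ℤ × ℤ) :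
    chi Ω (measurableSet_cell j a) (cellVec Ω n j a) = cellVec Ω n j a := by
  rw [cellVec, ← mul_apply_eq_comp, (isStarProjection_chi _).isIdempotentElem.eq]

theorem cellProj_chi_ballVec {n m j : ℕ} {A : Set ℂ} (hA : MeasurableSet A)
    (hn : A ⊆ Metric.ball (0 : ℂ) n) (hm : A ⊆ Metric.ball (0 : ℂ) m) (hs : Saturated j A) :
    cellProj Ω n j (chi Ω hA (ballVec Ω m)) = chi Ω hA (ballVec Ω m) := by
  rw [chi_ballVec_eq hA hm hn, ← sum_chi_cell_inter hA hn j, sum_apply, map_sum]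
  refine Finset.sum_congr rfl fun a ha => ?_
  rw [← chi_mul_chi (measurableSet_cell j a) hA]
  rcases hs.cell_subset_or_disjoint a with h | h
  · rw [chi_mul_chi_of_subset_left _ _ h]
    exact transfer_self_apply_of_mem (pairwise_inner_cellVec_eq_zero n j _) ha
  · rw [chi_mul_chi_of_disjoint _ _ h, zero_apply, map_zero]

theorem isStarProjection_cellProj (n j : ℕ) : IsStarProjection (cellProj Ω n j) :=
  isStarProjection_transfer_self (pairwise_inner_cellVec_eq_zero n j _)

theorem cellProj_mul_cellProj {n m i j : ℕ} (hnm : n ≤ m) (hij : i ≤ j) :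
    cellProj Ω m j * cellProj Ω n i = cellProj Ω n i := by
  refine mul_transfer_of_forall_apply_eq fun a ha => ?_
  have h := cell_subset_ball ha
  exact cellProj_chi_ballVec _ (h.trans (Metric.ball_subset_ball (by exact_mod_cast hnm))) h
    (saturated_cell hij a)

theorem isFlag_cellProj (Ω : Set ℂ) (n : ℕ) : IsFlag (cellProj Ω n) where
  isStarProjection := isStarProjection_cellProj n
  mul_eq_left h := by
    simpa [(isStarProjection_cellProj _ _).isSelfAdjoint.star_eq] using
      congrArg star (cellProj_mul_cellProj (Ω := Ω) (le_refl n) h)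

theorem chiBall_mul_cellProj (n j : ℕ) :
    chiBall Ω n * cellProj Ω n j = cellProj Ω n j := by
  refine mul_transfer_of_forall_apply_eq fun a ha => ?_
  rw [cellVec, ← mul_apply_eq_comp, chi_mul_chi_of_subset_right _ _ (cell_subset_ball ha)]

theorem hsNorm_cellProj_le (n j : ℕ) :
    hsNorm (cellProj Ω n j) ≤ ENNReal.ofReal ((2 * n + 1) ^ 2 * 2 ^ j) := by
  have hcast : ENNReal.ofReal ((2 * n + 1) ^ 2 * 2 ^ j)
      = (((2 * n + 1) ^ 2 * 2 ^ j : ℕ) : ℝ≥0∞) := by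
    rw [← ENNReal.ofReal_natCast]; push_cast; rfl
  rw [hsNorm_le_iff_hsSq_le, hcast]
  refine (hsSq_transfer_self_le (pairwise_inner_cellVec_eq_zero n j _)).trans ?_
  exact_mod_cast card_cellIndex_le n j

end CellProjections

/-! ### Almost commuting projections above the cell projections -/

section StepOps

variable {Ω : Set ℂ}

/-- The operators of multiplication by functions that vanish outside the ball of radius `n` and are
constant on the cells of level `j`. -/
def stepOps (Ω : Set ℂ) (n j : ℕ) : Set (BL2 Ω) :=
  Set.range fun c : ℕ × ℤ × ℤ → ℂ => ∑ a ∈ cellIndex n j, c a • chi Ω (measurableSet_cell j a)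

theorem commute_of_mem_stepOps {n j : ℕ} {T S : BL2 Ω} (hT : T ∈ stepOps Ω n j)
    (h : ∀ a ∈ cellIndex n j, Commute (chi Ω (measurableSet_cell j a)) S) : Commute T S := by
  obtain ⟨c, rfl⟩ := hT
  exact Commute.sum_left _ _ _ fun a ha => (h a ha).smul_left _

theorem sum_smul_chi_cell_apply_ae (n j : ℕ) (c : ℕ × ℤ × ℤ → ℂ) (x : L2 Ω) :
    (∑ a ∈ cellIndex n j, c a • chi Ω (measurableSet_cell j a)) x =ᵐ[leb Ω]
      (Metric.ball (0 : ℂ) n).indicator fun z => c (cellLabel j z) * x z := by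
  have hsmul : ∀ᵐ z ∂leb Ω, ∀ a, (c a • chi Ω (measurableSet_cell j a) x : L2 Ω) z
      = c a * (cell j a).indicator x z := by
    refine ae_all_iff.2 fun a => ?_
    filter_upwards [Lp.coeFn_smul (c a) (chi Ω (measurableSet_cell j a) x),
      chi_apply_ae (measurableSet_cell j a) x] with z h1 h2
    rw [h1, Pi.smul_apply, h2, smul_eq_mul]
  simp only [sum_apply, smul_apply]
  filter_upwards [hsmul,
    coeFn_finsetSum_ae (cellIndex n j) fun a => c a • chi Ω (measurableSet_cell j a) x] with z h1 h2
  rw [h2, Finset.sum_congr rfl fun a _ => h1 a]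
  by_cases hz : z ∈ Metric.ball (0 : ℂ) n
  · rw [Set.indicator_of_mem hz, Finset.sum_eq_single_of_mem (cellLabel j z)
      (cellLabel_mem_cellIndex (mem_ball_zero_iff.1 hz) j)]
    · rw [Set.indicator_of_mem (show z ∈ cell j (cellLabel j z) from rfl)]
    · intro b _ hb
      rw [Set.indicator_of_notMem fun h : z ∈ cell j b => hb (Eq.symm h), mul_zero]
  · rw [Set.indicator_of_notMem hz]
    exact Finset.sum_eq_zero fun a ha => by
      rw [Set.indicator_of_notMem fun h => hz (cell_subset_ball ha h), mul_zero]

theorem exists_stepOps_near_of_ae {f : Lp ℂ ∞ (leb Ω)} {r : ℝ} (hr : 0 ≤ r) (n j : ℕ)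
    (h : ∀ a, ∃ c : ℂ, ∀ᵐ z ∂leb Ω, z ∈ cell j a → ‖f z - c‖ ≤ r) :
    ∃ g ∈ stepOps Ω n j, ‖(mulOp f - g) * chiBall Ω n‖ ≤ r := by
  choose c hc using h
  refine ⟨_, ⟨c, rfl⟩, ContinuousLinearMap.opNorm_le_bound _ hr fun x => ?_⟩
  refine Lp.norm_le_mul_norm_of_ae_le_mul ?_
  rw [mul_apply_eq_comp, sub_apply]
  filter_upwards [ae_all_iff.2 hc, Lp.coeFn_sub (mulOp f (chiBall Ω n x))
      ((∑ a ∈ cellIndex n j, c a • chi Ω (measurableSet_cell j a)) (chiBall Ω n x)),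
    mulOp_apply_ae f (chiBall Ω n x), sum_smul_chi_cell_apply_ae n j c (chiBall Ω n x),
    chi_apply_ae (measurableSet_ball (x := (0 : ℂ)) (ε := n)) x] with z h1 h2 h3 h4 h5
  rw [h2, Pi.sub_apply, h3, h4, h5]
  by_cases hz : z ∈ Metric.ball (0 : ℂ) n
  · rw [Set.indicator_of_mem hz, Set.indicator_of_mem hz, h5, Set.indicator_of_mem hz, ← sub_mul,
      norm_mul]
    exact mul_le_mul_of_nonneg_right (h1 _ rfl) (norm_nonneg _)
  · rw [Set.indicator_of_notMem hz, Set.indicator_of_notMem hz, mul_zero, sub_zero, norm_zero]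
    positivity

theorem exists_stepOps_near {f : Lp ℂ ∞ (leb Ω)} (hf : lipNorm f ≤ 1) (n j : ℕ) :
    ∃ g ∈ stepOps Ω n j, ‖(mulOp f - g) * chiBall Ω n‖ ≤ 2 / 2 ^ j :=
  exists_stepOps_near_of_ae (by positivity) n j fun _ =>
    exists_ae_norm_sub_le_of_diam_le hf fun _ hs _ ht =>
      norm_sub_le_of_cellLabel_eq (cellLabel_eq_of_mem hs ht)

theorem exists_chi_eq_smul {A B : Set ℂ} (hA : MeasurableSet A) (hB : MeasurableSet B)
    (h : A ⊆ B ∨ Disjoint A B) :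
    ∃ κ : ℝ, ∀ x : L2 Ω, chi Ω hA x = x → chi Ω hB x = (κ : ℂ) • x := by
  rcases h with h | h
  · refine ⟨1, fun x hx => ?_⟩
    rw [← hx, ← mul_apply_eq_comp, chi_mul_chi_of_subset_right hA hB h]; simp
  · refine ⟨0, fun x hx => ?_⟩
    rw [← hx, ← mul_apply_eq_comp, chi_mul_chi_of_disjoint hB hA h.symm]; simp

theorem Saturated.commute_chi_transfer {j : ℕ} {B : Set ℂ} (hs : Saturated j B)
    (hB : MeasurableSet B) {ι : Type*} {s : Finset ι} {x y : ι → L2 Ω}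
    (h : ∀ i ∈ s, ∃ a, chi Ω (measurableSet_cell j a) (x i) = x i ∧
      chi Ω (measurableSet_cell j a) (y i) = y i) :
    Commute (chi Ω hB) (transfer s y x) := by
  refine commute_transfer (isStarProjection_chi hB).isSelfAdjoint fun i hi => ?_
  obtain ⟨a, hx, hy⟩ := h i hi
  obtain ⟨κ, hκ⟩ := exists_chi_eq_smul (Ω := Ω) (measurableSet_cell j a) hB
    (hs.cell_subset_or_disjoint a)
  exact ⟨κ, hκ _ hx, hκ _ hy⟩

theorem Saturated.commute_chi_cellProj {j : ℕ} {B : Set ℂ} (hs : Saturated j B)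
    (hB : MeasurableSet B) (n : ℕ) : Commute (chi Ω hB) (cellProj Ω n j) :=
  hs.commute_chi_transfer hB fun a _ => ⟨a, chi_cell_cellVec n j a, chi_cell_cellVec n j a⟩

end StepOps

section BalancedDiff

variable {H : Type*} [NormedAddCommGroup H] [InnerProductSpace ℂ H] {u v : H}

/-- For orthogonal `u` and `v`, the vector in their span that is orthogonal to `u + v`. -/
def balancedDiff (u v : H) : H := ((‖v‖ ^ 2 : ℝ) : ℂ) • u - ((‖u‖ ^ 2 : ℝ) : ℂ) • v

theorem inner_add_balancedDiff (h : ⟪u, v⟫_ℂ = 0) : ⟪u + v, balancedDiff u v⟫_ℂ = 0 := by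
  have h' : ⟪v, u⟫_ℂ = 0 := inner_eq_zero_symm.1 h
  simp only [balancedDiff, inner_sub_right, inner_smul_right, inner_add_left, h, h',
    inner_self_eq_norm_sq_to_K]
  push_cast
  exact sub_eq_zero.2 (by simp [mul_comm])

theorem balancedDiff_ne_zero (h : ⟪u, v⟫_ℂ = 0) (hu : u ≠ 0) (hv : v ≠ 0) :
    balancedDiff u v ≠ 0 := by
  intro h0
  have hinner : ⟪u, balancedDiff u v⟫_ℂ = 0 := by rw [h0, inner_zero_right]
  simp [balancedDiff, h, hu, hv] at hinner

theorem map_balancedDiff_eq {T : H →L[ℂ] H} (hu : T u = u) (hv : T v = v) :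
    T (balancedDiff u v) = balancedDiff u v := by
  rw [balancedDiff, map_sub, map_smul, map_smul, hu, hv]

end BalancedDiff

section MovedVectors

variable {Ω : Set ℂ}

theorem chi_inter_add_chi_diff {A B : Set ℂ} (hA : MeasurableSet A) (hB : MeasurableSet B) :
    chi Ω (hA.inter hB) + chi Ω (hB.diff hA) = chi Ω hB := by
  have h := sum_chi (Ω := Ω) (s := Finset.univ) hB
    (C := fun i : Bool => bif i then A ∩ B else B \ A)
    (fun i => by cases i; exacts [hB.diff hA, hA.inter hB]) (fun z => by
      by_cases hzA : z ∈ A <;> by_cases hzB : z ∈ B <;> simp [hzA, hzB])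
  rwa [Fintype.sum_bool] at h

theorem exists_cell_splitting {R : Set ℂ} (hR : MeasurableSet R) {n : ℕ}
    (hRn : R ⊆ Metric.ball (0 : ℂ) n) (N : ℕ) (h : chi Ω hR (ballVec Ω n) ≠ 0) :
    ∃ M d, N ≤ M ∧ chi Ω ((measurableSet_cell M d).inter hR) (ballVec Ω n) ≠ 0 ∧
      chi Ω (hR.diff (measurableSet_cell M d)) (ballVec Ω n) ≠ 0 := by
  obtain ⟨M, hM, hvol⟩ := exists_volume_cell_lt N (ε := ‖chi Ω hR (ballVec Ω n)‖ₑ ^ 2)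
    (pos_iff_ne_zero.2 (pow_ne_zero 2 (by simpa using h)))
  obtain ⟨d, -, hd⟩ := exists_chi_cell_inter_ne_zero hR hRn M h
  refine ⟨M, d, hM, hd, fun hdiff => (hvol d).not_ge ?_⟩
  rw [← chi_inter_add_chi_diff (measurableSet_cell M d) hR, add_apply, hdiff, add_zero]
  exact (enorm_chi_ballVec_sq_le _ n).trans (measure_mono Set.inter_subset_left)

/-- `y` is a place to which the indicator function of the cell `a` of level `N` can be moved: a
function with mean zero concentrated in that cell and in a cell of level `L`, and constant on the
cells of level `M`; it vanishes exactly if the cell is null. -/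
structure IsMovedCellVec (Ω : Set ℂ) (n N L M : ℕ) (a : ℕ × ℤ × ℤ) (y : L2 Ω) : Prop where
  eq_zero_iff : y = 0 ↔ cellVec Ω n N a = 0
  exists_chi_eq : ∃ b, chi Ω (measurableSet_cell L b) y = y
  chi_eq : chi Ω (measurableSet_cell N a) y = y
  inner_eq_zero : ⟪cellVec Ω n N a, y⟫_ℂ = 0
  cellProj_eq : ∀ M', M ≤ M' → cellProj Ω n M' y = y

theorem isMovedCellVec_balancedDiff {n N L M : ℕ} {a b d : ℕ × ℤ × ℤ} {R : Set ℂ}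
    (ha : a ∈ cellIndex n N) (hR : MeasurableSet R) (hRs : Saturated M R) (hRL : R ⊆ cell L b)
    (hRN : R ⊆ cell N a)
    (hu : chi Ω ((measurableSet_cell M d).inter hR) (ballVec Ω n) ≠ 0)
    (hv : chi Ω (hR.diff (measurableSet_cell M d)) (ballVec Ω n) ≠ 0) :
    IsMovedCellVec Ω n N L M a (balancedDiff
      (chi Ω ((measurableSet_cell M d).inter hR) (ballVec Ω n))
      (chi Ω (hR.diff (measurableSet_cell M d)) (ballVec Ω n))) := by
  have hRn : R ⊆ Metric.ball (0 : ℂ) n := hRN.trans (cell_subset_ball ha)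
  set u := chi Ω ((measurableSet_cell M d).inter hR) (ballVec Ω n) with hu_def
  set v := chi Ω (hR.diff (measurableSet_cell M d)) (ballVec Ω n)
  have huv : ⟪u, v⟫_ℂ = 0 :=
    inner_chi_chi_of_disjoint _ _ (Set.disjoint_left.2 fun z hz hz' => hz'.2 hz.1) _ _
  have chi_eq : ∀ {B : Set ℂ} (hB : MeasurableSet B), R ⊆ B →
      chi Ω hB (balancedDiff u v) = balancedDiff u v := fun {B} hB hRB => by
    refine map_balancedDiff_eq ?_ ?_
    · rw [← mul_apply_eq_comp, chi_mul_chi_of_subset_right _ _ (Set.inter_subset_right.trans hRB)]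
    · rw [← mul_apply_eq_comp, chi_mul_chi_of_subset_right _ _ (Set.sdiff_subset.trans hRB)]
  have cellProj_chi : ∀ {M' : ℕ} {B : Set ℂ} (hB : MeasurableSet B), M ≤ M' → B ⊆ R →
      Saturated M B → cellProj Ω n M' (chi Ω hB (ballVec Ω n)) = chi Ω hB (ballVec Ω n) :=
    fun hB hM hBR hs => cellProj_chi_ballVec _ (hBR.trans hRn) (hBR.trans hRn) (hs.mono hM)
  refine ⟨iff_of_false (balancedDiff_ne_zero huv hu hv) fun h0 => hu ?_, ⟨b, chi_eq _ hRL⟩,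
    chi_eq _ hRN, ?_, fun M' hM' => map_balancedDiff_eq
      (cellProj_chi _ hM' Set.inter_subset_right ((saturated_cell le_rfl d).inter hRs))
      (cellProj_chi _ hM' Set.sdiff_subset (hRs.diff (saturated_cell le_rfl d)))⟩
  · rw [hu_def, ← chi_mul_chi_of_subset_left _ (measurableSet_cell N a)
      (Set.inter_subset_right.trans hRN), mul_apply_eq_comp]
    exact (congrArg _ h0).trans (map_zero _)
  · rw [← chi_eq hR subset_rfl, ← inner_chi_left, cellVec, ← mul_apply_eq_comp,
      chi_mul_chi_of_subset_left _ _ hRN, ← chi_inter_add_chi_diff (measurableSet_cell M d) hR,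
      add_apply, inner_add_balancedDiff huv]

theorem exists_isMovedCellVec {n N : ℕ} {a : ℕ × ℤ × ℤ} (ha : a ∈ cellIndex n N) (L : ℕ) :
    ∃ M y, IsMovedCellVec Ω n N L M a y := by
  by_cases h : cellVec Ω n N a = 0
  · exact ⟨0, 0, iff_of_true rfl h, ⟨a, map_zero _⟩, map_zero _, inner_zero_right _,
      fun _ _ => map_zero _⟩
  · obtain ⟨b, -, hb⟩ := exists_chi_cell_inter_ne_zero (measurableSet_cell N a)
      (cell_subset_ball ha) (max L N) h
    obtain ⟨b', hb'⟩ := exists_cell_subset_of_le (le_max_left L N) b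
    have hR := (measurableSet_cell (max L N) b).inter (measurableSet_cell N a)
    obtain ⟨M, d, hM, hu, hv⟩ := exists_cell_splitting hR
      (Set.inter_subset_right.trans (cell_subset_ball ha)) (max L N) hb
    exact ⟨M, _, isMovedCellVec_balancedDiff ha hR
      (((saturated_cell le_rfl b).inter (saturated_cell (le_max_right L N) a)).mono hM)
      (Set.inter_subset_left.trans hb') Set.inter_subset_right hu hv⟩

theorem exists_isOrthogonalMove_cellProj (Ω : Set ℂ) (n N L : ℕ) : ∃ (W : BL2 Ω) (M : ℕ),
    N ≤ M ∧ IsOrthogonalMove (cellProj Ω n N) W ∧ cellProj Ω n M * W = W ∧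
    (∀ g ∈ stepOps Ω n N, Commute g W) ∧ (∀ g ∈ stepOps Ω n L, Commute g (W * star W)) ∧
    ∀ m, Commute (chiBall Ω m) W := by
  choose! M y hy using fun a (ha : a ∈ cellIndex n N) => exists_isMovedCellVec (Ω := Ω) ha L
  have inner_cell_cell : ∀ {a b : ℕ × ℤ × ℤ}, a ≠ b → ∀ u v : L2 Ω,
      chi Ω (measurableSet_cell N a) u = u → chi Ω (measurableSet_cell N b) v = v →
      ⟪u, v⟫_ℂ = 0 := fun hab u v hu hv => by
    rw [← hu, ← hv]
    exact inner_chi_chi_of_disjoint _ _ (disjoint_cell hab) _ _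
  have hyy : (cellIndex n N : Set (ℕ × ℤ × ℤ)).Pairwise fun a b => ⟪y a, y b⟫_ℂ = 0 :=
    fun a ha b hb hab => inner_cell_cell hab _ _ (hy a ha).chi_eq (hy b hb).chi_eq
  have hxy : ∀ a ∈ cellIndex n N, ∀ b ∈ cellIndex n N, ⟪cellVec Ω n N a, y b⟫_ℂ = 0 := by
    intro a ha b hb
    by_cases hab : a = b
    · exact hab ▸ (hy a ha).inner_eq_zero
    · exact inner_cell_cell hab _ _ (chi_cell_cellVec n N a) (hy b hb).chi_eq
  have hcomm : ∀ {B : Set ℂ} (hB : MeasurableSet B), Saturated N B →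
      Commute (chi Ω hB) (transfer (cellIndex n N) y (cellVec Ω n N)) := fun hB hs =>
    hs.commute_chi_transfer hB fun a ha => ⟨a, chi_cell_cellVec n N a, (hy a ha).chi_eq⟩
  refine ⟨transfer (cellIndex n N) y (cellVec Ω n N), max N ((cellIndex n N).sup M),
    le_max_left _ _, ⟨isStarProjection_cellProj n N, ?_, transfer_mul_transfer_eq_zero hxy⟩,
    mul_transfer_of_forall_apply_eq fun a ha => (hy a ha).cellProj_eq _
      ((Finset.le_sup ha).trans (le_max_right _ _)),
    fun g hg => commute_of_mem_stepOps hg fun a _ => hcomm _ (saturated_cell le_rfl a),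
    fun g hg => ?_, fun m => hcomm _ (saturated_ball N m)⟩
  · rw [star_transfer]
    exact transfer_mul_transfer hyy fun a ha => (hy a ha).eq_zero_iff.1
  · rw [star_transfer, transfer_mul_transfer (pairwise_inner_cellVec_eq_zero n N _) fun a ha =>
      (hy a ha).eq_zero_iff.2]
    refine commute_of_mem_stepOps hg fun c _ =>
      (saturated_cell le_rfl c).commute_chi_transfer _ fun a ha => ?_
    obtain ⟨b, hb⟩ := (hy a ha).exists_chi_eq
    exact ⟨b, hb, hb⟩

end MovedVectors

section AlmostCommuting

/-- The multiplication operators over which the supremum in `lipL` is taken. -/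
def lipUnitBall (Ω : Set ℂ) : Set (BL2 Ω) :=
  mulOp '' {f | f ∈ essLip Ω ∧ lipNorm f ≤ 1}

theorem isDyadicFlag_cellProj (Ω : Set ℂ) (n : ℕ) :
    IsDyadicFlag (cellProj Ω n) (chiBall Ω n) (lipUnitBall Ω) (stepOps Ω n) ((2 * n + 1) ^ 2) where
  isFlag := isFlag_cellProj Ω n
  mul_flag := chiBall_mul_cellProj n
  star_mem := by
    rintro _ ⟨f, ⟨hf, hf1⟩, rfl⟩
    exact ⟨star f, ⟨star_mem_essLip hf, (lipNorm_star f).trans_le hf1⟩, (star_mulOp f).symm⟩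
  exists_near := by
    rintro _ ⟨f, ⟨-, hf1⟩, rfl⟩ i
    exact exists_stepOps_near hf1 n i
  commute _ _ hg := commute_of_mem_stepOps hg fun a _ =>
    (saturated_cell le_rfl a).commute_chi_cellProj _ n
  nonneg := by positivity
  hsNorm_le := hsNorm_cellProj_le n

theorem exists_almost_commuting_above_cellProj (Ω : Set ℂ) (n j : ℕ) {ε : ℝ} (hε : 0 < ε) :
    ∃ (P : BL2 Ω) (M : ℕ), j ≤ M ∧ IsStarProjection P ∧ P * cellProj Ω n j = cellProj Ω n j ∧
      cellProj Ω n M * P = P ∧ lipL P ≤ ENNReal.ofReal ε ∧ ∀ m, Commute (chiBall Ω m) P := by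
  have hmove : ∀ N L : ℕ, ∃ (W : BL2 Ω) (M : ℕ), N ≤ M ∧ IsOrthogonalMove (cellProj Ω n N) W ∧
      cellProj Ω n M * W = W ∧ (∀ g ∈ stepOps Ω n N, Commute g W) ∧
      (∀ g ∈ stepOps Ω n L, Commute g (W * star W)) ∧
      ∀ T ∈ Set.range (chiBall Ω), Commute T W := fun N L => by
    simpa only [Set.forall_mem_range] using exists_isOrthogonalMove_cellProj Ω n N L
  obtain ⟨P, M, hjM, hP, hPj, hMP, hlip, hcomm⟩ :=
    (isDyadicFlag_cellProj Ω n).exists_almost_commuting_projection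
      (Set.forall_mem_range.2 fun m => (isStarProjection_chi _).isSelfAdjoint)
      (Set.forall_mem_range.2 fun m i => (saturated_ball i m).commute_chi_cellProj _ n)
      hmove j hε
  exact ⟨P, M, hjM, hP, hPj, hMP, iSup₂_le fun f hf => hlip _ (Set.mem_image_of_mem _ hf),
    Set.forall_mem_range.1 hcomm⟩

end AlmostCommuting

/-! ### Almost commuting projections of finite rank -/

section FiniteRank

variable {H : Type*} [NormedAddCommGroup H] [InnerProductSpace ℂ H]

theorem isCompactOperator_of_finiteDimensional_range {T : H →L[ℂ] H}
    (h : FiniteDimensional ℂ T.range) : IsCompactOperator T := by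
  have : ProperSpace T.range := FiniteDimensional.proper ℂ _
  exact (isCompactOperator_of_locallyCompactSpace_dom
    (T.rangeRestrict : H →L[ℂ] T.range)).clm_comp T.range.subtypeL

theorem finiteDimensional_range_comp {H' : Type*} [NormedAddCommGroup H']
    [InnerProductSpace ℂ H'] {T : H →L[ℂ] H} (h : FiniteDimensional ℂ T.range)
    (A : H →L[ℂ] H') (B : H' →L[ℂ] H) : FiniteDimensional ℂ (A ∘L T ∘L B).range := by
  have hle : (A ∘L T ∘L B).range ≤ T.range.map (A : H →ₗ[ℂ] H') := by
    rintro _ ⟨v, rfl⟩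
    exact ⟨T (B v), ⟨B v, rfl⟩, rfl⟩
  exact Submodule.finiteDimensional_of_le hle

theorem finiteDimensional_range_of_mul_eq {S T : H →L[ℂ] H} (hS : FiniteDimensional ℂ S.range)
    (h : S * T = T) : FiniteDimensional ℂ T.range := by
  have hle : T.range ≤ S.range := by
    rintro _ ⟨v, rfl⟩
    exact ⟨T v, congrArg (fun R : H →L[ℂ] H => R v) h⟩
  exact Submodule.finiteDimensional_of_le hle

variable [CompleteSpace H]

theorem hsNorm_lt_top_of_finiteDimensional_range {T : H →L[ℂ] H}
    (h : FiniteDimensional ℂ T.range) : hsNorm T < ∞ := by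
  have hT : T = T.range.starProjection * T := by
    ext1 x
    rw [mul_apply_eq_comp]
    exact (Submodule.starProjection_eq_self_iff.2
      (LinearMap.mem_range_self (T : H →ₗ[ℂ] H) x)).symm
  rw [hT]
  refine (hsNorm_mul_le' _ _).trans_lt (ENNReal.mul_lt_top ?_ enorm_lt_top)
  rw [(stdOrthonormalBasis ℂ T.range).starProjection_eq_sum_rankOne]
  refine (hsNorm_sum_le _ _).trans_lt (ENNReal.sum_lt_top.2 fun i _ => ?_)
  rw [hsNorm_lt_top_iff, hsSq_rankOne]
  exact ENNReal.mul_lt_top (ENNReal.pow_lt_top enorm_lt_top) (ENNReal.pow_lt_top enorm_lt_top)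

theorem norm_sub_apply_le_of_isStarProjection {P : H →L[ℂ] H} (hP : IsStarProjection P) {x y : H}
    (hy : P y = y) : ‖x - P x‖ ≤ ‖x - y‖ := by
  have hxy : x - P x = (1 - P) (x - y) := by simp [hy]
  rw [hxy]
  simpa only [one_mul] using (1 - P).le_of_opNorm_le hP.one_sub.norm_le (x - y)

end FiniteRank

section Density

variable {Ω : Set ℂ}

theorem lipL_lt_top_of_hsNorm_lt_top {T : BL2 Ω} (hT : hsNorm T < ∞) {n : ℕ}
    (hleft : chiBall Ω n * T = T) (hright : T * chiBall Ω n = T) : lipL T < ∞ := by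
  suffices h : lipL T ≤
      ENNReal.ofReal (2 * n) * hsNorm T + ENNReal.ofReal (2 * n) * hsNorm T from
    h.trans_lt (ENNReal.add_lt_top.2 ⟨ENNReal.mul_lt_top ENNReal.ofReal_lt_top hT,
      ENNReal.mul_lt_top ENNReal.ofReal_lt_top hT⟩)
  refine iSup₂_le fun f hf => ?_
  obtain ⟨c, hc⟩ := exists_ae_norm_sub_le_of_diam_le (A := Metric.ball (0 : ℂ) n) hf.2
    (r := 2 * n) fun s hs t ht => by
      rw [mem_ball_zero_iff] at hs ht
      linarith [norm_sub_le s t]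
  set F : BL2 Ω := (mulOp f - c • 1) * chiBall Ω n with hF
  have hnorm : ‖F‖ ≤ 2 * n := norm_mulOp_sub_smul_mul_chi_le measurableSet_ball (by positivity) hc
  have hcomm : Commute (chiBall Ω n) (mulOp f - c • (1 : BL2 Ω)) :=
    (commute_chi_mulOp _ f).sub_right ((Commute.one_right _).smul_right c)
  have hFT : mulOp f * T - T * mulOp f = F * T - T * F := by
    rw [hF, mul_assoc, hleft, ← hcomm.eq, ← mul_assoc, hright, sub_mul, mul_sub, smul_mul_assoc,
      mul_smul_comm, one_mul, mul_one]
    abel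
  rw [hFT]
  exact (hsNorm_sub_le _ _).trans (add_le_add (hsNorm_mul_le_of_norm_le_left hnorm _)
    (hsNorm_mul_le_of_norm_le_right hnorm _))

theorem exists_norm_sub_le_on_cells {g : ℂ → ℂ} (hg : UniformContinuous g) {r : ℝ} (hr : 0 < r) :
    ∃ j, ∀ a, ∃ c, ∀ z ∈ cell j a, ‖g z - c‖ ≤ r := by
  obtain ⟨δ, hδ, hgδ⟩ := Metric.uniformContinuous_iff.1 hg r hr
  obtain ⟨j, hj⟩ := exists_forall_div_two_pow_le 2 (half_pos hδ)
  refine ⟨j, fun a => ?_⟩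
  rcases (cell j a).eq_empty_or_nonempty with ha | ⟨t, ht⟩
  · exact ⟨0, fun z hz => absurd hz (ha ▸ Set.notMem_empty z)⟩
  refine ⟨g t, fun z hz => ?_⟩
  rw [← dist_eq_norm]
  refine (hgδ ?_).le
  rw [dist_eq_norm]
  exact (norm_sub_le_of_cellLabel_eq (cellLabel_eq_of_mem hz ht)).trans_lt
    ((hj j le_rfl).trans_lt (half_lt_self hδ))

theorem chiBall_ballVec (n : ℕ) : chiBall Ω n (ballVec Ω n) = ballVec Ω n := by
  refine Lp.ext ?_
  filter_upwards [chi_apply_ae (measurableSet_ball (x := (0 : ℂ)) (ε := n)) (ballVec Ω n),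
    ballVec_ae (Ω := Ω) n] with z h1 h2
  rw [h1]
  by_cases hz : z ∈ Metric.ball (0 : ℂ) n
  · rw [Set.indicator_of_mem hz]
  · rw [Set.indicator_of_notMem hz, h2, Set.indicator_of_notMem hz]

theorem mulOp_toLp_ballVec {g : ℂ → ℂ} {n : ℕ} (hsupp : ∀ z ∉ Metric.ball (0 : ℂ) n, g z = 0)
    (hg : MemLp g ∞ (leb Ω)) (hg2 : MemLp g 2 (leb Ω)) :
    mulOp hg.toLp (ballVec Ω n) = hg2.toLp := by
  refine Lp.ext ?_
  filter_upwards [mulOp_apply_ae hg.toLp (ballVec Ω n), hg.coeFn_toLp, hg2.coeFn_toLp,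
    ballVec_ae (Ω := Ω) n] with z h1 h2 h3 h4
  rw [h1, h2, h3, h4]
  by_cases hz : z ∈ Metric.ball (0 : ℂ) n
  · rw [Set.indicator_of_mem hz, mul_one]
  · rw [hsupp z hz, zero_mul]

theorem cellProj_stepOps_ballVec {n j : ℕ} {T : BL2 Ω} (hT : T ∈ stepOps Ω n j) :
    cellProj Ω n j (T (ballVec Ω n)) = T (ballVec Ω n) := by
  obtain ⟨c, rfl⟩ := hT
  simp only [sum_apply, smul_apply, map_sum, map_smul]
  refine Finset.sum_congr rfl fun a ha => ?_
  exact congrArg _ (transfer_self_apply_of_mem (pairwise_inner_cellVec_eq_zero n j _) ha)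

theorem exists_norm_sub_cellProj_toLp_le {g : ℂ → ℂ} (hgc : Continuous g)
    (hgs : HasCompactSupport g) (hg2 : MemLp g 2 (leb Ω)) {ε : ℝ} (hε : 0 < ε) :
    ∃ n j : ℕ, ‖hg2.toLp - cellProj Ω n j hg2.toLp‖ ≤ ε := by
  obtain ⟨R, hR⟩ := hgs.isCompact.isBounded.subset_ball 0
  obtain ⟨n, hn⟩ := exists_nat_ge R
  have hsupp : ∀ z ∉ Metric.ball (0 : ℂ) n, g z = 0 := fun z hz =>
    image_eq_zero_of_notMem_tsupport fun h => hz (Metric.ball_subset_ball hn (hR h))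
  obtain ⟨C, hC⟩ := hgs.exists_bound_of_continuous hgc
  have hg : MemLp g ∞ (leb Ω) :=
    memLp_top_of_bound hgc.aestronglyMeasurable C (Eventually.of_forall hC)
  have hr : 0 < ε / (‖ballVec Ω n‖ + 1) := by positivity
  obtain ⟨j, hj⟩ := exists_norm_sub_le_on_cells
    (hgc.uniformContinuous_of_tendsto_cocompact hgs.is_zero_at_infty) hr
  obtain ⟨T, hT, hgT⟩ := exists_stepOps_near_of_ae (f := hg.toLp) hr.le n j fun a => by
    obtain ⟨c, hc⟩ := hj a
    refine ⟨c, ?_⟩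
    filter_upwards [hg.coeFn_toLp] with z hz hza
    rw [hz]
    exact hc z hza
  refine ⟨n, j, (norm_sub_apply_le_of_isStarProjection (isStarProjection_cellProj n j)
    (cellProj_stepOps_ballVec hT)).trans ?_⟩
  have hle := ContinuousLinearMap.le_of_opNorm_le _ hgT (ballVec Ω n)
  rw [mul_apply_eq_comp, chiBall_ballVec, sub_apply, mulOp_toLp_ballVec hsupp hg hg2] at hle
  refine hle.trans ?_
  rw [div_mul_eq_mul_div, div_le_iff₀ (by positivity)]
  nlinarith [norm_nonneg (ballVec Ω n)]

theorem exists_norm_sub_cellProj_le (x : L2 Ω) {ε : ℝ} (hε : 0 < ε) :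
    ∃ n j : ℕ, ‖x - cellProj Ω n j x‖ ≤ ε := by
  obtain ⟨g, hgs, hgx, hgc, hgm⟩ := (Lp.memLp x).exists_hasCompactSupport_eLpNorm_sub_le
    (by norm_num) (ε := ENNReal.ofReal (ε / 2)) (by simpa using hε)
  obtain ⟨n, j, hnj⟩ := exists_norm_sub_cellProj_toLp_le hgc hgs hgm (half_pos hε)
  have hxg : ‖x - hgm.toLp‖ ≤ ε / 2 := by
    rw [Lp.norm_def]
    refine ENNReal.toReal_le_of_le_ofReal (by positivity) (le_trans (le_of_eq ?_) hgx)
    refine eLpNorm_congr_ae ?_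
    filter_upwards [Lp.coeFn_sub x hgm.toLp, hgm.coeFn_toLp] with z h1 h2
    rw [h1, Pi.sub_apply, h2, Pi.sub_apply]
  have hP := isStarProjection_cellProj (Ω := Ω) n j
  refine ⟨n, j, (norm_sub_apply_le_of_isStarProjection hP (y := cellProj Ω n j hgm.toLp) ?_).trans
    ((norm_sub_le_norm_sub_add_norm_sub _ hgm.toLp _).trans (by linarith))⟩
  rw [← mul_apply_eq_comp, hP.isIdempotentElem.eq]

theorem tendsto_cellProj (x : L2 Ω) {j : ℕ → ℕ} (hj : ∀ n, n ≤ j n) :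
    Tendsto (fun n => cellProj Ω n (j n) x) atTop (𝓝 x) := by
  rw [Metric.tendsto_atTop]
  intro ε hε
  obtain ⟨n, i, h⟩ := exists_norm_sub_cellProj_le x (half_pos hε)
  refine ⟨max n i, fun m hm => ?_⟩
  rw [dist_comm, dist_eq_norm]
  refine ((norm_sub_apply_le_of_isStarProjection (isStarProjection_cellProj m _)
    (y := cellProj Ω n i x) ?_).trans h).trans_lt (half_lt_self hε)
  rw [← mul_apply_eq_comp, cellProj_mul_cellProj ((le_max_left _ _).trans hm)
    (((le_max_right _ _).trans hm).trans (hj m))]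

end Density

/-- The properties of the sequence of projections in the theorem: it increases to the identity, it
consists of projections of finite rank that live on growing balls and commute with the indicator
functions of all balls, and it commutes with multiplication operators up to small Hilbert-Schmidt
errors. -/
structure IsLocalizingSequence {Ω : Set ℂ} (P : ℕ → BL2 Ω) : Prop where
  isStarProjection : ∀ n, IsStarProjection (P n)
  finiteDimensional_range : ∀ n, FiniteDimensional ℂ (P n).range
  succ_mul : ∀ n, P (n + 1) * P n = P n
  tendsto_apply : ∀ x, Tendsto (fun n => P n x) atTop (𝓝 x)
  tendsto_lipL : Tendsto (fun n => lipL (P n)) atTop (𝓝 0)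
  lipL_le_one : ∀ n, lipL (P n) ≤ 1
  chiBall_mul : ∀ n, chiBall Ω n * P n = P n
  commute_chiBall : ∀ m n, Commute (chiBall Ω m) (P n)

theorem exists_isLocalizingSequence (Ω : Set ℂ) : ∃ P : ℕ → BL2 Ω, IsLocalizingSequence P := by
  choose Q M hM hQ hfix hdom hlip hcomm using fun n j : ℕ =>
    exists_almost_commuting_above_cellProj Ω n j (ε := 1 / (n + 1)) (by positivity)
  let level : ℕ → ℕ := fun n => Nat.rec 0 (fun n l => M n l + 1) n
  have hlevel : ∀ n, n ≤ level n := fun n => by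
    induction n with
    | zero => exact Nat.zero_le _
    | succ n ih => exact Nat.succ_le_succ (ih.trans (hM n _))
  refine ⟨fun n => Q n (level n), fun n => hQ _ _, fun n => ?_, fun n => ?_, fun x => ?_, ?_,
    fun n => ?_, fun n => ?_, fun m n => hcomm _ _ _⟩
  · exact finiteDimensional_range_of_mul_eq finiteDimensional_range_transfer (hdom n (level n))
  · have h := cellProj_mul_cellProj (Ω := Ω) (i := M n (level n)) (j := level (n + 1))
      n.le_succ (Nat.le_succ _)
    rw [← hdom n (level n), ← h, mul_assoc, ← mul_assoc, hfix]
  · rw [tendsto_iff_norm_sub_tendsto_zero]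
    refine squeeze_zero (fun _ => norm_nonneg _) (fun n => ?_)
      (tendsto_iff_norm_sub_tendsto_zero.1 (tendsto_cellProj x hlevel))
    rw [norm_sub_rev, norm_sub_rev _ x]
    refine norm_sub_apply_le_of_isStarProjection (hQ _ _) ?_
    rw [← mul_apply_eq_comp, hfix]
  · refine tendsto_of_tendsto_of_tendsto_of_le_of_le tendsto_const_nhds ?_ (fun _ => zero_le)
      fun n => hlip n _
    simpa using ENNReal.tendsto_ofReal (tendsto_one_div_add_atTop_nhds_zero_nat (𝕜 := ℝ))
  · refine (hlip n _).trans (ENNReal.ofReal_le_one.2 ?_)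
    rw [div_le_one (by positivity)]
    exact le_add_of_nonneg_left n.cast_nonneg
  · rw [← hdom n (level n), ← mul_assoc, chiBall_mul_cellProj]

/-! ### Blocks near and far from the diagonal -/

section Blocks

open scoped Classical in
/-- The part of `Z` that consists of the blocks `χ_a Z χ_b` over the pairs of cells of level `j` in
the ball of radius `n` that satisfy `q a b`. -/
def blockPart {Ω : Set ℂ} (n j : ℕ) (q : ℕ × ℤ × ℤ → ℕ × ℤ × ℤ → Prop) (Z : BL2 Ω) : BL2 Ω :=
  ∑ a ∈ cellIndex n j, ∑ b ∈ cellIndex n j with q a b,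
    chi Ω (measurableSet_cell j a) * Z * chi Ω (measurableSet_cell j b)

variable {Ω : Set ℂ} {n j : ℕ} {q : ℕ × ℤ × ℤ → ℕ × ℤ × ℤ → Prop}

theorem blockPart_add (Y Z : BL2 Ω) :
    blockPart n j q (Y + Z) = blockPart n j q Y + blockPart n j q Z := by
  simp only [blockPart, mul_add, add_mul, Finset.sum_add_distrib]

theorem blockPart_sum {ι : Type*} (s : Finset ι) (Z : ι → BL2 Ω) :
    blockPart n j q (∑ i ∈ s, Z i) = ∑ i ∈ s, blockPart n j q (Z i) :=
  map_sum (AddMonoidHom.mk' (blockPart n j q) blockPart_add) Z s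

open scoped Classical in
theorem hsSq_blockPart (Z : BL2 Ω) : hsSq (blockPart n j q Z) =
    ∑ a ∈ cellIndex n j, ∑ b ∈ cellIndex n j with q a b,
      hsSq (chi Ω (measurableSet_cell j a) * Z * chi Ω (measurableSet_cell j b)) := by
  have hstar : ∀ a, star (chi Ω (measurableSet_cell j a)) = chi Ω (measurableSet_cell j a) :=
    fun a => (isStarProjection_chi _).isSelfAdjoint.star_eq
  have hdisj : ∀ a b, a ≠ b →
      chi Ω (measurableSet_cell j a) * chi Ω (measurableSet_cell j b) = 0 := fun a b hab =>
    chi_mul_chi_of_disjoint _ _ (disjoint_cell hab)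
  rw [blockPart, hsSq_sum_of_star_mul_eq_zero]
  · refine Finset.sum_congr rfl fun a _ => hsSq_sum_of_mul_star_eq_zero fun b _ c _ hbc => ?_
    simp only [star_mul, hstar]
    rw [← mul_assoc, mul_assoc _ (chi Ω (measurableSet_cell j b)), hdisj b c hbc, mul_zero,
      zero_mul]
  · intro a _ c _ hac
    simp only [mul_assoc, ← Finset.mul_sum, star_mul, hstar]
    rw [← mul_assoc (chi Ω (measurableSet_cell j a)), hdisj a c hac, zero_mul, mul_zero,
      mul_zero]

theorem sum_chi_cell (n j : ℕ) :
    ∑ a ∈ cellIndex n j, chi Ω (measurableSet_cell j a) = chiBall Ω n := by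
  rw [chiBall, ← sum_chi_cell_inter measurableSet_ball subset_rfl j]
  refine Finset.sum_congr rfl fun a ha => ?_
  congr 1
  exact (Set.inter_eq_left.2 (cell_subset_ball ha)).symm

theorem hsSq_blockPart_add_hsSq_blockPart_not (Z : BL2 Ω) :
    hsSq (blockPart n j q Z) + hsSq (blockPart n j (fun a b => ¬ q a b) Z)
      = hsSq (chiBall Ω n * Z * chiBall Ω n) := by
  classical
  have hall : blockPart n j (fun _ _ => True) Z = chiBall Ω n * Z * chiBall Ω n := by
    simp only [blockPart, Finset.filter_true, ← Finset.mul_sum, ← Finset.sum_mul, sum_chi_cell]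
  rw [← hall, hsSq_blockPart, hsSq_blockPart, hsSq_blockPart, ← Finset.sum_add_distrib]
  refine Finset.sum_congr rfl fun a _ => ?_
  rw [Finset.filter_true]
  convert Finset.sum_filter_add_sum_filter_not (cellIndex n j) (q a) _

theorem hsNorm_compression_le {H : Type*} [NormedAddCommGroup H] [InnerProductSpace ℂ H]
    [CompleteSpace H] {S T : H →L[ℂ] H} (hS : ‖S‖ ≤ 1) (hT : ‖T‖ ≤ 1) (Z : H →L[ℂ] H) :
    hsNorm (S * Z * T) ≤ hsNorm Z :=
  (hsNorm_mul_le_of_norm_le_one_right hT _).trans (hsNorm_mul_le_of_norm_le_one_left hS _)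

theorem hsNorm_blockPart_le (Z : BL2 Ω) : hsNorm (blockPart n j q Z) ≤ hsNorm Z := by
  have hχ : ‖chiBall Ω n‖ ≤ 1 := (isStarProjection_chi _).norm_le
  refine le_trans ?_ (hsNorm_compression_le hχ hχ Z)
  rw [hsNorm_le_iff_hsSq_le, hsNorm_sq, ← hsSq_blockPart_add_hsSq_blockPart_not (q := q) (j := j)]
  exact le_self_add

/-- Two cells of level `j` are near if they have points at distance less than ten times the bound
`2 / 2 ^ j` for the diameter of a cell. -/
def Near (j : ℕ) (a b : ℕ × ℤ × ℤ) : Prop :=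
  ∃ s ∈ cell j a, ∃ t ∈ cell j b, ‖s - t‖ < 10 * (2 / 2 ^ j)

theorem Near.cell_subset_closedBall {a b : ℕ × ℤ × ℤ} (h : Near j a b) {s : ℂ} (hs : s ∈ cell j a) :
    cell j b ⊆ Metric.closedBall s (24 / 2 ^ j) := by
  intro t ht
  obtain ⟨s', hs', t', ht', hst⟩ := h
  have htt' : ‖t - t'‖ ≤ 2 / 2 ^ j := norm_sub_le_of_cellLabel_eq (cellLabel_eq_of_mem ht ht')
  have hss' : ‖s' - s‖ ≤ 2 / 2 ^ j := norm_sub_le_of_cellLabel_eq (cellLabel_eq_of_mem hs' hs)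
  have hsum : (24 : ℝ) / 2 ^ j = 2 / 2 ^ j + 10 * (2 / 2 ^ j) + 2 / 2 ^ j := by ring
  have hts : t - s = (t - t') - (s' - t') + (s' - s) := by ring
  rw [Metric.mem_closedBall, dist_eq_norm, hsum, hts]
  exact (norm_add_le _ _).trans
    (add_le_add ((norm_sub_le _ _).trans (add_le_add htt' hst.le)) hss')

theorem sum_enorm_chi_cell_sq_le {s : Finset (ℕ × ℤ × ℤ)} {A : Set ℂ}
    (h : ∀ a ∈ s, cell j a ⊆ A) (x : L2 Ω) :
    ∑ a ∈ s, ‖chi Ω (measurableSet_cell j a) x‖ₑ ^ 2 ≤ ∫⁻ z in A, ‖x z‖ₑ ^ 2 ∂leb Ω := by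
  simp only [enorm_chi_apply_sq]
  rw [← lintegral_biUnion_finset (fun a _ b _ hab => disjoint_cell hab)
    fun a _ => measurableSet_cell j a]
  exact lintegral_mono_set (Set.iUnion₂_subset h)

open InnerProductSpace (rankOne) in
theorem hsSq_chi_mul_rankOne_mul_chi {A B : Set ℂ} (hA : MeasurableSet A) (hB : MeasurableSet B)
    (g h : L2 Ω) :
    hsSq (chi Ω hA * rankOne ℂ g h * chi Ω hB) = ‖chi Ω hA g‖ₑ ^ 2 * ‖chi Ω hB h‖ₑ ^ 2 := by
  rw [ContinuousLinearMap.mul_def, ContinuousLinearMap.mul_def, InnerProductSpace.comp_rankOne,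
    InnerProductSpace.rankOne_comp, ← ContinuousLinearMap.star_eq_adjoint,
    (isStarProjection_chi hB).isSelfAdjoint.star_eq, hsSq_rankOne]

open InnerProductSpace (rankOne) in
theorem hsSq_blockPart_near_rankOne_le (n j : ℕ) (g h : L2 Ω) :
    hsSq (blockPart n j (Near j) (rankOne ℂ g h)) ≤
      ‖g‖ₑ ^ 2 * ⨆ s : ℂ, ∫⁻ z in Metric.closedBall s (24 / 2 ^ j), ‖h z‖ₑ ^ 2 ∂leb Ω := by
  classical
  simp only [hsSq_blockPart, hsSq_chi_mul_rankOne_mul_chi, ← Finset.mul_sum]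
  have hrow : ∀ a, ∑ b ∈ cellIndex n j with Near j a b, ‖chi Ω (measurableSet_cell j b) h‖ₑ ^ 2 ≤
      ⨆ s : ℂ, ∫⁻ z in Metric.closedBall s (24 / 2 ^ j), ‖h z‖ₑ ^ 2 ∂leb Ω := fun a => by
    rcases (cell j a).eq_empty_or_nonempty with ha | ⟨s, hs⟩
    · rw [Finset.filter_eq_empty_iff.2 fun b _ ⟨s, hs, _⟩ => (ha ▸ hs : s ∈ (∅ : Set ℂ))]
      exact zero_le
    · exact (sum_enorm_chi_cell_sq_le
        (fun b hb => (Finset.mem_filter.1 hb).2.cell_subset_closedBall hs) h).trans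
        (le_iSup (fun s => ∫⁻ z in Metric.closedBall s (24 / 2 ^ j), ‖h z‖ₑ ^ 2 ∂leb Ω) s)
  refine (Finset.sum_le_sum fun a _ => mul_le_mul_right (hrow a) _).trans ?_
  rw [← Finset.sum_mul]
  gcongr
  simpa [← enorm_sq_eq_lintegral] using
    sum_enorm_chi_cell_sq_le (s := cellIndex n j) (fun a _ => Set.subset_univ (cell j a)) g

theorem tendsto_iSup_setLIntegral_closedBall {r : ℕ → ℝ} (hr : Tendsto r atTop (𝓝 0))
    {f : ℂ → ℝ≥0∞} (hf : ∫⁻ z, f z ∂leb Ω ≠ ∞) :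
    Tendsto (fun j => ⨆ s : ℂ, ∫⁻ z in Metric.closedBall s (r j), f z ∂leb Ω) atTop (𝓝 0) := by
  rw [ENNReal.tendsto_nhds_zero]
  intro ε hε
  obtain ⟨δ, hδ, hδε⟩ := exists_pos_setLIntegral_lt_of_measure_lt hf hε.ne'
  have hvol : Tendsto (fun j => ENNReal.ofReal (r j) ^ 2 * (NNReal.pi : ℝ≥0∞)) atTop (𝓝 0) := by
    simpa using ENNReal.Tendsto.mul_const (b := (NNReal.pi : ℝ≥0∞))
      (ENNReal.Tendsto.pow (n := 2) (ENNReal.tendsto_ofReal hr)) (Or.inr ENNReal.coe_ne_top)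
  filter_upwards [hvol.eventually_lt_const hδ] with j hj
  refine iSup_le fun s => (hδε _ (lt_of_le_of_lt ?_ hj)).le
  rw [← Complex.volume_closedBall s]
  exact Measure.restrict_apply_le _ _

open InnerProductSpace (rankOne) in
theorem tendsto_blockPart_near_rankOne (n : ℕ) (g h : L2 Ω) :
    Tendsto (fun j => hsNorm (blockPart n j (Near j) (rankOne ℂ g h))) atTop (𝓝 0) := by
  rw [tendsto_hsNorm_zero_iff]
  refine tendsto_of_tendsto_of_tendsto_of_le_of_le tendsto_const_nhds ?_ (fun _ => zero_le)
    fun j => hsSq_blockPart_near_rankOne_le n j g h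
  have hr : Tendsto (fun j : ℕ => (24 : ℝ) / 2 ^ j) atTop (𝓝 0) :=
    tendsto_const_nhds.div_atTop (tendsto_pow_atTop_atTop_of_one_lt one_lt_two)
  simpa using ENNReal.Tendsto.const_mul (a := ‖g‖ₑ ^ 2) (tendsto_iSup_setLIntegral_closedBall hr
    (f := fun z => ‖h z‖ₑ ^ 2) (by rw [← enorm_sq_eq_lintegral]; simp)) (Or.inr (by simp))

open InnerProductSpace (rankOne) in
theorem exists_hsNorm_sub_sum_rankOne_le {H : Type*} [NormedAddCommGroup H]
    [InnerProductSpace ℂ H] [CompleteSpace H] {Z : H →L[ℂ] H} (hZ : hsNorm Z < ∞) {ε : ℝ≥0∞}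
    (hε : 0 < ε) : ∃ (w : Set H) (s : Finset w) (x y : w → H),
      hsNorm (Z - ∑ i ∈ s, rankOne ℂ (x i) (y i)) ≤ ε := by
  classical
  obtain ⟨w, b, -⟩ := exists_hilbertBasis ℂ H
  rw [hsNorm_lt_top_iff, hsSq_eq_tsum b] at hZ
  obtain ⟨s, hs⟩ := ((ENNReal.tendsto_tsum_compl_atTop_zero hZ.ne).eventually_le_const
    (u := ε ^ 2) (by positivity)).exists
  refine ⟨w, s, fun i => Z (b i), b, ?_⟩
  rw [hsNorm_le_iff_hsSq_le, hsSq_eq_tsum b]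
  refine le_trans (le_of_eq ?_) hs
  have hbasis : ∀ i, (Z - ∑ k ∈ s, rankOne ℂ (Z (b k)) (b k)) (b i)
      = if i ∈ s then 0 else Z (b i) := fun i => by
    simp only [sub_apply, sum_apply, InnerProductSpace.rankOne_apply,
      orthonormal_iff_ite.1 b.orthonormal, ite_smul, one_smul, zero_smul, Finset.sum_ite_eq']
    split_ifs <;> simp
  simp only [hbasis]
  refine Eq.trans ?_ (tsum_subtype {x | x ∉ s} fun i => ‖Z (b i)‖ₑ ^ 2).symm
  refine tsum_congr fun i => ?_
  by_cases hi : i ∈ s <;> simp [hi]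

theorem tendsto_blockPart_near {Z : BL2 Ω} (hZ : hsNorm Z < ∞) (n : ℕ) :
    Tendsto (fun j => hsNorm (blockPart n j (Near j) Z)) atTop (𝓝 0) := by
  rw [ENNReal.tendsto_nhds_zero]
  intro ε hε
  have hε2 : 0 < ε / 2 := ENNReal.half_pos hε.ne'
  obtain ⟨w, s, x, y, hxy⟩ := exists_hsNorm_sub_sum_rankOne_le hZ hε2
  set Z' := ∑ i ∈ s, InnerProductSpace.rankOne ℂ (x i) (y i) with hZ'
  have hnear : Tendsto (fun j => ∑ i ∈ s, hsNorm (blockPart n j (Near j)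
      (InnerProductSpace.rankOne ℂ (x i) (y i)))) atTop (𝓝 0) := by
    simpa using tendsto_finsetSum s fun i _ => tendsto_blockPart_near_rankOne n (x i) (y i)
  filter_upwards [hnear.eventually_le_const hε2] with j hj
  calc hsNorm (blockPart n j (Near j) Z)
      = hsNorm (blockPart n j (Near j) (Z - Z') + blockPart n j (Near j) Z') := by
        rw [← blockPart_add, sub_add_cancel]
    _ ≤ ε / 2 + ε / 2 := by
        refine (hsNorm_add_le _ _).trans (add_le_add ((hsNorm_blockPart_le _).trans hxy) ?_)
        rw [hZ', blockPart_sum]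
        exact (hsNorm_sum_le _ _).trans hj
    _ = ε := ENNReal.add_halves ε

end Blocks

/-! ### Commutators with the coordinate function -/

section Comparison

variable {Ω : Set ℂ}

theorem chi_eq_zero_of_measure_eq_zero {A : Set ℂ} (hA : MeasurableSet A) (h : leb Ω A = 0) :
    chi Ω hA = 0 := by
  ext1 x
  refine Lp.ext ?_
  filter_upwards [chi_apply_ae hA x, measure_eq_zero_iff_ae_notMem.1 h,
    Lp.coeFn_zero ℂ 2 (leb Ω)] with z hχ hz hzero
  rw [hχ, Set.indicator_of_notMem hz, zero_apply, hzero, Pi.zero_apply]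

section Block

variable {A B : Set ℂ} (hA : MeasurableSet A) (hB : MeasurableSet B) {f : Lp ℂ ∞ (leb Ω)} {r : ℝ}

theorem hsNorm_block_commutator_sub_le (hr : 0 ≤ r) {c d : ℂ}
    (hc : ∀ᵐ z ∂leb Ω, z ∈ A → ‖f z - c‖ ≤ r) (hd : ∀ᵐ z ∂leb Ω, z ∈ B → ‖f z - d‖ ≤ r)
    (X : BL2 Ω) :
    hsNorm (chi Ω hA * (mulOp f * X - X * mulOp f) * chi Ω hB
      - (c - d) • (chi Ω hA * X * chi Ω hB))
      ≤ ENNReal.ofReal (2 * r) * hsNorm (chi Ω hA * X * chi Ω hB) := by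
  set Y := chi Ω hA * X * chi Ω hB with hY
  have hAA := (isStarProjection_chi (Ω := Ω) hA).isIdempotentElem.eq
  have hBB := (isStarProjection_chi (Ω := Ω) hB).isIdempotentElem.eq
  have hAY : chi Ω hA * Y = Y := by rw [hY, ← mul_assoc, ← mul_assoc, hAA]
  have hYB : Y * chi Ω hB = Y := by rw [hY, mul_assoc _ _ (chi Ω hB), hBB]
  have hleft : chi Ω hA * (mulOp f * X) * chi Ω hB = (mulOp f * chi Ω hA) * Y := by
    rw [mul_assoc (mulOp f), hAY, hY, ← mul_assoc (chi Ω hA), (commute_chi_mulOp hA f).eq]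
    simp only [mul_assoc]
  have hright : chi Ω hA * (X * mulOp f) * chi Ω hB = Y * (mulOp f * chi Ω hB) := by
    rw [← (commute_chi_mulOp hB f).eq, ← mul_assoc Y, hYB, hY]
    simp only [mul_assoc, (commute_chi_mulOp hB f).eq]
  have hsplit : chi Ω hA * (mulOp f * X - X * mulOp f) * chi Ω hB - (c - d) • Y
      = ((mulOp f - c • (1 : BL2 Ω)) * chi Ω hA) * Y
        - Y * ((mulOp f - d • (1 : BL2 Ω)) * chi Ω hB) := by
    rw [mul_sub, sub_mul, hleft, hright]
    simp only [sub_mul, mul_sub, smul_mul_assoc, mul_smul_comm, one_mul, hAY, hYB, sub_smul]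
    abel
  rw [hsplit, two_mul, ENNReal.ofReal_add hr hr, add_mul]
  exact (hsNorm_sub_le _ _).trans (add_le_add
    (hsNorm_mul_le_of_norm_le_left (norm_mulOp_sub_smul_mul_chi_le hA hr hc) _)
    (hsNorm_mul_le_of_norm_le_right (norm_mulOp_sub_smul_mul_chi_le hB hr hd) _))

theorem hsNorm_block_commutator_le (hr : 0 ≤ r) {c d : ℂ}
    (hc : ∀ᵐ z ∂leb Ω, z ∈ A → ‖f z - c‖ ≤ r) (hd : ∀ᵐ z ∂leb Ω, z ∈ B → ‖f z - d‖ ≤ r)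
    (X : BL2 Ω) :
    hsNorm (chi Ω hA * (mulOp f * X - X * mulOp f) * chi Ω hB)
      ≤ (‖c - d‖ₑ + ENNReal.ofReal (2 * r)) * hsNorm (chi Ω hA * X * chi Ω hB) := by
  rw [← add_sub_cancel ((c - d) • (chi Ω hA * X * chi Ω hB))
    (chi Ω hA * (mulOp f * X - X * mulOp f) * chi Ω hB), add_mul, ← hsNorm_smul]
  exact (hsNorm_add_le _ _).trans
    (add_le_add_right (hsNorm_block_commutator_sub_le hA hB hr hc hd X) _)

theorem enorm_sub_mul_hsNorm_block_le (hr : 0 ≤ r) {c d : ℂ}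
    (hc : ∀ᵐ z ∂leb Ω, z ∈ A → ‖f z - c‖ ≤ r) (hd : ∀ᵐ z ∂leb Ω, z ∈ B → ‖f z - d‖ ≤ r)
    (X : BL2 Ω) :
    ‖c - d‖ₑ * hsNorm (chi Ω hA * X * chi Ω hB)
      ≤ hsNorm (chi Ω hA * (mulOp f * X - X * mulOp f) * chi Ω hB)
        + ENNReal.ofReal (2 * r) * hsNorm (chi Ω hA * X * chi Ω hB) := by
  rw [← hsNorm_smul, ← sub_sub_cancel (chi Ω hA * (mulOp f * X - X * mulOp f) * chi Ω hB)
    ((c - d) • (chi Ω hA * X * chi Ω hB))]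
  exact (hsNorm_sub_le _ _).trans
    (add_le_add_right (hsNorm_block_commutator_sub_le hA hB hr hc hd X) _)

theorem exists_essLip_separating (hne : A.Nonempty) (hr : 0 ≤ r)
    (hAB : ∀ s ∈ A, ∀ t ∈ B, r ≤ ‖s - t‖) :
    ∃ f : Lp ℂ ∞ (leb Ω), f ∈ essLip Ω ∧ lipNorm f ≤ 1 ∧
      (∀ᵐ z ∂leb Ω, z ∈ A → f z = 0) ∧ ∀ᵐ z ∂leb Ω, z ∈ B → f z = r := by
  have bounded : ∀ z, ‖((min r (Metric.infDist z A) : ℝ) : ℂ)‖ ≤ r := fun z => by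
    rw [Complex.norm_real, Real.norm_of_nonneg (le_min hr Metric.infDist_nonneg)]
    exact min_le_left _ _
  have lipschitz : LipschitzWith 1 fun z => ((min r (Metric.infDist z A) : ℝ) : ℂ) := by
    simpa only [one_mul] using! Complex.isometry_ofReal.lipschitz.comp
      ((Metric.lipschitz_infDist_pt A).const_min r)
  obtain ⟨f, hf, hf1, hfF⟩ := exists_essLip_of_lipschitz (Ω := Ω) bounded lipschitz
  refine ⟨f, hf, hf1, ?_, ?_⟩ <;> filter_upwards [hfF] with z hz hmem
  · rw [hz, Metric.infDist_zero_of_mem hmem, min_eq_right hr, Complex.ofReal_zero]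
  · have hdist : r ≤ Metric.infDist z A := (Metric.le_infDist hne).2 fun {s} hs => by
      rw [dist_comm, dist_eq_norm]
      exact hAB s hs z hmem
    rw [hz, min_eq_left hdist]

theorem hsNorm_block_lt_top (hne : A.Nonempty) (hr : 0 < r)
    (hAB : ∀ s ∈ A, ∀ t ∈ B, r ≤ ‖s - t‖) {X : BL2 Ω} (hX : lipL X < ∞) :
    hsNorm (chi Ω hA * X * chi Ω hB) < ∞ := by
  obtain ⟨f, hf, hf1, hfA, hfB⟩ := exists_essLip_separating (Ω := Ω) hne hr.le hAB
  have hblock := enorm_sub_mul_hsNorm_block_le hA hB le_rfl (f := f) (c := 0) (d := r)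
    (hfA.mono fun z hz hzA => by simp [hz hzA]) (hfB.mono fun z hz hzB => by simp [hz hzB]) X
  rw [mul_zero, ENNReal.ofReal_zero, zero_mul, add_zero] at hblock
  have hfinite := ((hblock.trans (hsNorm_compression_le (isStarProjection_chi hA).norm_le
    (isStarProjection_chi hB).norm_le _)).trans (hsNorm_le_lipL X f hf hf1)).trans_lt hX
  exact ENNReal.lt_top_of_mul_ne_top_right hfinite.ne (by simpa using hr.ne')

theorem hsNorm_block_commutator_le_two_mul (hr : 0 ≤ r) {g : Lp ℂ ∞ (leb Ω)} {c d s t : ℂ}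
    (hc : ∀ᵐ z ∂leb Ω, z ∈ A → ‖f z - c‖ ≤ r) (hd : ∀ᵐ z ∂leb Ω, z ∈ B → ‖f z - d‖ ≤ r)
    (hs : ∀ᵐ z ∂leb Ω, z ∈ A → ‖g z - s‖ ≤ r) (ht : ∀ᵐ z ∂leb Ω, z ∈ B → ‖g z - t‖ ≤ r)
    (hcd : ‖c - d‖ ≤ ‖s - t‖ + 2 * r) (hst : 8 * r ≤ ‖s - t‖) {X : BL2 Ω}
    (hX : hsNorm (chi Ω hA * X * chi Ω hB) < ∞) :
    hsNorm (chi Ω hA * (mulOp f * X - X * mulOp f) * chi Ω hB)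
      ≤ 2 * hsNorm (chi Ω hA * (mulOp g * X - X * mulOp g) * chi Ω hB) := by
  have upper := hsNorm_block_commutator_le hA hB hr hc hd X
  have lower := enorm_sub_mul_hsNorm_block_le hA hB hr hs ht X
  set y := hsNorm (chi Ω hA * X * chi Ω hB)
  set U := hsNorm (chi Ω hA * (mulOp f * X - X * mulOp f) * chi Ω hB)
  set V := hsNorm (chi Ω hA * (mulOp g * X - X * mulOp g) * chi Ω hB)
  set ρ := ENNReal.ofReal (2 * r) with hρ
  have hcd' : ‖c - d‖ₑ ≤ ‖s - t‖ₑ + ρ := by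
    rw [← ofReal_norm, ← ofReal_norm, hρ, ← ENNReal.ofReal_add (norm_nonneg _) (by positivity)]
    exact ENNReal.ofReal_le_ofReal hcd
  have hst' : 4 * ρ ≤ ‖s - t‖ₑ := by
    rw [← ofReal_norm, hρ, ← ENNReal.ofReal_ofNat 4, ← ENNReal.ofReal_mul (by norm_num)]
    exact ENNReal.ofReal_le_ofReal (by linarith)
  refine (ENNReal.add_le_add_iff_right (ENNReal.mul_lt_top (ENNReal.mul_lt_top
    ENNReal.ofNat_lt_top ENNReal.ofReal_lt_top) hX : 2 * ρ * y < ∞).ne).1 ?_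
  calc U + 2 * ρ * y ≤ (‖s - t‖ₑ + ρ + ρ) * y + 2 * ρ * y := by
        gcongr
        exact upper.trans (by gcongr)
    _ = (‖s - t‖ₑ + 4 * ρ) * y := by ring
    _ ≤ (‖s - t‖ₑ + ‖s - t‖ₑ) * y := by gcongr
    _ = 2 * (‖s - t‖ₑ * y) := by ring
    _ ≤ 2 * (V + ρ * y) := by gcongr
    _ = 2 * V + 2 * ρ * y := by ring

end Block

theorem lipschitzWith_complex_mk {p q : ℝ → ℝ} (hp : LipschitzWith 1 p) (hq : LipschitzWith 1 q) :
    LipschitzWith 1 fun z : ℂ => (⟨p z.re, q z.im⟩ : ℂ) := by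
  refine LipschitzWith.mk_one fun s t => ?_
  have hre := hp.dist_le_mul s.re t.re
  have him := hq.dist_le_mul s.im t.im
  rw [NNReal.coe_one, one_mul, Real.dist_eq, Real.dist_eq] at hre him
  rw [Complex.dist_eq_re_im, Complex.dist_eq_re_im]
  exact Real.sqrt_le_sqrt (add_le_add (sq_le_sq.2 hre) (sq_le_sq.2 him))

theorem exists_essLip_eq_on_ball (Ω : Set ℂ) (n : ℕ) :
    ∃ ζ : Lp ℂ ∞ (leb Ω), ζ ∈ essLip Ω ∧ lipNorm ζ ≤ 1 ∧
      ∀ᵐ z ∂leb Ω, z ∈ Metric.ball (0 : ℂ) n → ζ z = z := by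
  have hn : (-n : ℝ) ≤ n := neg_le_self n.cast_nonneg
  let clamp : ℝ → ℝ := fun x => Set.projIcc (-n : ℝ) n hn x
  have abs_clamp_le : ∀ x, |clamp x| ≤ n := fun x => abs_le.2 (Set.projIcc (-n : ℝ) n hn x).2
  have lipschitz_clamp : LipschitzWith 1 clamp := LipschitzWith.projIcc hn
  have clamp_eq : ∀ x : ℝ, |x| < n → clamp x = x := fun x hx => by
    rw [abs_lt] at hx
    exact congrArg Subtype.val (Set.projIcc_of_mem hn ⟨hx.1.le, hx.2.le⟩)
  obtain ⟨ζ, hζ, hζ1, hζF⟩ := exists_essLip_of_lipschitz (Ω := Ω)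
    (fun z => (Complex.norm_le_abs_re_add_abs_im _).trans
      (add_le_add (abs_clamp_le z.re) (abs_clamp_le z.im)))
    (lipschitzWith_complex_mk lipschitz_clamp lipschitz_clamp)
  refine ⟨ζ, hζ, hζ1, ?_⟩
  filter_upwards [hζF] with z hz hmem
  rw [mem_ball_zero_iff] at hmem
  rw [hz, clamp_eq _ ((Complex.abs_re_le_norm z).trans_lt hmem),
    clamp_eq _ ((Complex.abs_im_le_norm z).trans_lt hmem)]

/-- A bounded function with Lipschitz constant `1` that agrees with the coordinate `z` on the ball
of radius `n`; the coordinate itself need not be bounded on `Ω`. -/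
def coordinate (Ω : Set ℂ) (n : ℕ) : Lp ℂ ∞ (leb Ω) := (exists_essLip_eq_on_ball Ω n).choose

theorem coordinate_mem_essLip (n : ℕ) : coordinate Ω n ∈ essLip Ω :=
  (exists_essLip_eq_on_ball Ω n).choose_spec.1

theorem lipNorm_coordinate_le (n : ℕ) : lipNorm (coordinate Ω n) ≤ 1 :=
  (exists_essLip_eq_on_ball Ω n).choose_spec.2.1

theorem coordinate_ae_eq (n : ℕ) :
    ∀ᵐ z ∂leb Ω, z ∈ Metric.ball (0 : ℂ) n → coordinate Ω n z = z :=
  (exists_essLip_eq_on_ball Ω n).choose_spec.2.2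

theorem exists_ae_norm_sub_le_of_diam_le_pair {f : Lp ℂ ∞ (leb Ω)} (hf : lipNorm f ≤ 1)
    {A B : Set ℂ} (hA : leb Ω A ≠ 0) (hB : leb Ω B ≠ 0) {r : ℝ}
    (hrA : ∀ s ∈ A, ∀ t ∈ A, ‖s - t‖ ≤ r) (hrB : ∀ s ∈ B, ∀ t ∈ B, ‖s - t‖ ≤ r) :
    ∃ s ∈ A, ∃ t ∈ B, ∃ c d : ℂ, (∀ᵐ z ∂leb Ω, z ∈ A → ‖f z - c‖ ≤ r) ∧
      (∀ᵐ z ∂leb Ω, z ∈ B → ‖f z - d‖ ≤ r) ∧ ‖c - d‖ ≤ ‖s - t‖ + 2 * r := by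
  obtain ⟨c, hc⟩ := exists_ae_norm_sub_le_of_diam_le hf hrA
  obtain ⟨d, hd⟩ := exists_ae_norm_sub_le_of_diam_le hf hrB
  obtain ⟨s, hsA, hs, hsc⟩ := ((frequently_ae_mem_iff.2 hA).and_eventually
    ((ae_ae_norm_sub_le_of_lipNorm_le_one hf).and hc)).exists
  obtain ⟨t, htB, ht, htd⟩ := ((frequently_ae_mem_iff.2 hB).and_eventually (hs.and hd)).exists
  refine ⟨s, hsA, t, htB, c, d, hc, hd, ?_⟩
  have hsplit : c - d = (f s - f t) - (f s - c) + (f t - d) := by ring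
  rw [hsplit, two_mul, ← add_assoc]
  exact (norm_add_le _ _).trans
    (add_le_add ((norm_sub_le _ _).trans (add_le_add ht (hsc hsA))) (htd htB))

theorem hsNorm_far_block_commutator_le {n j : ℕ} {a b : ℕ × ℤ × ℤ} (ha : a ∈ cellIndex n j)
    (hb : b ∈ cellIndex n j) (hab : ¬ Near j a b) {X : BL2 Ω} (hX : lipL X < ∞)
    {f : Lp ℂ ∞ (leb Ω)} (hf : lipNorm f ≤ 1) :
    hsNorm (chi Ω (measurableSet_cell j a) * (mulOp f * X - X * mulOp f)
      * chi Ω (measurableSet_cell j b)) ≤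
    2 * hsNorm (chi Ω (measurableSet_cell j a) *
      (mulOp (coordinate Ω n) * X - X * mulOp (coordinate Ω n))
      * chi Ω (measurableSet_cell j b)) := by
  by_cases hA : leb Ω (cell j a) = 0
  · simp [chi_eq_zero_of_measure_eq_zero _ hA, hsNorm_zero]
  by_cases hB : leb Ω (cell j b) = 0
  · simp [chi_eq_zero_of_measure_eq_zero _ hB, hsNorm_zero]
  have hr : (0 : ℝ) < 2 / 2 ^ j := by positivity
  have hdiam : ∀ c, ∀ s ∈ cell j c, ∀ t ∈ cell j c, ‖s - t‖ ≤ 2 / 2 ^ j := fun c s hs t ht =>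
    norm_sub_le_of_cellLabel_eq (cellLabel_eq_of_mem hs ht)
  have hfar : ∀ s ∈ cell j a, ∀ t ∈ cell j b, 10 * (2 / 2 ^ j) ≤ ‖s - t‖ := by
    simpa only [Near, not_exists, not_and, not_lt] using hab
  have hcoordinate : ∀ c ∈ cellIndex n j, ∀ s ∈ cell j c,
      ∀ᵐ z ∂leb Ω, z ∈ cell j c → ‖coordinate Ω n z - s‖ ≤ 2 / 2 ^ j := fun c hc s hs => by
    filter_upwards [coordinate_ae_eq n] with z hz hzc
    rw [hz (cell_subset_ball hc hzc)]
    exact hdiam c z hzc s hs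
  obtain ⟨s, hs, t, ht, c, d, hc, hd, hcd⟩ :=
    exists_ae_norm_sub_le_of_diam_le_pair hf hA hB (hdiam a) (hdiam b)
  exact hsNorm_block_commutator_le_two_mul _ _ hr.le hc hd (hcoordinate a ha s hs)
    (hcoordinate b hb t ht) hcd (by linarith [hfar s hs t ht])
    (hsNorm_block_lt_top _ _ ⟨s, hs⟩ (by positivity) hfar hX)

/-- The compression to the ball of radius `n` of the commutator of `X` with the coordinate
function. -/
def coordCommutator (n : ℕ) (X : BL2 Ω) : BL2 Ω :=
  chiBall Ω n * (mulOp (coordinate Ω n) * X - X * mulOp (coordinate Ω n)) * chiBall Ω n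

theorem hsNorm_compression_commutator_le {X : BL2 Ω} (hX : lipL X < ∞) (n : ℕ)
    {f : Lp ℂ ∞ (leb Ω)} (hf : f ∈ essLip Ω) (hf1 : lipNorm f ≤ 1) :
    hsNorm (chiBall Ω n * (mulOp f * X - X * mulOp f) * chiBall Ω n)
      ≤ 2 * hsNorm (coordCommutator n X) := by
  set Z := mulOp f * X - X * mulOp f
  set V := mulOp (coordinate Ω n) * X - X * mulOp (coordinate Ω n)
  have hZ : hsNorm Z < ∞ := (hsNorm_le_lipL X f hf hf1).trans_lt hX
  have hfar : ∀ j, hsSq (blockPart n j (fun a b => ¬ Near j a b) Z)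
      ≤ (2 * hsNorm (coordCommutator n X)) ^ 2 := fun j => by
    calc hsSq (blockPart n j (fun a b => ¬ Near j a b) Z)
        ≤ 2 ^ 2 * hsSq (blockPart n j (fun a b => ¬ Near j a b) V) := by
          rw [hsSq_blockPart, hsSq_blockPart]
          simp only [Finset.mul_sum]
          refine Finset.sum_le_sum fun a ha => Finset.sum_le_sum fun b hb => ?_
          obtain ⟨hb, hab⟩ : b ∈ cellIndex n j ∧ ¬ Near j a b := by
            simpa only [Finset.mem_filter] using hb
          rw [← hsNorm_sq, ← hsNorm_sq, ← mul_pow]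
          gcongr
          exact hsNorm_far_block_commutator_le ha hb hab hX hf1
      _ ≤ 2 ^ 2 * hsSq (coordCommutator n X) := by
          gcongr
          rw [coordCommutator, ← hsSq_blockPart_add_hsSq_blockPart_not (q := Near j) (j := j)]
          exact le_add_self
      _ = (2 * hsNorm (coordCommutator n X)) ^ 2 := by rw [mul_pow, hsNorm_sq]
  have hnear : Tendsto (fun j => hsNorm (blockPart n j (Near j) Z) ^ 2
      + (2 * hsNorm (coordCommutator n X)) ^ 2) atTop
      (𝓝 ((2 * hsNorm (coordCommutator n X)) ^ 2)) := by
    simpa using (ENNReal.Tendsto.pow (n := 2) (tendsto_blockPart_near hZ n)).add_const _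
  rw [hsNorm_le_iff_hsSq_le]
  refine ge_of_tendsto' hnear fun j => ?_
  rw [← hsSq_blockPart_add_hsSq_blockPart_not (q := Near j) (j := j), hsNorm_sq]
  exact add_le_add_right (hfar j) _

end Comparison

/-! ### Approximate units -/

section Hilbert

theorem tendsto_enorm_mul_of_isCompactOperator {E : Type*} [NormedAddCommGroup E] [NormedSpace ℂ E]
    {T : E →L[ℂ] E} (hT : IsCompactOperator T) {q : ℕ → E →L[ℂ] E} (hq : ∀ n, ‖q n‖ ≤ 1)
    (h : ∀ x, Tendsto (fun n => q n x) atTop (𝓝 0)) :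
    Tendsto (fun n => ‖q n * T‖ₑ) atTop (𝓝 0) := by
  suffices hnorm : Tendsto (fun n => ‖q n * T‖) atTop (𝓝 0) by
    simpa [ofReal_norm] using ENNReal.tendsto_ofReal hnorm
  rw [Metric.tendsto_nhds]
  intro ε hε
  obtain ⟨t, ht, hcover⟩ := Metric.totallyBounded_iff.1
    (hT.isCompact_closure_image_closedBall 1).totallyBounded (ε / 4) (by positivity)
  have hnet : ∀ᶠ n in atTop, ∀ y ∈ t, ‖q n y‖ < ε / 4 :=
    (eventually_all_finite ht).2 fun y _ =>
      (norm_zero (E := E) ▸ (h y).norm).eventually_lt_const (by positivity)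
  filter_upwards [hnet] with n hn
  rw [dist_zero_right, norm_norm]
  refine lt_of_le_of_lt (ContinuousLinearMap.opNorm_le_of_unit_norm (C := ε / 2)
    (by positivity) fun x hx => ?_) (half_lt_self hε)
  obtain ⟨y, hy, hxy⟩ := Set.mem_iUnion₂.1
    (hcover (subset_closure ⟨x, by simp [hx], rfl⟩ : T x ∈ closure (T '' Metric.closedBall 0 1)))
  rw [Metric.mem_ball, dist_eq_norm] at hxy
  have hsub : ‖q n (T x - y)‖ ≤ ‖T x - y‖ := by
    simpa using (q n).le_of_opNorm_le (hq n) (T x - y)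
  calc ‖(q n * T) x‖ = ‖q n (T x - y) + q n y‖ := by
        rw [mul_apply_eq_comp, map_sub, sub_add_cancel]
    _ ≤ ‖q n (T x - y)‖ + ‖q n y‖ := norm_add_le _ _
    _ ≤ ε / 2 := by linarith [hn y hy]

theorem tendsto_compression_apply {E : Type*} [NormedAddCommGroup E] [NormedSpace ℂ E]
    {p : ℕ → E →L[ℂ] E} (hp : ∀ m, ‖p m‖ ≤ 1) (hlim : ∀ x, Tendsto (fun m => p m x) atTop (𝓝 x))
    (Z : E →L[ℂ] E) (x : E) :
    Tendsto (fun m => (p m * Z * p m) x) atTop (𝓝 (Z x)) := by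
  have hZ : Tendsto (fun m => Z (p m x)) atTop (𝓝 (Z x)) := (Z.continuous.tendsto x).comp (hlim x)
  have hzero : Tendsto (fun m => p m (Z (p m x) - Z x)) atTop (𝓝 0) := by
    refine squeeze_zero_norm (fun m => ?_) (tendsto_iff_norm_sub_tendsto_zero.1 hZ)
    simpa only [one_mul] using (p m).le_of_opNorm_le (hp m) (Z (p m x) - Z x)
  simpa using hzero.add (hlim (Z x))

variable {H : Type*} [NormedAddCommGroup H] [InnerProductSpace ℂ H] [CompleteSpace H]

theorem norm_star_apply_sq_le (T : H →L[ℂ] H) (x : H) :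
    ‖star T x‖ ^ 2 ≤ ‖(T * star T) x‖ * ‖x‖ := by
  rw [← inner_self_eq_norm_sq (𝕜 := ℂ), ContinuousLinearMap.star_eq_adjoint,
    ContinuousLinearMap.adjoint_inner_left, mul_comm, mul_apply_eq_comp]
  exact re_inner_le_norm _ _

/- A finite net for the image of the unit ball under the compact operator `T T*` yields one for the
image under `T*`. -/
theorem isCompactOperator_star {T : H →L[ℂ] H} (hT : IsCompactOperator T) :
    IsCompactOperator (star T : H →L[ℂ] H) := by
  have hTT : IsCompactOperator (T * star T : H →L[ℂ] H) := hT.comp_clm (star T)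
  refine (isCompactOperator_iff_isCompact_closure_image_closedBall
    ((star T : H →L[ℂ] H) : H →ₗ[ℂ] H) one_pos).2 ?_
  refine (TotallyBounded.closure (Metric.totallyBounded_iff.2 fun ε hε => ?_)
    ).isCompact_of_isClosed isClosed_closure
  obtain ⟨t, ht, hfin, hcover⟩ := Metric.finite_approx_of_totallyBounded
    ((hTT.isCompact_closure_image_closedBall 1).totallyBounded.subset subset_closure)
    (ε ^ 2 / 4) (by positivity)
  have hpreimage : ∀ y ∈ t, ∃ x ∈ Metric.closedBall (0 : H) 1, (T * star T) x = y :=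
    fun y hy => ht hy
  choose! u hu hTu using hpreimage
  refine ⟨(fun y => star T (u y)) '' t, hfin.image _, ?_⟩
  rintro _ ⟨x, hx, rfl⟩
  obtain ⟨y, hy, hxy⟩ := Set.mem_iUnion₂.1 (hcover (Set.mem_image_of_mem _ hx))
  refine Set.mem_iUnion₂.2 ⟨_, Set.mem_image_of_mem _ hy, ?_⟩
  rw [Metric.mem_ball, dist_eq_norm] at hxy
  have hdist : ‖x - u y‖ ≤ 2 := by
    have hx1 := mem_closedBall_zero_iff.1 hx
    have hu1 := mem_closedBall_zero_iff.1 (hu y hy)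
    linarith [norm_sub_le x (u y)]
  have hsq : ‖star T (x - u y)‖ ^ 2 < ε ^ 2 := by
    calc ‖star T (x - u y)‖ ^ 2 ≤ ‖(T * star T) (x - u y)‖ * ‖x - u y‖ :=
          norm_star_apply_sq_le T _
      _ ≤ ε ^ 2 / 4 * 2 := by
          rw [map_sub, hTu y hy]
          gcongr
          exact hxy.le
      _ < ε ^ 2 := by nlinarith [pow_pos hε 2]
  rw [Metric.mem_ball, dist_eq_norm]
  simpa only [ContinuousLinearMap.coe_coe, map_sub] using lt_of_pow_lt_pow_left₀ 2 hε.le hsq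

theorem hsSq_mul_add_hsSq_one_sub_mul {p : H →L[ℂ] H} (hp : IsStarProjection p) (Z : H →L[ℂ] H) :
    hsSq (p * Z) + hsSq ((1 - p) * Z) = hsSq Z := by
  rw [← hsSq_add_of_star_mul_eq_zero, ← add_mul, add_sub_cancel, one_mul]
  rw [star_mul, hp.isSelfAdjoint.star_eq, mul_assoc, ← mul_assoc p, mul_sub, mul_one,
    hp.isIdempotentElem.eq, sub_self, zero_mul, mul_zero]

theorem hsSq_mul_add_hsSq_mul_one_sub {p : H →L[ℂ] H} (hp : IsStarProjection p) (Z : H →L[ℂ] H) :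
    hsSq (Z * p) + hsSq (Z * (1 - p)) = hsSq Z := by
  rw [← hsSq_star Z, ← hsSq_mul_add_hsSq_one_sub_mul hp (star Z), ← hsSq_star (Z * p),
    ← hsSq_star (Z * (1 - p)), star_mul, star_mul, hp.isSelfAdjoint.star_eq,
    hp.one_sub.isSelfAdjoint.star_eq]

theorem hsSq_compression_add {p : H →L[ℂ] H} (hp : IsStarProjection p) (Z : H →L[ℂ] H) :
    hsSq (p * Z * p) + hsSq (Z - p * Z * p) = hsSq Z := by
  have hpp := hp.isIdempotentElem.eq
  have hleft : p * (Z - p * Z * p) = p * Z * (1 - p) := by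
    rw [mul_sub, mul_sub, mul_one, ← mul_assoc, ← mul_assoc, hpp]
  have hright : (1 - p) * (Z - p * Z * p) = (1 - p) * Z := by
    rw [mul_sub, ← mul_assoc, ← mul_assoc, sub_mul 1 p p, one_mul, hpp, sub_self, zero_mul,
      zero_mul, sub_zero]
  rw [← hsSq_mul_add_hsSq_one_sub_mul hp (Z - p * Z * p), hleft, hright, ← add_assoc,
    hsSq_mul_add_hsSq_mul_one_sub hp, hsSq_mul_add_hsSq_one_sub_mul hp]

theorem hsNorm_le_of_tendsto_apply {Y : ℕ → H →L[ℂ] H} {Z : H →L[ℂ] H} {c : ℝ≥0∞}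
    (hY : ∀ x, Tendsto (fun m => Y m x) atTop (𝓝 (Z x)))
    (h : ∀ᶠ m in atTop, hsNorm (Y m) ≤ c) : hsNorm Z ≤ c := by
  rw [hsNorm_le_iff]
  intro s hs
  have hsum : Tendsto (fun m => (∑ x ∈ s, ‖Y m x‖ₑ ^ (2 : ℝ)) ^ (1 / 2 : ℝ)) atTop
      (𝓝 ((∑ x ∈ s, ‖Z x‖ₑ ^ (2 : ℝ)) ^ (1 / 2 : ℝ))) :=
    (tendsto_finsetSum s fun x _ => (hY x).enorm.ennrpow_const 2).ennrpow_const _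
  exact le_of_tendsto hsum (h.mono fun m hm => (hsNorm_le_iff _ _).1 hm s hs)

theorem exists_hsNorm_sub_le_of_compression_eq {p Z : ℕ → H →L[ℂ] H}
    (hp : ∀ m, IsStarProjection (p m)) (hZ : ∀ m m', m ≤ m' → p m * Z m' * p m = Z m) {C : ℝ≥0∞}
    (hC : C < ∞) (hbound : ∀ m, hsNorm (Z m) ≤ C) {η : ℝ≥0∞} (hη : 0 < η) :
    ∃ m₀, ∀ m, m₀ ≤ m → hsNorm (Z m - Z m₀) ≤ η := by
  have hsup : (⨆ m, hsSq (Z m)) < ∞ := by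
    refine lt_of_le_of_lt (iSup_le fun m => ?_) (ENNReal.pow_lt_top hC (n := 2))
    rw [← hsNorm_sq]
    gcongr
    exact hbound m
  obtain ⟨m₀, hm₀⟩ : ∃ m₀, ⨆ m, hsSq (Z m) < hsSq (Z m₀) + η ^ 2 := by
    have hlt := ENNReal.lt_add_right hsup.ne (pow_ne_zero 2 hη.ne')
    conv_rhs at hlt => rw [ENNReal.iSup_add]
    exact lt_iSup_iff.1 hlt
  refine ⟨m₀, fun m hm => ?_⟩
  have hfinite : hsSq (Z m₀) ≠ ∞ := ((le_iSup (fun m => hsSq (Z m)) m₀).trans_lt hsup).ne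
  rw [hsNorm_le_iff_hsSq_le, ← ENNReal.add_le_add_iff_left hfinite]
  calc hsSq (Z m₀) + hsSq (Z m - Z m₀) = hsSq (Z m) := by
        rw [← hZ m₀ m hm, hsSq_compression_add (hp m₀)]
    _ ≤ ⨆ m, hsSq (Z m) := le_iSup (fun m => hsSq (Z m)) m
    _ ≤ hsSq (Z m₀) + η ^ 2 := hm₀.le

end Hilbert

section Approximation

variable {Ω : Set ℂ}

theorem mulOp_mul_chi_congr {A : Set ℂ} (hA : MeasurableSet A) {f g : Lp ℂ ∞ (leb Ω)}
    (h : ∀ᵐ z ∂leb Ω, z ∈ A → f z = g z) : mulOp f * chi Ω hA = mulOp g * chi Ω hA := by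
  ext1 x
  refine Lp.ext ?_
  rw [mul_apply_eq_comp, mul_apply_eq_comp]
  filter_upwards [mulOp_apply_ae f (chi Ω hA x), mulOp_apply_ae g (chi Ω hA x),
    chi_apply_ae hA x, h] with z hf hg hχ hfg
  rw [hf, hg, hχ]
  by_cases hz : z ∈ A
  · rw [hfg hz]
  · rw [Set.indicator_of_notMem hz, mul_zero, mul_zero]

theorem mulOp_coordinate_mul_chiBall {m m' : ℕ} (h : m ≤ m') :
    mulOp (coordinate Ω m') * chiBall Ω m = mulOp (coordinate Ω m) * chiBall Ω m := by
  refine mulOp_mul_chi_congr _ ?_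
  filter_upwards [coordinate_ae_eq m, coordinate_ae_eq m'] with z hz hz' hmem
  rw [hz hmem, hz' (Metric.ball_subset_ball (by exact_mod_cast h) hmem)]

theorem compression_coordCommutator {m m' : ℕ} (h : m ≤ m') (X : BL2 Ω) :
    chiBall Ω m * coordCommutator m' X * chiBall Ω m = coordCommutator m X := by
  have hball : Metric.ball (0 : ℂ) m ⊆ Metric.ball 0 m' :=
    Metric.ball_subset_ball (by exact_mod_cast h)
  have hcoordinate := mulOp_coordinate_mul_chiBall (Ω := Ω) h
  have hcoordinate' : chiBall Ω m * mulOp (coordinate Ω m')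
      = chiBall Ω m * mulOp (coordinate Ω m) := by
    rwa [(commute_chi_mulOp _ _).eq, (commute_chi_mulOp _ _).eq]
  calc chiBall Ω m * coordCommutator m' X * chiBall Ω m
      = (chiBall Ω m * chiBall Ω m') * (mulOp (coordinate Ω m') * X - X * mulOp (coordinate Ω m'))
          * (chiBall Ω m' * chiBall Ω m) := by simp only [coordCommutator, mul_assoc]
    _ = (chiBall Ω m * mulOp (coordinate Ω m')) * X * chiBall Ω m
          - chiBall Ω m * X * (mulOp (coordinate Ω m') * chiBall Ω m) := by
        rw [chi_mul_chi_of_subset_left _ _ hball, chi_mul_chi_of_subset_right _ _ hball]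
        simp only [mul_sub, sub_mul, mul_assoc]
    _ = coordCommutator m X := by
        rw [hcoordinate, hcoordinate', coordCommutator]
        simp only [mul_sub, sub_mul, mul_assoc]

theorem hsNorm_coordCommutator_le (m : ℕ) (X : BL2 Ω) : hsNorm (coordCommutator m X) ≤ lipL X :=
  (hsNorm_compression_le (isStarProjection_chi _).norm_le (isStarProjection_chi _).norm_le _).trans
    (hsNorm_le_lipL X _ (coordinate_mem_essLip m) (lipNorm_coordinate_le m))

theorem lipL_le_of_eventually_hsNorm_coordCommutator_le {X : BL2 Ω} (hX : lipL X < ∞) {c : ℝ≥0∞}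
    (h : ∀ᶠ m in atTop, hsNorm (coordCommutator m X) ≤ c) : lipL X ≤ 2 * c := by
  refine iSup₂_le fun f hf => hsNorm_le_of_tendsto_apply (tendsto_compression_apply
    (fun m => (isStarProjection_chi _).norm_le) tendsto_chiBall _) ?_
  filter_upwards [h] with m hm
  refine (hsNorm_compression_commutator_le hX m hf.1 hf.2).trans ?_
  gcongr

theorem hsNorm_coordCommutator_mul_sub_le {m : ℕ} {p : BL2 Ω} (hp : Commute (chiBall Ω m) p)
    (T : BL2 Ω) :
    hsNorm (coordCommutator m (p * T - T))
      ≤ lipL p * ‖T‖ₑ + hsNorm ((p - 1) * coordCommutator m T) := by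
  set ζ := coordinate Ω m with hζ
  have hcomm : chiBall Ω m * (p - 1) = (p - 1) * chiBall Ω m :=
    (hp.sub_right (Commute.one_right _)).eq
  have leibniz : mulOp ζ * (p * T - T) - (p * T - T) * mulOp ζ
      = (mulOp ζ * p - p * mulOp ζ) * T + (p - 1) * (mulOp ζ * T - T * mulOp ζ) := by
    noncomm_ring
  have hsplit : coordCommutator m (p * T - T)
      = chiBall Ω m * ((mulOp ζ * p - p * mulOp ζ) * T) * chiBall Ω m
        + (p - 1) * coordCommutator m T := by
    rw [coordCommutator, coordCommutator, ← hζ, leibniz, mul_add, add_mul, ← mul_assoc _ (p - 1),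
      hcomm]
    simp only [mul_assoc]
  rw [hsplit]
  refine (hsNorm_add_le _ _).trans (add_le_add ((hsNorm_compression_le
    (isStarProjection_chi _).norm_le (isStarProjection_chi _).norm_le _).trans
    ((hsNorm_mul_le' _ _).trans ?_)) le_rfl)
  gcongr
  exact hsNorm_le_lipL _ _ (coordinate_mem_essLip m) (lipNorm_coordinate_le m)

theorem lipL_mul_sub_lt_top {p T : BL2 Ω} (hp : lipL p < ∞) (hT : lipL T < ∞) :
    lipL (p * T - T) < ∞ :=
  (EAlg Ω).sub_mem ((EAlg Ω).mul_mem hp hT) hT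

theorem IsLocalizingSequence.tendsto_lipL_mul_sub {P : ℕ → BL2 Ω} (hP : IsLocalizingSequence P)
    {T : BL2 Ω} (hT : lipL T < ∞) : Tendsto (fun n => lipL (P n * T - T)) atTop (𝓝 0) := by
  have norm_sub_one_le : ∀ n, ‖P n - 1‖ ≤ 1 := fun n => by
    rw [norm_sub_rev]
    exact (hP.isStarProjection n).one_sub.norm_le
  have tendsto_sub_one : ∀ x, Tendsto (fun n => (P n - 1) x) atTop (𝓝 0) := fun x => by
    simpa using (hP.tendsto_apply x).sub_const x
  rw [ENNReal.tendsto_nhds_zero]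
  intro ε hε
  set η := ε / 6
  have hη : 0 < η := ENNReal.div_pos hε.ne' (by norm_num)
  obtain ⟨m₀, hm₀⟩ := exists_hsNorm_sub_le_of_compression_eq (p := chiBall Ω)
    (Z := fun m => coordCommutator m T) (fun m => isStarProjection_chi _)
    (fun m m' h => compression_coordCommutator h T) hT (fun m => hsNorm_coordCommutator_le m T) hη
  have hL : Tendsto (fun n => lipL (P n) * ‖T‖ₑ) atTop (𝓝 0) := by
    simpa using ENNReal.Tendsto.mul_const (b := ‖T‖ₑ) hP.tendsto_lipL (Or.inr enorm_ne_top)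
  have hZ := tendsto_hsNorm_mul_of_strong ((hsNorm_coordCommutator_le m₀ T).trans_lt hT)
    norm_sub_one_le tendsto_sub_one
  filter_upwards [hL.eventually_le_const hη, hZ.eventually_le_const hη] with n hLn hZn
  have hcoord : ∀ m, m₀ ≤ m → hsNorm (coordCommutator m (P n * T - T)) ≤ η + (η + η) :=
    fun m hm => by
    refine (hsNorm_coordCommutator_mul_sub_le (hP.commute_chiBall m n) T).trans
      (add_le_add hLn ?_)
    rw [← add_sub_cancel (coordCommutator m₀ T) (coordCommutator m T), mul_add]
    exact (hsNorm_add_le _ _).trans (add_le_add hZn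
      ((hsNorm_mul_le_of_norm_le_one_left (norm_sub_one_le n) _).trans (hm₀ m hm)))
  calc lipL (P n * T - T) ≤ 2 * (η + (η + η)) :=
        lipL_le_of_eventually_hsNorm_coordCommutator_le
          (lipL_mul_sub_lt_top ((hP.lipL_le_one n).trans_lt ENNReal.one_lt_top) hT)
          (eventually_atTop.2 ⟨m₀, hcoord⟩)
    _ = 6 * η := by ring
    _ = ε := ENNReal.mul_div_cancel (by norm_num) (by norm_num)

end Approximation

section Inclusion

variable {Ω A : Set ℂ}

theorem chi_eq_one_of_subset (hΩ : MeasurableSet Ω) (hA : MeasurableSet A) (h : Ω ⊆ A) :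
    chi Ω hA = 1 := by
  ext1 x
  refine Lp.ext ?_
  filter_upwards [chi_apply_ae hA x, ae_restrict_mem hΩ] with z hχ hz
  rw [hχ, Set.indicator_of_mem (h hz), one_apply_eq_self]

theorem extendL2_restrictL2 (hΩ : MeasurableSet Ω) (hA : MeasurableSet A) (x : L2 Ω) :
    extendL2 (Set.inter_subset_left : Ω ∩ A ⊆ Ω) (restrictL2 Set.inter_subset_left x)
      = chi Ω hA x := by
  have hrestrict := restrictL2_apply_ae (Set.inter_subset_left : Ω ∩ A ⊆ Ω) x
  have hmeasure : (leb Ω).restrict (Ω ∩ A) = leb (Ω ∩ A) :=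
    Measure.restrict_restrict_of_subset Set.inter_subset_left
  have hrestrict' : ∀ᵐ z ∂(leb Ω).restrict (Ω ∩ A),
      restrictL2 (Set.inter_subset_left : Ω ∩ A ⊆ Ω) x z = x z := hmeasure.symm ▸ hrestrict
  refine Lp.ext ?_
  filter_upwards [extendL2_apply_ae (Set.inter_subset_left : Ω ∩ A ⊆ Ω) (hΩ.inter hA)
    (restrictL2 Set.inter_subset_left x), chi_apply_ae hA x, ae_imp_of_ae_restrict hrestrict',
    ae_restrict_mem hΩ] with z hextend hχ hz hzΩ
  rw [hextend, hχ]
  by_cases hzA : z ∈ A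
  · rw [Set.indicator_of_mem (show z ∈ Ω ∩ A from ⟨hzΩ, hzA⟩), Set.indicator_of_mem hzA,
      hz ⟨hzΩ, hzA⟩]
  · rw [Set.indicator_of_notMem fun h => hzA h.2, Set.indicator_of_notMem hzA]

theorem inclOp_restriction (hΩ : MeasurableSet Ω) (hA : MeasurableSet A) (T : BL2 Ω) :
    inclOp (Set.inter_subset_left : Ω ∩ A ⊆ Ω)
        (restrictL2 Set.inter_subset_left ∘L T ∘L extendL2 Set.inter_subset_left)
      = chi Ω hA * T * chi Ω hA := by
  ext1 x
  simp only [inclOp, ContinuousLinearMap.comp_apply, mul_apply_eq_comp, extendL2_restrictL2 hΩ hA]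

theorem exists_inclOp_eq (hΩ : MeasurableSet Ω) {T : BL2 Ω} {n : ℕ}
    (hT : FiniteDimensional ℂ T.range) (hleft : chiBall Ω n * T = T)
    (hright : T * chiBall Ω n = T) :
    ∃ S ∈ EAlg (Ω ∩ Metric.ball (0 : ℂ) n), T = inclOp Set.inter_subset_left S := by
  refine ⟨restrictL2 Set.inter_subset_left ∘L T ∘L extendL2 Set.inter_subset_left, ?_, ?_⟩
  · have hone : chiBall (Ω ∩ Metric.ball (0 : ℂ) n) n = 1 :=
      chi_eq_one_of_subset (hΩ.inter measurableSet_ball) _ Set.inter_subset_right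
    exact lipL_lt_top_of_hsNorm_lt_top (n := n)
      (hsNorm_lt_top_of_finiteDimensional_range (finiteDimensional_range_comp hT _ _))
      (by rw [hone, one_mul]) (by rw [hone, mul_one])
  · rw [inclOp_restriction hΩ measurableSet_ball, hleft, hright]

end Inclusion

section TriNorm

variable {Ω : Set ℂ}

theorem lipL_neg (T : BL2 Ω) : lipL (-T) = lipL T := by
  have commutator_neg : ∀ f : Lp ℂ ∞ (leb Ω),
      mulOp f * -T - -T * mulOp f = -(mulOp f * T - T * mulOp f) := fun f => by noncomm_ring
  simp only [lipL, commutator_neg, hsNorm_neg]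

theorem lipL_star (T : BL2 Ω) : lipL (star T) = lipL T :=
  le_antisymm (lipL_star_le T) (by simpa using lipL_star_le (star T))

theorem triNorm_add_le (S T : EAlg Ω) : triNorm (S + T) ≤ triNorm S + triNorm T :=
  calc triNorm (S + T) ≤ (‖(S : BL2 Ω)‖ₑ + ‖(T : BL2 Ω)‖ₑ)
        + (lipL (S : BL2 Ω) + lipL (T : BL2 Ω)) :=
        add_le_add (enorm_add_le (S : BL2 Ω) (T : BL2 Ω)) (lipL_add_le _ _)
    _ = triNorm S + triNorm T := add_add_add_comm _ _ _ _

theorem triNorm_neg (T : EAlg Ω) : triNorm (-T) = triNorm T :=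
  congrArg₂ (· + ·) (enorm_neg (T : BL2 Ω)) (lipL_neg (T : BL2 Ω))

theorem triNorm_star (T : EAlg Ω) : triNorm (star T) = triNorm T :=
  congrArg₂ (· + ·) (enorm_star_op (T : BL2 Ω)) (lipL_star (T : BL2 Ω))

theorem triNorm_mul_le (S T : EAlg Ω) : triNorm (S * T) ≤ triNorm S * triNorm T := by
  have enorm_mul_le : ‖(S : BL2 Ω) * T‖ₑ ≤ ‖(S : BL2 Ω)‖ₑ * ‖(T : BL2 Ω)‖ₑ := by
    simp only [enorm_eq_nnnorm]
    exact_mod_cast nnnorm_mul_le (S : BL2 Ω) (T : BL2 Ω)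
  calc triNorm (S * T) ≤ ‖(S : BL2 Ω)‖ₑ * ‖(T : BL2 Ω)‖ₑ
        + (lipL (S : BL2 Ω) * ‖(T : BL2 Ω)‖ₑ + ‖(S : BL2 Ω)‖ₑ * lipL (T : BL2 Ω)) :=
        add_le_add enorm_mul_le (lipL_mul_le _ _)
    _ ≤ ‖(S : BL2 Ω)‖ₑ * ‖(T : BL2 Ω)‖ₑ
        + (lipL (S : BL2 Ω) * ‖(T : BL2 Ω)‖ₑ + ‖(S : BL2 Ω)‖ₑ * lipL (T : BL2 Ω))
        + lipL (S : BL2 Ω) * lipL (T : BL2 Ω) := le_self_add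
    _ = triNorm S * triNorm T := by rw [triNorm, triNorm]; ring

end TriNorm

section CornerUnion

variable {Ω : Set ℂ}

/-- The operators of `EΛ(Ω)` that are fixed by `P n` on both sides for all large `n`. When `P` is an
increasing sequence of projections this is the union of the corners `P n B(L²(Ω)) P n`; asking for
all large `n` makes it a subalgebra for every sequence. -/
def cornerUnion (P : ℕ → BL2 Ω) : NonUnitalSubalgebra ℂ (EAlg Ω) where
  carrier := {T | ∀ᶠ n in atTop, P n * (T : BL2 Ω) = T ∧ (T : BL2 Ω) * P n = T}
  zero_mem' := Eventually.of_forall fun _ => ⟨mul_zero _, zero_mul _⟩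
  add_mem' {S T} hS hT := by
    filter_upwards [hS, hT] with n hSn hTn
    exact ⟨(mul_add _ (S : BL2 Ω) T).trans (congrArg₂ _ hSn.1 hTn.1),
      (add_mul (S : BL2 Ω) T _).trans (congrArg₂ _ hSn.2 hTn.2)⟩
  mul_mem' {S T} hS hT := by
    filter_upwards [hS, hT] with n hSn hTn
    exact ⟨(mul_assoc _ (S : BL2 Ω) T).symm.trans (congrArg (· * (T : BL2 Ω)) hSn.1),
      (mul_assoc (S : BL2 Ω) T _).trans (congrArg ((S : BL2 Ω) * ·) hTn.2)⟩
  smul_mem' c T hT := by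
    filter_upwards [hT] with n hTn
    exact ⟨(mul_smul_comm c _ (T : BL2 Ω)).trans (congrArg (c • ·) hTn.1),
      (smul_mul_assoc c (T : BL2 Ω) _).trans (congrArg (c • ·) hTn.2)⟩

end CornerUnion

namespace IsLocalizingSequence

variable {Ω : Set ℂ} {P : ℕ → BL2 Ω}

protected theorem monotone (hP : IsLocalizingSequence P) : Monotone P :=
  monotone_nat_of_le_succ fun n =>
    (hP.isStarProjection n).le_of_mul_eq_right (hP.isStarProjection (n + 1)) (hP.succ_mul n)

theorem mul_of_le (hP : IsLocalizingSequence P) {n m : ℕ} (h : n ≤ m) : P m * P n = P n :=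
  ((hP.isStarProjection n).le_iff_mul_eq_right (hP.isStarProjection m)).1 (hP.monotone h)

theorem mul_of_ge (hP : IsLocalizingSequence P) {n m : ℕ} (h : n ≤ m) : P n * P m = P n :=
  ((hP.isStarProjection n).le_iff_mul_eq_left (hP.isStarProjection m)).1 (hP.monotone h)

theorem mul_chiBall (hP : IsLocalizingSequence P) (n : ℕ) : P n * chiBall Ω n = P n :=
  (hP.commute_chiBall n n).eq.symm.trans (hP.chiBall_mul n)

theorem exists_inclOp_eq (hP : IsLocalizingSequence P) (hΩ : MeasurableSet Ω) (n : ℕ) :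
    ∃ T ∈ EAlg (Ω ∩ Metric.ball (0 : ℂ) n), P n = inclOp Set.inter_subset_left T :=
  LipAlg.exists_inclOp_eq hΩ (hP.finiteDimensional_range n) (hP.chiBall_mul n) (hP.mul_chiBall n)

theorem finiteDimensional_range_corner (hP : IsLocalizingSequence P) (n : ℕ) (S : BL2 Ω) :
    FiniteDimensional ℂ (P n * S * P n).range :=
  finiteDimensional_range_comp (hP.finiteDimensional_range n) 1 (S * P n)

theorem lipL_corner_lt_top (hP : IsLocalizingSequence P) (n : ℕ) (S : BL2 Ω) :
    lipL (P n * S * P n) < ∞ :=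
  lipL_lt_top_of_hsNorm_lt_top (n := n)
    (hsNorm_lt_top_of_finiteDimensional_range (hP.finiteDimensional_range_corner n S))
    (by rw [← mul_assoc, ← mul_assoc, hP.chiBall_mul]) (by rw [mul_assoc, hP.mul_chiBall])

theorem isCompactOperator (hP : IsLocalizingSequence P) (n : ℕ) : IsCompactOperator (P n) :=
  isCompactOperator_of_finiteDimensional_range (hP.finiteDimensional_range n)

/-- A localizing sequence as a sequence of elements of `EΛ(Ω)`; it is an approximate unit of
`KΛ(Ω)`. -/
def approxUnit (hP : IsLocalizingSequence P) (n : ℕ) : EAlg Ω :=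
  ⟨P n, (hP.lipL_le_one n).trans_lt ENNReal.one_lt_top⟩

theorem approxUnit_mem_KIdeal (hP : IsLocalizingSequence P) (n : ℕ) :
    hP.approxUnit n ∈ KIdeal Ω :=
  (mem_KIdeal _).2 (hP.isCompactOperator n)

theorem triNorm_approxUnit_le (hP : IsLocalizingSequence P) (n : ℕ) :
    triNorm (hP.approxUnit n) ≤ 2 := by
  have hnorm : ‖P n‖ₑ ≤ 1 := by
    rw [← ofReal_norm]
    exact ENNReal.ofReal_le_one.2 (hP.isStarProjection n).norm_le
  calc triNorm (hP.approxUnit n) ≤ 1 + 1 := add_le_add hnorm (hP.lipL_le_one n)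
    _ = 2 := one_add_one_eq_two

theorem tendsto_triNorm_mul_sub (hP : IsLocalizingSequence P) {T : EAlg Ω} (hT : T ∈ KIdeal Ω) :
    Tendsto (fun n => triNorm (hP.approxUnit n * T - T)) atTop (𝓝 0) := by
  have hnorm : Tendsto (fun n => ‖(P n - 1) * (T : BL2 Ω)‖ₑ) atTop (𝓝 0) :=
    tendsto_enorm_mul_of_isCompactOperator ((mem_KIdeal _).1 hT)
      (fun n => norm_sub_rev (P n) 1 ▸ (hP.isStarProjection n).one_sub.norm_le)
      fun x => by simpa using (hP.tendsto_apply x).sub_const x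
  simp only [sub_mul, one_mul] at hnorm
  exact add_zero (0 : ℝ≥0∞) ▸ hnorm.add (hP.tendsto_lipL_mul_sub T.2)

theorem tendsto_triNorm_sub_mul (hP : IsLocalizingSequence P) {T : EAlg Ω} (hT : T ∈ KIdeal Ω) :
    Tendsto (fun n => triNorm (T * hP.approxUnit n - T)) atTop (𝓝 0) := by
  have hstar : star T ∈ KIdeal Ω :=
    (mem_KIdeal _).2 (isCompactOperator_star ((mem_KIdeal _).1 hT))
  refine (hP.tendsto_triNorm_mul_sub hstar).congr fun n => ?_
  have hunit : star (hP.approxUnit n) = hP.approxUnit n :=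
    Subtype.ext (hP.isStarProjection n).isSelfAdjoint.star_eq
  rw [← triNorm_star, star_sub, star_mul, star_star, hunit]

theorem corner_mem_cornerUnion (hP : IsLocalizingSequence P) (n : ℕ) (S : BL2 Ω) :
    (⟨P n * S * P n, hP.lipL_corner_lt_top n S⟩ : EAlg Ω) ∈ cornerUnion P := by
  refine (eventually_ge_atTop n).mono fun m hm => ⟨?_, ?_⟩
  · change P m * (P n * S * P n) = P n * S * P n
    rw [← mul_assoc, ← mul_assoc, hP.mul_of_le hm]
  · change P n * S * P n * P m = P n * S * P n
    rw [mul_assoc, hP.mul_of_ge hm]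

theorem image_cornerUnion (hP : IsLocalizingSequence P) :
    (fun T : EAlg Ω => (T : BL2 Ω)) '' (cornerUnion P : Set (EAlg Ω))
      = ⋃ n, Set.range fun S => P n * S * P n := by
  ext S
  simp only [Set.mem_image, Set.mem_iUnion, Set.mem_range, SetLike.mem_coe]
  constructor
  · rintro ⟨T, hT, rfl⟩
    obtain ⟨n, hleft, hright⟩ := Eventually.exists hT
    exact ⟨n, T, by rw [hleft, hright]⟩
  · rintro ⟨n, S, rfl⟩
    exact ⟨_, hP.corner_mem_cornerUnion n S, rfl⟩

theorem mem_KIdeal_of_mem_cornerUnion (hP : IsLocalizingSequence P) {T : EAlg Ω}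
    (hT : T ∈ cornerUnion P) : T ∈ KIdeal Ω := by
  obtain ⟨n, hleft, -⟩ := Eventually.exists hT
  rw [mem_KIdeal, ← hleft]
  exact (hP.isCompactOperator n).comp_clm (T : BL2 Ω)

theorem exists_mem_cornerUnion_triNorm_sub_lt (hP : IsLocalizingSequence P) {T : EAlg Ω}
    (hT : T ∈ KIdeal Ω) {ε : ℝ≥0∞} (hε : 0 < ε) : ∃ S ∈ cornerUnion P, triNorm (T - S) < ε := by
  set Q := hP.approxUnit
  have hlim : Tendsto (fun n => triNorm (Q n * T - T) + 2 * triNorm (T * Q n - T)) atTop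
      (𝓝 0) := by
    simpa using (hP.tendsto_triNorm_mul_sub hT).add
      (ENNReal.Tendsto.const_mul (hP.tendsto_triNorm_sub_mul hT) (Or.inr ENNReal.ofNat_ne_top))
  obtain ⟨n, hn⟩ := (hlim.eventually_lt_const hε).exists
  refine ⟨Q n * T * Q n, hP.corner_mem_cornerUnion n T, lt_of_le_of_lt ?_ hn⟩
  calc triNorm (T - Q n * T * Q n) = triNorm ((Q n * T - T) + Q n * (T * Q n - T)) := by
        rw [← triNorm_neg]
        congr 1
        noncomm_ring
    _ ≤ triNorm (Q n * T - T) + triNorm (Q n) * triNorm (T * Q n - T) :=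
        (triNorm_add_le _ _).trans (add_le_add le_rfl (triNorm_mul_le _ _))
    _ ≤ triNorm (Q n * T - T) + 2 * triNorm (T * Q n - T) := by
        gcongr
        exact hP.triNorm_approxUnit_le n

end IsLocalizingSequence

end LipAlg

end

theorem mainTheorem8 (Ω : Set ℂ) (hΩ : MeasurableSet Ω) :
    ∃ P : ℕ → LipAlg.EAlg Ω,
      -- finite rank self-adjoint projections in `KΛ(Ω)`
      (∀ n, P n ∈ LipAlg.KIdeal Ω) ∧
      (∀ n, IsStarProjection (P n : LipAlg.BL2 Ω)) ∧
      (∀ n, FiniteDimensional ℂ (P n : LipAlg.BL2 Ω).range) ∧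
      -- `P n ↑ I`
      (Monotone fun n => (P n : LipAlg.BL2 Ω)) ∧
      (∀ x : LipAlg.L2 Ω, Tendsto (fun n => (P n : LipAlg.BL2 Ω) x) atTop (𝓝 x)) ∧
      -- `L(P n) → 0`
      Tendsto (fun n => LipAlg.lipL (P n : LipAlg.BL2 Ω)) atTop (𝓝 0) ∧
      -- `P n` lies in the image of `EΛ(Ω ∩ n𝔻)`
      (∀ n : ℕ, ∃ T ∈ LipAlg.EAlg (Ω ∩ Metric.ball (0 : ℂ) n),
        (P n : LipAlg.BL2 Ω) = LipAlg.inclOp Set.inter_subset_left T) ∧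
      -- `P n` commutes with multiplication by the indicator function of `Ω ∩ m𝔻`
      (∀ n m : ℕ, Commute (P n : LipAlg.BL2 Ω)
        (LipAlg.mulOp (LipAlg.indLinf Ω (Metric.ball (0 : ℂ) m) measurableSet_ball))) ∧
      -- `(P n)` is a bounded approximate unit of `KΛ(Ω)`
      (∃ C : ℝ≥0, ∀ n, LipAlg.triNorm (P n) ≤ C) ∧
      (∀ T ∈ LipAlg.KIdeal Ω,
        Tendsto (fun n => LipAlg.triNorm (P n * T - T)) atTop (𝓝 0) ∧
        Tendsto (fun n => LipAlg.triNorm (T * P n - T)) atTop (𝓝 0)) ∧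
      -- the union of the `P n B(L²(Ω)) P n` is a dense subalgebra of `KΛ(Ω)`
      (∃ D : NonUnitalSubalgebra ℂ (LipAlg.EAlg Ω),
        (fun T : LipAlg.EAlg Ω => (T : LipAlg.BL2 Ω)) '' (D : Set (LipAlg.EAlg Ω)) =
          ⋃ n, Set.range (fun S : LipAlg.BL2 Ω => (P n : LipAlg.BL2 Ω) * S * P n) ∧
        (∀ S ∈ D, S ∈ LipAlg.KIdeal Ω) ∧
        ∀ T ∈ LipAlg.KIdeal Ω, ∀ ε : ℝ≥0∞, 0 < ε →
          ∃ S ∈ D, LipAlg.triNorm (T - S) < ε) := by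
  obtain ⟨P, hP⟩ := LipAlg.exists_isLocalizingSequence Ω
  exact ⟨hP.approxUnit, hP.approxUnit_mem_KIdeal, hP.isStarProjection, hP.finiteDimensional_range,
    hP.monotone, hP.tendsto_apply, hP.tendsto_lipL, hP.exists_inclOp_eq hΩ,
    fun n m => (hP.commute_chiBall m n).symm, ⟨2, hP.triNorm_approxUnit_le⟩,
    fun T hT => ⟨hP.tendsto_triNorm_mul_sub hT, hP.tendsto_triNorm_sub_mul hT⟩,
    LipAlg.cornerUnion P, hP.image_cornerUnion, fun S => hP.mem_KIdeal_of_mem_cornerUnion,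
    fun T hT ε => hP.exists_mem_cornerUnion_triNorm_sub_lt hT⟩
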